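/- Let $G=(V,E)$ be an infinite, connected, locally finite, vertex-transitive graph. Activated random walk (ARW) on $G$ with sleeping rate $\lambda>0$ and density $\mu\in[0,1]$ is the following continuous-time particle system. Initially each vertex, independently, carries one active particle with probability $\mu$ and is empty otherwise. Each active particle performs, independently, a continuous-time random walk with jump rate $1$, each jump being to a uniformly random neighbour. Each active particle also has a Poisson clock of rate $\lambda$; when it rings, the particle falls asleep if it is alone at its vertex, and otherwise nothing happens. A sleeping particle does not move and becomes active as soon as another particle jumps onto its vertex. (The process on $G$ is the limit of the systems in which only the particles inside a finite set $B\subset V$ may act, as $B\uparrow V$.) ARW fixates if each vertex is, from some time on, always empty or occupied by a single sleeping particle; otherwise ARW is active. Let $$\mu_c=\mu_c(\lambda)=\inf\{\mu\in[0,1] : P_\mu(\text{ARW is active})>0\},$$ with $\inf\emptyset=+\infty$. Let $(X_t)_{t\in\mathbb N}$ be a discrete-time simple random walk on $G$ started at a vertex $o$, and let $|X_t|$ be the graph distance from $o$ to $X_t$. Suppose that the walk has positive speed, i.e. $\liminf_{t\to\infty}|X_t|/t>0$ almost surely. Then $$\mu_c(\lambda)<1\qquad\text{for all }\lambda>0 .$$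 More specifically, if the speed is $\alpha$, i.e. $\liminf_{t\to\infty}|X_t|/t=\alpha$ almost surely, then for all $\lambda>0$ $$\mu_c(\lambda)<1-\frac{\alpha\,\delta}{1+\lambda},\qquad \delta=P(X_t\neq o\text{ for all }t\ge 1).$$ -/

import Mathlib

open MeasureTheory ProbabilityTheory Filter
open scoped NNReal ENNReal

/-- Any two vertices are related by a graph automorphism. -/
def IsVertexTransitive {V : Type*} (G : SimpleGraph V) : Prop :=
  ∀ u v : V, ∃ φ : G ≃g G, φ u = v

/-! ### Simple random walk -/

/-- `X` is a discrete-time simple random walk on `G` started at `o`: the probability of following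
a given trajectory `p 0, …, p n` is the product of the one-step probabilities
`1 / deg (p i)` along edges (and `0` if the trajectory does not start at `o` or does not
follow edges). -/
structure IsSimpleRandomWalk {V : Type*} (G : SimpleGraph V) [G.LocallyFinite] (o : V)
    {Ω : Type*} [MeasurableSpace Ω] (P : Measure Ω) (X : ℕ → Ω → V) : Prop where
  measurable : ∀ (n : ℕ) (v : V), MeasurableSet {ω | X n ω = v}
  start : ∀ᵐ ω ∂P, X 0 ω = o
  path : ∀ (n : ℕ) (p : ℕ → V), p 0 = o → (∀ i < n, G.Adj (p i) (p (i + 1))) →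
    P {ω | ∀ i ≤ n, X i ω = p i} = ∏ i ∈ Finset.range n, ((G.degree (p i) : ℝ≥0∞))⁻¹

/-- `liminf_{t → ∞} |X_t| / t`, where `|·|` is the graph distance to `o`. -/
noncomputable def lowerSpeed {V : Type*} (G : SimpleGraph V) (o : V) (x : ℕ → V) : ℝ :=
  liminf (fun t : ℕ => (G.dist o (x t) : ℝ) / t) atTop

namespace ARW

/-! ### Configurations and instructions -/

/-- The state of a vertex: one sleeping particle, or `k ≥ 0` active particles
(`active 0` is the empty vertex). -/
inductive SiteState
  | sleeping
  | active (k : ℕ)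

instance : MeasurableSpace SiteState := ⊤

/-- The number of active particles. -/
def SiteState.numActive : SiteState → ℕ
  | sleeping => 0
  | active k => k

/-- A particle arrives; a sleeping particle is woken up. -/
def SiteState.add : SiteState → SiteState
  | sleeping => active 2
  | active k => active (k + 1)

/-- An active particle, if there is one, leaves. -/
def SiteState.remove : SiteState → SiteState
  | sleeping => sleeping
  | active k => active (k - 1)

/-- An active particle tries to fall asleep; it succeeds only if it is alone. -/
def SiteState.sleep : SiteState → SiteState
  | active 1 => sleeping
  | s => s

/-- What an active particle does when its clock rings. -/
inductive Instruction (V : Type*)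
  | sleep
  | jump (y : V)

instance {V : Type*} : MeasurableSpace (Instruction V) := ⊤

open Classical in
/-- The effect of an instruction carried out at a vertex `x`. -/
noncomputable def Instruction.perform {V : Type*} (x : V) :
    Instruction V → (V → SiteState) → (V → SiteState)
  | sleep, η => Function.update η x (η x).sleep
  | jump y, η =>
      let η' := Function.update η x (η x).remove
      Function.update η' y (η' y).add

/-! ### Randomness -/

open Classical in
/-- The uniform distribution on the neighbours of `x` (with an irrelevant convention
for isolated vertices). -/
noncomputable def neighborLaw {V : Type*} (G : SimpleGraph V) [G.LocallyFinite] (x : V) : PMF V :=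
  if h : (G.neighborFinset x).Nonempty then PMF.uniformOfFinset (G.neighborFinset x) h
  else PMF.pure x

/-- Sleep with probability `λ / (1 + λ)`; jump to a uniform neighbour with probability
`1 / (1 + λ)`. -/
noncomputable def instructionLaw {V : Type*} (G : SimpleGraph V) [G.LocallyFinite] (lam : ℝ≥0)
    (x : V) : Measure (Instruction V) :=
  (lam / (1 + lam)) • Measure.dirac Instruction.sleep +
    (1 / (1 + lam)) • ((neighborLaw G x).map Instruction.jump).toMeasure

instance {V : Type*} (G : SimpleGraph V) [G.LocallyFinite] (lam : ℝ≥0) (x : V) :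
    IsProbabilityMeasure (instructionLaw G lam x) where
  measure_univ := by
    have h : lam / (1 + lam) + 1 / (1 + lam) = 1 := by
      rw [← add_div, add_comm lam 1, div_self (by positivity)]
    simp only [instructionLaw, Measure.add_apply, Measure.smul_apply, measure_univ,
      ENNReal.smul_def, smul_eq_mul, mul_one]
    rw [← ENNReal.coe_add, h, ENNReal.coe_one]

instance (lam : ℝ≥0) : IsProbabilityMeasure (expMeasure (1 + (lam : ℝ))) :=
  isProbabilityMeasure_expMeasure (by positivity)

/-- A realisation of the randomness.
* `init x` is the state of `x` at time `0`;
* `instr (x, j)` is the `j`-th instruction to be used at `x`;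
* the `i`-th active particle at `x` is served by a Poisson clock whose consecutive waiting times
  are `gap (x, i, 0), gap (x, i, 1), …`. -/
abbrev Sample (V : Type*) :=
  (V → SiteState) × (V × ℕ → Instruction V) × (V × ℕ × ℕ → ℝ)

variable {V : Type*}

/-- The initial state of `x`. -/
def Sample.init (ω : Sample V) : V → SiteState := ω.1

/-- The stacks of instructions. -/
def Sample.instr (ω : Sample V) : V × ℕ → Instruction V := ω.2.1

/-- The waiting times of the clocks. -/
def Sample.gap (ω : Sample V) : V × ℕ × ℕ → ℝ := ω.2.2

/-- All coordinates are independent. Initially each vertex carries one active particle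
with probability `μ` and is empty otherwise; the clocks are Poisson of rate `1 + λ`
(rate `1` for jumping plus rate `λ` for sleeping), the kind of each ring being given by the
instructions. -/
noncomputable def law (G : SimpleGraph V) [G.LocallyFinite] (lam : ℝ≥0) (μ : unitInterval) :
    Measure (Sample V) :=
  (Measure.infinitePi fun _ : V =>
      bernoulliMeasure (SiteState.active 1) (SiteState.active 0) μ).prod
    ((Measure.infinitePi fun p : V × ℕ => instructionLaw G lam p.1).prod
      (Measure.infinitePi fun _ : V × ℕ × ℕ => expMeasure (1 + (lam : ℝ))))

/-! ### The continuous-time dynamics -/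

/-- The time of ring `k` of the clock serving the `i`-th active particle at `x`. -/
noncomputable def ringTime (ω : Sample V) (r : V × ℕ × ℕ) : ℝ :=
  ∑ j ∈ Finset.range (r.2.2 + 1), ω.gap (r.1, r.2.1, j)

/-- The state of the system: current time, current configuration, and number of instructions
already used at each vertex. -/
structure Snapshot (V : Type*) where
  time : ℝ
  config : V → SiteState
  used : V → ℕ

/-- The system at time `0`. -/
def start (ω : Sample V) : Snapshot V := ⟨0, ω.init, fun _ => 0⟩

/-- The ring `r` comes after the current time, and it is a ring of the clock of a particle which
is currently active and located in `B`. -/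
def IsEffective (ω : Sample V) (B : Finset V) (s : Snapshot V) (r : V × ℕ × ℕ) : Prop :=
  r.1 ∈ B ∧ r.2.1 < (s.config r.1).numActive ∧ s.time < ringTime ω r

/-- The first effective ring. -/
def IsNextRing (ω : Sample V) (B : Finset V) (s : Snapshot V) (r : V × ℕ × ℕ) : Prop :=
  IsEffective ω B s r ∧ ∀ r', IsEffective ω B s r' → ringTime ω r ≤ ringTime ω r'

open Classical in
/-- At time `ringTime ω (x, i, k)`, the next instruction at `x` is carried out. -/
noncomputable def ring (ω : Sample V) (s : Snapshot V) (r : V × ℕ × ℕ) : Snapshot V where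
  time := ringTime ω r
  config := (ω.instr (r.1, s.used r.1)).perform r.1 s.config
  used := Function.update s.used r.1 (s.used r.1 + 1)

open Classical in
/-- Let the system in which only the particles in `B` can act evolve until its next effective ring,
provided that this ring occurs by time `t`. -/
noncomputable def advance (ω : Sample V) (B : Finset V) (t : ℝ) (s : Snapshot V) : Snapshot V :=
  if h : ∃ r, IsNextRing ω B s r ∧ ringTime ω r ≤ t then ring ω s h.choose else s

/-- In activated random walk driven by `ω`, the state of vertex `x` at time `t` is `a`.
For a finite set `B`, let only the particles in `B` act (particles leaving `B` are frozen);
almost surely there are finitely many effective rings up to time `t`, and carrying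
them all out gives the configuration at time `t`. The process on the whole graph is the limit
of these finite systems as `B` increases to `V`. -/
def HasState (ω : Sample V) (t : ℝ) (x : V) (a : SiteState) : Prop :=
  ∀ᶠ B : Finset V in atTop, ∀ᶠ m : ℕ in atTop,
    ((advance ω B t)^[m] (start ω)).config x = a

/-- The process is active, i.e. does not fixate: it is not the case that every vertex is stable
(empty, or holding a sleeping particle) from some time on. In other words, some vertex holds an
active particle at arbitrarily large times. Realisations for which a state is not defined (a null
event) are not counted as active. -/
def IsActive (ω : Sample V) : Prop :=
  ∃ x : V, ∀ T : ℝ, ∃ t ≥ T, ∃ k ≥ 1, HasState ω t x (SiteState.active k)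

/-- The critical density `inf {μ : P_μ(ARW is active) > 0}`; the infimum is taken in the extended
reals, so that it would be `⊤` if there were no such `μ`. -/
noncomputable def criticalDensity (G : SimpleGraph V) [G.LocallyFinite] (lam : ℝ≥0) : EReal :=
  sInf {m : EReal | ∃ μ : unitInterval,
    0 < law G lam μ {ω | IsActive ω} ∧ m = ((μ : ℝ) : EReal)}

end ARW

/-! Suppose that at density `μ` the process is almost surely not active. Since the final effect of
legal topplings does not depend on their order, a process that fixates dominates every legal
sequence of topplings: all their odometers lie below one finite field `U` (`exists_odometer_bound`,
from the least action principle `Reach.le_of_stable`, monotonicity in the finite system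
`Valid.used_le`, and non-explosion `ae_nonExplosive`). Hence the number of particles that any legal
procedure can gather at `o` is bounded by a finite random variable that does not depend on the
procedure (`exists_arrived_le`).

A procedure gathering linearly many particles contradicts this. Sweep the vertices of the ball of
radius `L` by decreasing distance to `o`, releasing the particle found at each vertex `z`. Its first
instruction is a sleep with probability `λ/(1+λ)`, and it is then given up. Otherwise it walks until
it hits `o`, gets to distance at least `dist o z`, meets a vacant vertex and settles there, or runs
out of its `K ≈ cL` jumps. While it walks it always shares its vertex with another active particle,
so further sleep instructions have no effect.

If no vacant vertex ever stopped a particle, the expected number of arrivals `A` would be some `R`.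
A vacant vertex `y` costs at most `h y`, a bound for the probability of hitting `o` from `y`.
Initially a vertex is vacant with probability `1-μ`, so `E A ≥ R - (1-μ)W` up to a bounded error,
with `W` the sum of `h` (submartingale `lowerPotential`). A supermartingale gives `E A² ≤ R² + R`
(`squarePotential`). As `R = O(L)` and `A` is bounded outside an event of small probability, `E A =
o(L)`; all this is combined in `IsHitting.sum_yield_le`.

`R` and `W` are computed by reversibility: hitting probabilities of `o` are Green functions of the
walk started at `o` and killed on its return (`isHitting_green`). Summed over the sphere of radius
`k`, they give the probability of reaching this sphere before returning, so `R ≥ L(δ - b)/(1+λ)`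
with `b` bounding the probability of being too slow (`le_sum_yield`). Summed over the ball, they
give the expected time before returning, so `W` is at most about `cLδ` (`sum_dom_le`,
`eventually_sum_noReturn_le`). A contradiction arises when `(1-μ)δc < (δ-b)/(1+λ)`
(`law_isActive_pos`). For constant speed `α`, `b` can be arbitrarily small and `c` arbitrarily close
to `1/α`; `δ` cancels, so every density above `1 - α/(1+λ)` is active. As `δ < 1`, this yields the
strict inequality. If the speed is only positive, `c` is chosen with `b = δ/2`. -/

namespace ARW

variable {V : Type*}

/-! ### Legal topplings -/

/-- The number of particles at a vertex. -/
def SiteState.total : SiteState → ℕ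
  | sleeping => 1
  | active k => k

lemma SiteState.numActive_le_total (s : SiteState) : s.numActive ≤ s.total := by
  cases s <;> simp [numActive, total]

lemma SiteState.total_add (s : SiteState) : s.add.total = s.total + 1 := by
  cases s <;> simp [add, total]

lemma SiteState.numActive_add (s : SiteState) : s.numActive + 1 ≤ s.add.numActive := by
  cases s <;> simp [add, numActive]

lemma SiteState.add_ne_sleeping (s : SiteState) : s.add ≠ sleeping := by
  cases s <;> simp [add]

lemma SiteState.total_sleep (s : SiteState) : s.sleep.total = s.total := by
  rcases s with _ | _ | _ | k <;> simp [sleep, total]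

lemma SiteState.sleep_eq_self {s : SiteState} (h : 2 ≤ s.numActive) : s.sleep = s := by
  rcases s with _ | _ | _ | k <;> simp_all [sleep, numActive]

open Classical in
/-- The configuration `η` and the odometer `u` can be reached by carrying out instructions at
vertices holding active particles, in some order. -/
inductive Reach (ω : Sample V) : (V → SiteState) → (V → ℕ) → Prop
  | init : Reach ω ω.init (fun _ => 0)
  | topple {η : V → SiteState} {u : V → ℕ} (x : V) (h : Reach ω η u)
      (hx : 1 ≤ (η x).numActive) :
      Reach ω ((ω.instr (x, u x)).perform x η) (Function.update u x (u x + 1))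

/-- The randomness of the initial state and of the instructions is not degenerate. -/
structure Regular (G : SimpleGraph V) (ω : Sample V) : Prop where
  init : ∀ x, ω.init x = .active 0 ∨ ω.init x = .active 1
  adj : ∀ x j y, ω.instr (x, j) = .jump y → G.Adj x y

open Classical in
/-- The number of jumps among the first `n` instructions at `x`. -/
noncomputable def jumpsOut (ω : Sample V) (x : V) (n : ℕ) : ℕ :=
  ((Finset.range n).filter fun j => ω.instr (x, j) ≠ .sleep).card

open Classical in
/-- The number of jumps to `x` among the first `n` instructions at `y`. -/
noncomputable def jumpsInto (ω : Sample V) (y x : V) (n : ℕ) : ℕ :=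
  ((Finset.range n).filter fun j => ω.instr (y, j) = .jump x).card

lemma jumpsInto_le (ω : Sample V) (y x : V) (n : ℕ) : jumpsInto ω y x n ≤ n := by
  classical
  simpa [jumpsInto] using Finset.card_filter_le (Finset.range n) fun j => ω.instr (y, j) = .jump x

lemma jumpsInto_mono (ω : Sample V) (y x : V) : Monotone (jumpsInto ω y x) := by
  classical
  intro m n h
  exact Finset.card_le_card (Finset.filter_subset_filter _ (Finset.range_mono h))

lemma jumpsInto_succ (ω : Sample V) (y x : V) (n : ℕ) [Decidable (ω.instr (y, n) = .jump x)] :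
    jumpsInto ω y x (n + 1) = jumpsInto ω y x n + if ω.instr (y, n) = .jump x then 1 else 0 := by
  classical
  simp only [jumpsInto, Finset.range_add_one, Finset.filter_insert]
  split_ifs <;> simp

lemma jumpsOut_succ (ω : Sample V) (x : V) (n : ℕ) [Decidable (ω.instr (x, n) = .sleep)] :
    jumpsOut ω x (n + 1) = jumpsOut ω x n + if ω.instr (x, n) = .sleep then 0 else 1 := by
  classical
  simp only [jumpsOut, Finset.range_add_one, Finset.filter_insert]
  split_ifs <;> simp_all

variable {G : SimpleGraph V} {ω : Sample V}

/-- A sleep carried out by a lone particle leaves it sleeping, and otherwise at least two active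
particles are present; later arrivals, before the next toppling at `x`, turn the former into two
active particles and only increase the latter. -/
lemma Reach.not_sleeping_of_sleep_last {η : V → SiteState} {u : V → ℕ}
    (h : Reach ω η u) (x : V) (n : ℕ) (hn : u x = n + 1) (hs : ω.instr (x, n) = .sleep) (k : ℕ)
    (hk : k < 2) : η x ≠ .active k := by
  classical
  induction h generalizing n k with
  | init => simp at hn
  | @topple η u z h hz ih =>
    by_cases hzx : z = x
    · subst hzx
      simp at hn
      subst hn
      rw [hs]
      simp only [Instruction.perform, Function.update_self]
      rcases hη : η z with _ | _ | _ | m <;> simp_all [SiteState.sleep, SiteState.numActive]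
      omega
    · rw [Function.update_of_ne (Ne.symm hzx)] at hn
      have h0 := ih n hn hs 0 (by omega)
      have h1 := ih n hn hs 1 (by omega)
      cases hi : ω.instr (z, u z) with
      | sleep =>
        simp only [Instruction.perform]
        rw [Function.update_of_ne (Ne.symm hzx)]
        exact ih n hn hs k hk
      | jump y =>
        simp only [Instruction.perform]
        by_cases hyx : x = y
        · subst hyx
          rw [Function.update_self, Function.update_of_ne (Ne.symm hzx)]
          rcases hη : η x with _ | m
          · simp only [SiteState.add, ne_eq, SiteState.active.injEq]
            omega
          · have : m ≠ 0 := fun h => h0 (by rw [hη, h])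
            simp only [SiteState.add, ne_eq, SiteState.active.injEq]
            omega
        · rw [Function.update_of_ne hyx, Function.update_of_ne (Ne.symm hzx)]
          exact ih n hn hs k hk

/-- Converse of the preceding lemma: initially nobody sleeps, an arrival wakes a sleeper, and a
toppling needs an active particle, so a sleeper must come from the last instruction used at its
vertex. -/
lemma Reach.sleep_last_of_sleeping (hω : Regular G ω) {η : V → SiteState} {u : V → ℕ}
    (h : Reach ω η u) (x : V) (hx : η x = .sleeping) :
    ∃ n, u x = n + 1 ∧ ω.instr (x, n) = .sleep := by
  classical
  induction h with
  | init => rcases hω.init x with h | h <;> simp [h] at hx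
  | @topple η u z h hz ih =>
    cases hi : ω.instr (z, u z) with
    | sleep =>
      by_cases hzx : z = x
      · subst hzx
        exact ⟨u z, by simp, hi⟩
      · rw [hi] at hx
        simp only [Instruction.perform, Function.update_of_ne (Ne.symm hzx)] at hx ⊢
        exact ih hx
    | jump y =>
      rw [hi] at hx
      simp only [Instruction.perform] at hx
      have hyx : x ≠ y := by
        rintro rfl
        rw [Function.update_self] at hx
        exact SiteState.add_ne_sleeping _ hx
      rw [Function.update_of_ne hyx] at hx
      by_cases hzx : z = x
      · subst hzx
        rw [Function.update_self] at hx
        rcases hη : η z with _ | m <;> simp_all [SiteState.remove, SiteState.numActive]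
      · rw [Function.update_of_ne (Ne.symm hzx)] at hx ⊢
        exact ih hx

/-- Conservation of particles at `x`. -/
lemma Reach.total_eq [G.LocallyFinite] (hω : Regular G ω) {η : V → SiteState} {u : V → ℕ}
    (h : Reach ω η u) (x : V) :
    (η x).total + jumpsOut ω x (u x) =
      (ω.init x).total + ∑ y ∈ G.neighborFinset x, jumpsInto ω y x (u y) := by
  classical
  induction h with
  | init => simp [jumpsOut, jumpsInto]
  | @topple η u z h hz ih =>
    by_cases hzx : z = x
    · subst hzx
      have hs : ∑ y ∈ G.neighborFinset z, jumpsInto ω y z (Function.update u z (u z + 1) y) =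
          ∑ y ∈ G.neighborFinset z, jumpsInto ω y z (u y) := by
        refine Finset.sum_congr rfl fun y hy => ?_
        rw [Function.update_of_ne]
        rintro rfl
        simp at hy
      rw [hs, ← ih, Function.update_self, jumpsOut_succ]
      cases hi : ω.instr (z, u z) with
      | sleep => simp [Instruction.perform, SiteState.total_sleep]
      | jump y =>
        have hne : z ≠ y := (hω.adj _ _ _ hi).ne
        simp only [Instruction.perform, Function.update_of_ne hne, Function.update_self]
        rcases hη : η z with _ | m <;>
          simp_all [SiteState.remove, SiteState.total, SiteState.numActive]
        omega
    · have hs : ∑ y ∈ G.neighborFinset x, jumpsInto ω y x (Function.update u z (u z + 1) y) =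
          ∑ y ∈ G.neighborFinset x, jumpsInto ω y x (u y) +
            if ω.instr (z, u z) = .jump x then 1 else 0 := by
        by_cases hj : ω.instr (z, u z) = .jump x
        · have hmem : z ∈ G.neighborFinset x := by
            simpa using (hω.adj _ _ _ hj).symm
          rw [← Finset.add_sum_erase _ _ hmem, ← Finset.add_sum_erase _ (fun y =>
            jumpsInto ω y x (u y)) hmem, Function.update_self, jumpsInto_succ]
          have : ∀ y ∈ (G.neighborFinset x).erase z,
              jumpsInto ω y x (Function.update u z (u z + 1) y) = jumpsInto ω y x (u y) := by
            intro y hy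
            rw [Function.update_of_ne (Finset.ne_of_mem_erase hy)]
          rw [Finset.sum_congr rfl this]
          ring
        · rw [if_neg hj, add_zero]
          refine Finset.sum_congr rfl fun y hy => ?_
          by_cases hyz : y = z
          · subst hyz
            rw [Function.update_self, jumpsInto_succ, if_neg hj, add_zero]
          · rw [Function.update_of_ne hyz]
      rw [hs, ← add_assoc, ← ih, Function.update_of_ne (Ne.symm hzx)]
      cases hi : ω.instr (z, u z) with
      | sleep => simp [Instruction.perform, Function.update_of_ne (Ne.symm hzx)]
      | jump y =>
        simp only [Instruction.perform]
        by_cases hyx : x = y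
        · subst hyx
          rw [Function.update_self, Function.update_of_ne (Ne.symm hzx), SiteState.total_add]
          simp
          ring
        · rw [Function.update_of_ne hyx, Function.update_of_ne (Ne.symm hzx)]
          simp [Ne.symm hyx]

lemma Reach.total_le [G.LocallyFinite] (hω : Regular G ω) {η : V → SiteState} {u : V → ℕ}
    (h : Reach ω η u) (x : V) : (η x).total ≤ 1 + ∑ y ∈ G.neighborFinset x, u y := by
  have h1 := h.total_eq hω x
  have h2 : (ω.init x).total ≤ 1 := by rcases hω.init x with h | h <;> simp [h, SiteState.total]
  have h3 : ∑ y ∈ G.neighborFinset x, jumpsInto ω y x (u y) ≤ ∑ y ∈ G.neighborFinset x, u y :=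
    Finset.sum_le_sum fun y _ => jumpsInto_le _ _ _ _
  omega

/-- The two preceding lemmas make the state at `x` a function of the last instruction used there and
of the number of particles. The instruction is common to both sides since `u x = u' x`, and the
function is monotone in the number of particles. -/
lemma Reach.numActive_le_of_total_le (hω : Regular G ω) {η η' : V → SiteState} {u u' : V → ℕ}
    (h : Reach ω η u) (h' : Reach ω η' u') {x : V} (hx : u x = u' x)
    (ht : (η x).total ≤ (η' x).total) : (η x).numActive ≤ (η' x).numActive := by
  rcases hη : η x with _ | k
  · simp [SiteState.numActive]
  rcases hη' : η' x with _ | k'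
  · obtain ⟨n, hn, hs⟩ := h'.sleep_last_of_sleeping hω x hη'
    have := h.not_sleeping_of_sleep_last x n (by omega) hs k
    rw [hη, hη'] at ht
    simp only [SiteState.total] at ht
    exact absurd hη (this (by omega))
  · simpa [hη, hη', SiteState.total, SiteState.numActive] using ht

/-- At equal odometer values at `x`, more topplings elsewhere means more active particles at `x`. -/
lemma Reach.numActive_mono [G.LocallyFinite] (hω : Regular G ω) {η η' : V → SiteState}
    {u u' : V → ℕ} (h : Reach ω η u) (h' : Reach ω η' u') {x : V} (hx : u x = u' x)
    (hu : ∀ y, G.Adj x y → jumpsInto ω y x (u y) ≤ jumpsInto ω y x (u' y)) :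
    (η x).numActive ≤ (η' x).numActive := by
  refine h.numActive_le_of_total_le hω h' hx ?_
  have h1 := h.total_eq hω x
  have h2 := h'.total_eq hω x
  have h3 : ∑ y ∈ G.neighborFinset x, jumpsInto ω y x (u y) ≤
      ∑ y ∈ G.neighborFinset x, jumpsInto ω y x (u' y) :=
    Finset.sum_le_sum fun y hy => hu y (by simpa using hy)
  rw [hx] at h1
  omega

/-- The state at `x` is determined by the odometer at `x` and at its neighbours. -/
lemma Reach.config_eq [G.LocallyFinite] (hω : Regular G ω) {η η' : V → SiteState}
    {u u' : V → ℕ} (h : Reach ω η u) (h' : Reach ω η' u') {x : V} (hx : u x = u' x)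
    (hu : ∀ y, G.Adj x y → u y = u' y) : η x = η' x := by
  have ht : (η x).total = (η' x).total := by
    have h1 := h.total_eq hω x
    have h2 := h'.total_eq hω x
    have h3 : ∑ y ∈ G.neighborFinset x, jumpsInto ω y x (u y) =
        ∑ y ∈ G.neighborFinset x, jumpsInto ω y x (u' y) :=
      Finset.sum_congr rfl fun y hy => by rw [hu y (by simpa using hy)]
    rw [hx] at h1
    omega
  have h1 := h.numActive_le_of_total_le hω h' hx ht.le
  have h2 := h'.numActive_le_of_total_le hω h hx.symm ht.ge
  rcases hη : η x with _ | k <;> rcases hη' : η' x with _ | k' <;>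
    simp_all [SiteState.total, SiteState.numActive]

/-- The least action principle. -/
lemma Reach.le_of_stable [G.LocallyFinite] (hω : Regular G ω) {η η' : V → SiteState}
    {u u' : V → ℕ} (h : Reach ω η u) (h' : Reach ω η' u') (B : Set V)
    (hB : ∀ x, u x ≠ 0 → x ∈ B) (hst : ∀ x ∈ B, (η' x).numActive = 0) : ∀ x, u x ≤ u' x := by
  classical
  induction h with
  | init => simp
  | @topple η u z h hz ih =>
    have ih' := ih fun x hx => hB x <| by
      by_cases hxz : x = z
      · subst hxz; simp
      · rwa [Function.update_of_ne hxz]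
    intro x
    by_cases hxz : x = z
    · subst hxz
      rw [Function.update_self]
      -- The first toppling that makes `u` exceed `u'` occurs at a vertex where the two agree; by
      -- monotonicity that vertex would be active in `η'`, although `η'` is stable there.
      by_contra hlt
      have heq : u x = u' x := le_antisymm (ih' x) (by omega)
      have := h.numActive_mono hω h' heq fun y _ => jumpsInto_mono ω y x (ih' y)
      have h0 := hst x (hB x (by simp))
      omega
    · rw [Function.update_of_ne hxz]
      exact ih' x

end ARW

namespace ARW

variable {V : Type*}

/-! ### Lists of rings -/

/-- The system after the rings of a list have occurred (latest ring first). -/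
noncomputable def after (ω : Sample V) : List (V × ℕ × ℕ) → Snapshot V
  | [] => start ω
  | r :: l => ring ω (after ω l) r

/-- The list consists of the first rings of the system restricted to `B`. -/
def Valid (ω : Sample V) (B : Finset V) : List (V × ℕ × ℕ) → Prop
  | [] => True
  | r :: l => Valid ω B l ∧ IsNextRing ω B (after ω l) r

/-- The properties of the clocks that hold almost surely. -/
structure Clocks (ω : Sample V) : Prop where
  gap_pos : ∀ c, 0 < ω.gap c
  injective : Function.Injective (ringTime ω)
  tendsto : ∀ x i, Tendsto (fun k => ringTime ω (x, i, k)) atTop atTop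

variable {G : SimpleGraph V} {ω : Sample V} {B B' : Finset V}

lemma Valid.reach {l : List (V × ℕ × ℕ)} (h : Valid ω B l) :
    Reach ω (after ω l).config (after ω l).used := by
  induction l with
  | nil => exact Reach.init
  | cons r l ih =>
    have := h.2.1.2.1
    exact Reach.topple r.1 (ih h.1) (by omega)

lemma after_used_self (r : V × ℕ × ℕ) (l : List (V × ℕ × ℕ)) :
    (after ω (r :: l)).used r.1 = (after ω l).used r.1 + 1 := by
  simp [after, ring]

lemma after_used_of_ne (r : V × ℕ × ℕ) (l : List (V × ℕ × ℕ)) {x : V} (h : x ≠ r.1) :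
    (after ω (r :: l)).used x = (after ω l).used x := by
  simp [after, ring, h]

lemma after_used_le_cons (r : V × ℕ × ℕ) (l : List (V × ℕ × ℕ)) (x : V) :
    (after ω l).used x ≤ (after ω (r :: l)).used x := by
  by_cases h : x = r.1
  · subst h
    rw [after_used_self]
    omega
  · rw [after_used_of_ne r l h]

lemma after_used_mono {l l' : List (V × ℕ × ℕ)} (h : l <:+ l') (x : V) :
    (after ω l).used x ≤ (after ω l').used x := by
  obtain ⟨m, rfl⟩ := h
  induction m with
  | nil => exact le_rfl
  | cons r m ih => exact ih.trans (after_used_le_cons r _ x)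

lemma Valid.of_suffix {l l' : List (V × ℕ × ℕ)} (h : Valid ω B l') (hs : l <:+ l') :
    Valid ω B l := by
  obtain ⟨m, rfl⟩ := hs
  induction m with
  | nil => exact h
  | cons r m ih => exact ih h.1

lemma Valid.time_lt {l : List (V × ℕ × ℕ)} {r : V × ℕ × ℕ} (h : Valid ω B (r :: l)) :
    (after ω l).time < ringTime ω r := h.2.1.2.2

lemma after_cons_time (l : List (V × ℕ × ℕ)) (r : V × ℕ × ℕ) :
    (after ω (r :: l)).time = ringTime ω r := rfl

lemma Valid.ringTime_le {l : List (V × ℕ × ℕ)} (h : Valid ω B l) {r : V × ℕ × ℕ} (hr : r ∈ l) :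
    ringTime ω r ≤ (after ω l).time := by
  induction l with
  | nil => simp at hr
  | cons r' l ih =>
    rcases List.mem_cons.1 hr with rfl | hr
    · exact le_rfl
    · exact (ih h.1 hr).trans h.time_lt.le

lemma Valid.time_nonneg {l : List (V × ℕ × ℕ)} (h : Valid ω B l) : 0 ≤ (after ω l).time := by
  induction l with
  | nil => exact le_rfl
  | cons r l ih => exact (ih h.1).trans h.time_lt.le

lemma Valid.nodup {l : List (V × ℕ × ℕ)} (h : Valid ω B l) : l.Nodup := by
  induction l with
  | nil => exact List.nodup_nil
  | cons r l ih =>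
    refine List.nodup_cons.2 ⟨fun hr => ?_, ih h.1⟩
    exact absurd (h.1.ringTime_le hr) (not_le.2 h.time_lt)

lemma Valid.mem {l : List (V × ℕ × ℕ)} (h : Valid ω B l) {r : V × ℕ × ℕ} (hr : r ∈ l) :
    r.1 ∈ B := by
  induction l with
  | nil => simp at hr
  | cons r' l ih =>
    rcases List.mem_cons.1 hr with rfl | hr
    · exact h.2.1.1
    · exact ih h.1 hr

lemma Valid.length_eq {l : List (V × ℕ × ℕ)} (h : Valid ω B l) :
    l.length = ∑ x ∈ B, (after ω l).used x := by
  classical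
  induction l with
  | nil => simp [after, start]
  | cons r l ih =>
    have hr : r.1 ∈ B := h.2.1.1
    rw [← Finset.add_sum_erase _ _ hr, after_used_self, List.length_cons, ih h.1,
      ← Finset.add_sum_erase _ _ hr]
    have : ∀ x ∈ B.erase r.1, (after ω (r :: l)).used x = (after ω l).used x := fun x hx =>
      after_used_of_ne r l (Finset.ne_of_mem_erase hx)
    rw [Finset.sum_congr rfl this]
    ring

lemma sum_total_perform_le (i : Instruction V) (x : V) (hx : x ∈ B) (η : V → SiteState)
    (h : 1 ≤ (η x).numActive) (hi : i ≠ .jump x) :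
    ∑ z ∈ B, (i.perform x η z).total ≤ ∑ z ∈ B, (η z).total := by
  classical
  cases i with
  | sleep =>
    refine Finset.sum_le_sum fun z _ => ?_
    by_cases hz : z = x
    · subst hz
      simp [Instruction.perform, SiteState.total_sleep]
    · simp [Instruction.perform, Function.update_of_ne hz]
  | jump y =>
    have hyx : y ≠ x := fun h => hi (by rw [h])
    have hrem : (η x).remove.total + 1 = (η x).total := by
      rcases hη : η x with _ | m <;>
        simp_all [SiteState.remove, SiteState.total, SiteState.numActive]
    have hz : ∀ z ∈ B, ((Instruction.jump y).perform x η z).total + (if z = x then 1 else 0) =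
        (η z).total + if z = y then 1 else 0 := by
      intro z _
      simp only [Instruction.perform]
      by_cases hzy : z = y
      · subst hzy
        rw [Function.update_self, Function.update_of_ne hyx, SiteState.total_add]
        simp [hyx]
      · rw [Function.update_of_ne hzy]
        by_cases hzx : z = x
        · subst hzx
          rw [Function.update_self]
          simp [hzy, hrem]
        · rw [Function.update_of_ne hzx]
          simp [hzy, hzx]
    have := Finset.sum_congr rfl hz
    rw [Finset.sum_add_distrib, Finset.sum_add_distrib, Finset.sum_ite_eq', Finset.sum_ite_eq',
      if_pos hx] at this
    split_ifs at this <;> omega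

/-- Only vertices of `B` are toppled, so particles may leave `B` but never enter it, and initially
there is at most one per vertex. -/
lemma Valid.total_le (hω : Regular G ω) {l : List (V × ℕ × ℕ)} (h : Valid ω B l) :
    ∑ z ∈ B, ((after ω l).config z).total ≤ B.card := by
  induction l with
  | nil =>
    rw [Finset.card_eq_sum_ones]
    refine Finset.sum_le_sum fun z _ => ?_
    rcases hω.init z with h | h <;> simp [after, start, h, SiteState.total]
  | cons r l ih =>
    refine le_trans ?_ (ih h.1)
    refine sum_total_perform_le _ r.1 h.2.1.1 _ ?_ fun hj => (hω.adj _ _ _ hj).ne rfl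
    have := h.2.1.2.1
    omega

lemma Valid.numActive_le (hω : Regular G ω) {l : List (V × ℕ × ℕ)} (h : Valid ω B l) {x : V}
    (hx : x ∈ B) : ((after ω l).config x).numActive ≤ B.card :=
  (SiteState.numActive_le_total _).trans <|
    (Finset.single_le_sum (f := fun z => ((after ω l).config z).total) (fun _ _ => Nat.zero_le _)
      hx).trans (h.total_le hω)

lemma Clocks.finite_rings (hc : Clocks ω) (B : Finset V) (n : ℕ) (t : ℝ) :
    {r : V × ℕ × ℕ | r.1 ∈ B ∧ r.2.1 < n ∧ ringTime ω r ≤ t}.Finite := by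
  have hK : ∀ p : V × ℕ, ∃ K, ∀ k, ringTime ω (p.1, p.2, k) ≤ t → k < K := by
    intro p
    obtain ⟨K, hK⟩ := ((hc.tendsto p.1 p.2).eventually_gt_atTop t).exists_forall_of_atTop
    refine ⟨K, fun k hk => ?_⟩
    by_contra hlt
    exact absurd (hK k (by omega)) (not_lt.2 hk)
  choose K hK using hK
  have hfin : (⋃ p ∈ B ×ˢ Finset.range n, (fun k => (p.1, p.2, k)) '' Set.Iio (K p)).Finite := by
    refine Set.Finite.biUnion (Finset.finite_toSet _) fun p _ => ?_
    exact (Set.finite_Iio _).image _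
  refine hfin.subset ?_
  rintro ⟨x, i, k⟩ ⟨h1, h2, h3⟩
  simp only [Set.mem_iUnion]
  exact ⟨(x, i), by simpa using ⟨h1, h2⟩, k, hK (x, i) k h3, rfl⟩

/-- A first effective ring exists because only finitely many clocks are in use in `B` and each has
finitely many rings before a given time. -/
lemma Valid.exists_next (hω : Regular G ω) (hc : Clocks ω) {l : List (V × ℕ × ℕ)}
    (h : Valid ω B l) {r : V × ℕ × ℕ} (hr : IsEffective ω B (after ω l) r) :
    ∃ r', Valid ω B (r' :: l) ∧ ringTime ω r' ≤ ringTime ω r := by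
  have hfin : {r' | IsEffective ω B (after ω l) r' ∧ ringTime ω r' ≤ ringTime ω r}.Finite := by
    refine (hc.finite_rings B B.card (ringTime ω r)).subset ?_
    rintro r' ⟨h1, h2⟩
    exact ⟨h1.1, h1.2.1.trans_le (h.numActive_le hω h1.1), h2⟩
  obtain ⟨r', ⟨hr', hle⟩, hmin⟩ := Set.exists_min_image _ (ringTime ω) hfin ⟨r, hr, le_rfl⟩
  refine ⟨r', ⟨h, hr', fun r'' hr'' => ?_⟩, hle⟩
  by_cases hle' : ringTime ω r'' ≤ ringTime ω r
  · exact hmin r'' ⟨hr'', hle'⟩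
  · exact hle.trans (not_le.1 hle').le

lemma IsNextRing.unique (hc : Clocks ω) {s : Snapshot V} {r r' : V × ℕ × ℕ}
    (h : IsNextRing ω B s r) (h' : IsNextRing ω B s r') : r = r' :=
  hc.injective (le_antisymm (h.2 _ h'.1) (h'.2 _ h.1))

lemma Valid.eq_of_length (hc : Clocks ω) {l l' : List (V × ℕ × ℕ)} (h : Valid ω B l)
    (h' : Valid ω B l') (hl : l.length = l'.length) : l = l' := by
  induction l generalizing l' with
  | nil => exact (List.length_eq_zero_iff.1 hl.symm).symm
  | cons r l ih =>
    cases l' with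
    | nil => simp at hl
    | cons r' l' =>
      obtain rfl := ih h.1 h'.1 (by simpa using hl)
      rw [h.2.unique hc h'.2]

/-- The evolution is deterministic because ring times are distinct: two histories of the same finite
system are comparable. -/
lemma Valid.suffix (hc : Clocks ω) {l l' : List (V × ℕ × ℕ)} (h : Valid ω B l)
    (h' : Valid ω B l') (hl : l.length ≤ l'.length) : l <:+ l' := by
  have hs : l'.drop (l'.length - l.length) <:+ l' := List.drop_suffix _ _
  rwa [← h.eq_of_length hc (h'.of_suffix hs) (by rw [List.length_drop]; omega)] at hs

/-- Valid lists ending within a bounded initial segment of times have a longest element. -/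
lemma exists_maximal (hω : Regular G ω) (hc : Clocks ω) (B : Finset V) (p : ℝ → Prop) (t : ℝ)
    (h0 : p 0) (hp : ∀ s s', s ≤ s' → p s' → p s) (ht : ∀ s, p s → s ≤ t) :
    ∃ l, Valid ω B l ∧ p (after ω l).time ∧
      ∀ r, IsEffective ω B (after ω l) r → ¬ p (ringTime ω r) := by
  classical
  have hfin := hc.finite_rings B B.card t
  -- The rings of a history are distinct and lie in a fixed finite set, so the length is bounded and
  -- a longest history can be chosen.
  have hsub : ∀ l, Valid ω B l → p (after ω l).time → l.length ≤ hfin.toFinset.card := by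
    intro l hl hpl
    have hmem : ∀ r ∈ l, r ∈ hfin.toFinset := by
      intro r hr
      simp only [Set.Finite.mem_toFinset, Set.mem_ofPred_eq]
      refine ⟨hl.mem hr, ?_, (hl.ringTime_le hr).trans (ht _ hpl)⟩
      obtain ⟨l₁, l₂, rfl⟩ := List.append_of_mem hr
      have h2 : Valid ω B (r :: l₂) := hl.of_suffix (List.suffix_append _ _)
      exact h2.2.1.2.1.trans_le (h2.1.numActive_le hω h2.2.1.1)
    rw [← List.toFinset_card_of_nodup hl.nodup]
    exact Finset.card_le_card fun r hr => hmem r (by simpa using hr)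
  obtain ⟨l, ⟨hl, hpl⟩, hmax⟩ : ∃ l, (Valid ω B l ∧ p (after ω l).time) ∧
      ∀ l', Valid ω B l' ∧ p (after ω l').time → l'.length ≤ l.length := by
    obtain ⟨l, hl, hn⟩ := Nat.findGreatest_spec
      (P := fun n => ∃ l, (Valid ω B l ∧ p (after ω l).time) ∧ l.length = n)
      (Nat.zero_le hfin.toFinset.card) ⟨[], ⟨trivial, h0⟩, rfl⟩
    refine ⟨l, hl, fun l' hl' => ?_⟩
    rw [hn]
    exact Nat.le_findGreatest (hsub l' hl'.1 hl'.2) ⟨l', hl', rfl⟩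
  refine ⟨l, hl, hpl, fun r hr hpr => ?_⟩
  obtain ⟨r', hr', hle⟩ := hl.exists_next hω hc hr
  have := hmax (r' :: l) ⟨hr', hp _ _ hle hpr⟩
  simp at this

/-- The list of all rings of the system restricted to `B` up to time `t`. -/
structure Terminal (ω : Sample V) (B : Finset V) (t : ℝ) (l : List (V × ℕ × ℕ)) : Prop where
  valid : Valid ω B l
  time_le : (after ω l).time ≤ t
  lt_ringTime : ∀ r, IsEffective ω B (after ω l) r → t < ringTime ω r

lemma exists_terminal (hω : Regular G ω) (hc : Clocks ω) (B : Finset V) {t : ℝ} (ht : 0 ≤ t) :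
    ∃ l, Terminal ω B t l := by
  obtain ⟨l, h1, h2, h3⟩ := exists_maximal hω hc B (· ≤ t) t ht (fun _ _ => le_trans) fun _ h => h
  exact ⟨l, h1, h2, fun r hr => not_le.1 (h3 r hr)⟩

/-- Were `l` longer than `l'`, the ring of `l` just after `l'` would be effective and occur by time
`t`. -/
lemma Terminal.suffix (hc : Clocks ω) {t : ℝ} {l l' : List (V × ℕ × ℕ)} (h' : Terminal ω B t l')
    (h : Valid ω B l) (ht : (after ω l).time ≤ t) : l <:+ l' := by
  by_contra hcon
  have hlen : l'.length < l.length := by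
    by_contra hlt
    exact hcon (h.suffix hc h'.valid (by omega))
  obtain ⟨m, rfl⟩ := h'.valid.suffix hc h hlen.le
  obtain ⟨m', r, rfl⟩ : ∃ m' r, m = m' ++ [r] := by
    rcases List.eq_nil_or_concat m with rfl | ⟨m', r, rfl⟩
    · simp at hlen
    · exact ⟨m', r, by simp⟩
  have hv : Valid ω B (r :: l') := h.of_suffix ⟨m', by simp⟩
  have h1 := h'.lt_ringTime r hv.2.1
  have h2 := h.ringTime_le (r := r) (by simp)
  linarith

/-- Enlarging the set of vertices increases the odometer at any given time. -/
lemma Valid.used_le [G.LocallyFinite] (hω : Regular G ω) (hc : Clocks ω) (hB : B ⊆ B')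
    {l : List (V × ℕ × ℕ)} (h : Valid ω B l) {t : ℝ} (ht : (after ω l).time ≤ t)
    {l' : List (V × ℕ × ℕ)} (h' : Terminal ω B' t l') (x : V) :
    (after ω l).used x ≤ (after ω l').used x := by
  induction l generalizing t l' x with
  | nil => simp [after, start]
  | cons r l ih =>
    have hlt := h.time_lt
    rw [after_cons_time] at ht
    -- `b` is the history of the larger system strictly before the ring `r`; the induction
    -- hypothesis compares it with `l` at a time just before `r`.
    obtain ⟨b, hb, hbt, hbe⟩ := exists_maximal hω hc B' (· < ringTime ω r) (ringTime ω r)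
      (h.1.time_nonneg.trans_lt hlt) (fun _ _ => lt_of_le_of_lt) fun _ h => h.le
    have hterm : Terminal ω B' (max (after ω b).time (after ω l).time) b :=
      ⟨hb, le_max_left _ _, fun r' hr' => (max_lt hbt hlt).trans_le (not_lt.1 (hbe r' hr'))⟩
    have hle : ∀ y, (after ω l).used y ≤ (after ω b).used y :=
      fun y => ih h.1 (le_max_right _ _) hterm y
    -- If the clock of `r` is in use in the larger system as well, `r` is its next ring and both
    -- odometers increase. If not, the larger system has fewer active particles at that vertex, so
    -- by `Reach.numActive_mono` its odometer is already strictly ahead there.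
    by_cases hact : r.2.1 < ((after ω b).config r.1).numActive
    · obtain ⟨r', hr', hle'⟩ := hb.exists_next hω hc (r := r) ⟨hB h.2.1.1, hact, hbt⟩
      have : r' = r := hc.injective (le_antisymm hle' (not_lt.1 (hbe r' hr'.2.1)))
      subst this
      refine le_trans ?_ (after_used_mono (h'.suffix hc hr' ht) x)
      by_cases hx : x = r'.1
      · subst hx
        rw [after_used_self, after_used_self]
        exact Nat.succ_le_succ (hle _)
      · rw [after_used_of_ne _ _ hx, after_used_of_ne _ _ hx]
        exact hle x
    · refine le_trans ?_ (after_used_mono (h'.suffix hc hb (hbt.le.trans ht)) x)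
      by_cases hx : x = r.1
      · subst hx
        rw [after_used_self]
        by_contra hcon
        have heq : (after ω l).used r.1 = (after ω b).used r.1 :=
          le_antisymm (hle _) (by omega)
        have := h.1.reach.numActive_mono hω hb.reach heq fun y _ =>
          jumpsInto_mono ω y r.1 (hle y)
        have := h.2.1.2.1
        omega
      · rw [after_used_of_ne _ _ hx]
        exact hle x

/-- Links the dynamics of the statement to lists of rings: lists have their latest ring first, so
the state after `m` moves keeps the last `m` entries of the complete history. -/
lemma advance_iterate (hc : Clocks ω) {t : ℝ} {l : List (V × ℕ × ℕ)} (h : Terminal ω B t l)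
    (m : ℕ) : (advance ω B t)^[m] (start ω) = after ω (l.drop (l.length - m)) := by
  classical
  induction m with
  | zero => simp [after]
  | succ m ih =>
    rw [Function.iterate_succ_apply', ih]
    rcases Nat.lt_or_ge m l.length with hm | hm
    · obtain ⟨k, hk⟩ : ∃ k, l.length - m = k + 1 := ⟨l.length - m - 1, by omega⟩
      have hk' : l.length - (m + 1) = k := by omega
      have hkl : k < l.length := by omega
      rw [hk, hk', List.drop_eq_getElem_cons hkl]
      set r := l[k]
      have hv : Valid ω B (r :: l.drop (k + 1)) := by
        rw [← List.drop_eq_getElem_cons hkl]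
        exact h.valid.of_suffix (List.drop_suffix _ _)
      have hex : ∃ r, IsNextRing ω B (after ω (l.drop (k + 1))) r ∧ ringTime ω r ≤ t :=
        ⟨r, hv.2, (h.valid.ringTime_le (List.getElem_mem hkl)).trans h.time_le⟩
      rw [advance, dif_pos hex, hex.choose_spec.1.unique hc hv.2]
      rfl
    · rw [Nat.sub_eq_zero_of_le hm, Nat.sub_eq_zero_of_le (by omega), List.drop_zero, advance,
        dif_neg]
      rintro ⟨r, hr, hrt⟩
      exact absurd (h.lt_ringTime r hr.1) (not_lt.2 hrt)

lemma eventually_advance_iterate (hc : Clocks ω) {t : ℝ} {l : List (V × ℕ × ℕ)}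
    (h : Terminal ω B t l) : ∀ᶠ m in atTop, (advance ω B t)^[m] (start ω) = after ω l := by
  filter_upwards [eventually_ge_atTop l.length] with m hm
  rw [advance_iterate hc h, Nat.sub_eq_zero_of_le hm, List.drop_zero]

/-! ### Infinite volume: a non-active process has bounded odometers -/

/-- No vertex is visited infinitely often in a bounded time interval. -/
def NonExplosive (ω : Sample V) : Prop :=
  ∀ (t : ℝ) (x : V), ∃ K : ℕ, ∀ (B : Finset V) (l : List (V × ℕ × ℕ)), Valid ω B l →
    (after ω l).time ≤ t → (after ω l).used x ≤ K

/-- A bounded monotone integer-valued function of `B` is eventually constant; the limit is the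
odometer at time `t` of the infinite system. -/
lemma NonExplosive.exists_limit [G.LocallyFinite] (hne : NonExplosive ω) (hω : Regular G ω)
    (hc : Clocks ω) (t : ℝ) (ht : 0 ≤ t) (x : V) :
    ∃ n : ℕ, (∀ B l, Valid ω B l → (after ω l).time ≤ t → (after ω l).used x ≤ n) ∧
      ∃ B₀, ∀ B, B₀ ⊆ B → ∀ l, Terminal ω B t l → (after ω l).used x = n := by
  classical
  obtain ⟨K, hK⟩ := hne t x
  let P : ℕ → Prop := fun n => ∃ B l, Terminal ω B t l ∧ (after ω l).used x = n
  obtain ⟨l₀, hl₀⟩ := exists_terminal hω hc ∅ ht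
  obtain ⟨B₀, l₁, hl₁, hn⟩ := Nat.findGreatest_spec (P := P)
    (hK ∅ l₀ hl₀.valid hl₀.time_le) ⟨∅, l₀, hl₀, rfl⟩
  have hmax : ∀ B l, Terminal ω B t l → (after ω l).used x ≤ Nat.findGreatest P K :=
    fun B l hl => Nat.le_findGreatest (hK B l hl.valid hl.time_le) ⟨B, l, hl, rfl⟩
  refine ⟨Nat.findGreatest P K, fun B l hl hlt => ?_, B₀, fun B hB l hl => ?_⟩
  · obtain ⟨l', hl'⟩ := exists_terminal hω hc B ht
    exact (hl.used_le hω hc subset_rfl hlt hl' x).trans (hmax B l' hl')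
  · refine le_antisymm (hmax B l hl) ?_
    rw [← hn]
    exact hl₁.valid.used_le hω hc hB hl₁.time_le hl x

lemma exists_hit_odometer {l : List (V × ℕ × ℕ)} (h : Valid ω B l) {x : V} {n : ℕ}
    (hn : n < (after ω l).used x) :
    ∃ r l', r :: l' <:+ l ∧ r.1 = x ∧ (after ω l').used x = n := by
  induction l with
  | nil => simp [after, start] at hn
  | cons r l ih =>
    by_cases hlt : n < (after ω l).used x
    · obtain ⟨r', l', hs, h1, h2⟩ := ih h.1 hlt
      exact ⟨r', l', hs.trans (List.suffix_cons _ _), h1, h2⟩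
    · have hx : x = r.1 := by
        by_contra hne
        rw [after_used_of_ne _ _ hne] at hn
        exact hlt hn
      subst hx
      rw [after_used_self] at hn
      exact ⟨r, l, List.suffix_rfl, rfl, by omega⟩

/-- If the process is not active, then the odometers of all legal sequences of topplings are
bounded. -/
theorem exists_odometer_bound [G.LocallyFinite] (hω : Regular G ω) (hc : Clocks ω)
    (hne : NonExplosive ω) (hna : ¬ IsActive ω) :
    ∃ U : V → ℕ, ∀ η u, Reach ω η u → ∀ x, u x ≤ U x := by
  classical
  have hlim := hne.exists_limit hω hc
  choose! u hu B₀ hB₀ using hlim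
  simp only [IsActive] at hna
  push Not at hna
  choose T hT using hna
  -- The limiting odometer at `x` cannot grow after `T x`: just before its next increase, `x` would
  -- hold an active particle in the infinite system.
  have hst : ∀ x t, T x ≤ t → 0 ≤ t → u t x ≤ u (max (T x) 0) x := by
    intro x t₁ hTt₁ ht₁
    set T₀ := max (T x) 0
    have hT₀ : 0 ≤ T₀ := le_max_right _ _
    by_contra! hlt
    set n := u T₀ x
    let R : Set (V × ℕ × ℕ) := {r | ringTime ω r ≤ t₁ ∧ r.1 = x ∧
      ∃ B l, Valid ω B (r :: l) ∧ (after ω l).used x = n}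
    have hRmem : ∀ t, 0 ≤ t → t ≤ t₁ → n < u t x → ∃ r ∈ R, ringTime ω r ≤ t := by
      intro t ht htt h
      obtain ⟨l, hl⟩ := exists_terminal hω hc (B₀ t x) ht
      rw [← hB₀ t ht x _ subset_rfl l hl] at h
      obtain ⟨r, l', hs, hr, hn⟩ := exists_hit_odometer hl.valid h
      have hv := hl.valid.of_suffix hs
      have hle : ringTime ω r ≤ t :=
        (hl.valid.ringTime_le (hs.subset (by simp))).trans hl.time_le
      exact ⟨r, ⟨hle.trans htt, hr, _, l', hv, hn⟩, hle⟩
    -- The number of particles at `x` before time `t₁` is bounded through the limiting odometers of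
    -- the neighbours, so only finitely many clocks at `x` matter, whatever the finite system; hence
    -- a first ring in `R` exists.
    have hRfin : R.Finite := by
      refine (hc.finite_rings {x} (1 + ∑ y ∈ G.neighborFinset x, u t₁ y) t₁).subset ?_
      rintro r ⟨hr, hrx, B, l, hv, hn⟩
      refine ⟨by simpa using hrx, ?_, hr⟩
      refine hv.2.1.2.1.trans_le ((SiteState.numActive_le_total _).trans ?_)
      rw [hrx]
      refine (hv.1.reach.total_le hω x).trans (Nat.add_le_add_left ?_ _)
      exact Finset.sum_le_sum fun y _ => hu t₁ ht₁ y B l hv.1 (hv.time_lt.le.trans hr)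
    obtain ⟨r₁, hr₁, -⟩ := hRmem t₁ ht₁ le_rfl hlt
    obtain ⟨r, ⟨hrt, hrx, B, l, hv, hn⟩, hmin⟩ :=
      Set.exists_min_image R (ringTime ω) hRfin ⟨r₁, hr₁⟩
    have hσ : T₀ < ringTime ω r := by
      by_contra! hle
      have := hu T₀ hT₀ x B (r :: l) hv hle
      rw [← hrx, after_used_self, hrx] at this
      omega
    -- A time after `T₀`, at or after the last ring preceding `r` and strictly before `r`: here the
    -- limiting odometer at `x` is still `n`.
    set t := max T₀ (after ω l).time
    have htσ : t < ringTime ω r := max_lt hσ hv.time_lt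
    have htT : T₀ ≤ t := le_max_left _ _
    have ht0 : 0 ≤ t := hT₀.trans htT
    have hutx : u t x = n := by
      refine le_antisymm ?_ ?_
      · by_contra! h
        obtain ⟨r', hr', hle⟩ := hRmem t ht0 (htσ.le.trans hrt) h
        exact absurd (hmin r' hr') (not_le.2 (hle.trans_lt htσ))
      · rw [← hn]
        exact hu t ht0 x B l hv.1 (le_max_right _ _)
    let B₁ := insert x (G.neighborFinset x)
    let C := B₁.biUnion (B₀ t)
    obtain ⟨lC, hlC⟩ := exists_terminal hω hc C ht0
    have hCu : ∀ B', C ⊆ B' → ∀ l', Terminal ω B' t l' → ∀ y ∈ B₁,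
        (after ω l').used y = u t y := fun B' hB' l' hl' y hy =>
      hB₀ t ht0 y B' ((Finset.subset_biUnion_of_mem (B₀ t) hy).trans hB') l' hl'
    have hxB : x ∈ B₁ := Finset.mem_insert_self _ _
    have hyB : ∀ y, G.Adj x y → y ∈ B₁ := fun y hy =>
      Finset.mem_insert_of_mem (by simpa using hy)
    -- `x` is active in the finite system `B` just before `r`; at equal odometer at `x`, the larger
    -- odometers of the infinite system at the neighbours keep it active.
    have hact : 1 ≤ ((after ω lC).config x).numActive := by
      have h1 := hv.2.1.2.1
      rw [hrx] at h1
      have h2 := hv.1.reach.numActive_mono hω hlC.valid.reach (x := x)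
        (by rw [hCu C subset_rfl lC hlC x hxB, hutx, hn]) fun y hy => by
          rw [hCu C subset_rfl lC hlC y (hyB y hy)]
          exact jumpsInto_mono ω y x (hu t ht0 y B l hv.1 (le_max_right _ _))
      omega
    have hstate : HasState ω t x ((after ω lC).config x) := by
      filter_upwards [eventually_ge_atTop C] with B' hB'
      obtain ⟨l', hl'⟩ := exists_terminal hω hc B' ht0
      filter_upwards [eventually_advance_iterate hc hl'] with m hm
      rw [hm]
      refine hl'.valid.reach.config_eq hω hlC.valid.reach ?_ fun y hy => ?_
      · rw [hCu B' hB' l' hl' x hxB, hCu C subset_rfl lC hlC x hxB]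
      · rw [hCu B' hB' l' hl' y (hyB y hy), hCu C subset_rfl lC hlC y (hyB y hy)]
    rcases hs : (after ω lC).config x with _ | k
    · simp [hs, SiteState.numActive] at hact
    · rw [hs] at hstate hact
      exact hT x t ((le_max_left _ _).trans htT) k hact hstate
  refine ⟨fun x => u (max (T x) 0) x, fun η v hv => ?_⟩
  have hbound : ∀ B l, Valid ω B l → ∀ x, (after ω l).used x ≤ u (max (T x) 0) x := by
    intro B l hl x
    refine le_trans ?_ (hst x (max (T x) (after ω l).time) (le_max_left _ _)
      (hl.time_nonneg.trans (le_max_right _ _)))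
    exact hu _ (hl.time_nonneg.trans (le_max_right _ _)) x B l hl (le_max_right _ _)
  -- A legal sequence topples a finite set `B`. The system in `B` has a bounded number of rings,
  -- hence a longest history, which is stable in `B` as every active particle would ring again; the
  -- least action principle then compares the two.
  have hfin : ∃ B : Finset V, ∀ x, v x ≠ 0 → x ∈ B := by
    induction hv with
    | init => exact ⟨∅, by simp⟩
    | @topple η v z _ _ ih =>
      obtain ⟨B, hB⟩ := ih
      refine ⟨insert z B, fun x hx => ?_⟩
      by_cases hxz : x = z
      · simp [hxz]
      · rw [Function.update_of_ne hxz] at hx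
        exact Finset.mem_insert_of_mem (hB x hx)
  obtain ⟨B, hB⟩ := hfin
  let P : ℕ → Prop := fun n => ∃ l, Valid ω B l ∧ l.length = n
  have hlen : ∀ l, Valid ω B l → l.length ≤ ∑ x ∈ B, u (max (T x) 0) x := fun l hl => by
    rw [hl.length_eq]
    exact Finset.sum_le_sum fun x _ => hbound B l hl x
  obtain ⟨l, hl, hn⟩ := Nat.findGreatest_spec (P := P) (Nat.zero_le _) ⟨[], trivial, rfl⟩
  have hstable : ∀ x ∈ B, ((after ω l).config x).numActive = 0 := by
    intro x hx
    by_contra hpos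
    obtain ⟨k, hk⟩ := ((hc.tendsto x 0).eventually_gt_atTop (after ω l).time).exists
    obtain ⟨r', hr', -⟩ := hl.exists_next hω hc (r := (x, 0, k))
      ⟨hx, Nat.pos_of_ne_zero hpos, hk⟩
    have := Nat.le_findGreatest (P := P) (hlen _ hr') ⟨_, hr', rfl⟩
    rw [← hn] at this
    simp at this
  exact fun x => (hv.le_of_stable hω hl.reach B hB hstable x).trans (hbound B l hl x)

end ARW

/-! ### Resampling one coordinate of a product measure -/

/-- Independence is used below only in this form: refreshing one coordinate preserves the law. It
replaces filtrations and conditional expectations, both for the clocks and for the instructions. -/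
theorem measurePreserving_update_infinitePi {ι : Type*} [DecidableEq ι] {X : ι → Type*}
    [∀ i, MeasurableSpace (X i)] (μ : ∀ i, Measure (X i)) [∀ i, IsProbabilityMeasure (μ i)]
    (c : ι) : MeasurePreserving (fun p : (∀ i, X i) × X c => Function.update p.1 c p.2)
      ((Measure.infinitePi μ).prod (μ c)) (Measure.infinitePi μ) := by
  have hm : Measurable (fun p : (∀ i, X i) × X c => Function.update p.1 c p.2) := by
    refine measurable_pi_lambda _ fun i => ?_
    by_cases h : i = c
    · subst h
      simpa using measurable_snd
    · simp only [Function.update_of_ne h]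
      exact (measurable_pi_apply i).comp measurable_fst
  refine ⟨hm, Measure.eq_infinitePi _ fun s t ht => ?_⟩
  rw [Measure.map_apply hm (MeasurableSet.pi s.countable_toSet fun i _ => ht i)]
  by_cases hc : c ∈ s
  · have : (fun p : (∀ i, X i) × X c => Function.update p.1 c p.2) ⁻¹' (Set.pi s t) =
        (Set.pi ↑(s.erase c) t) ×ˢ t c := by
      ext p
      simp only [Set.mem_preimage, Set.mem_pi, Finset.mem_coe, Set.mem_prod]
      constructor
      · intro h
        refine ⟨fun i hi => ?_, by simpa using h c hc⟩
        have := h i (Finset.mem_of_mem_erase hi)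
        rwa [Function.update_of_ne (Finset.ne_of_mem_erase hi)] at this
      · rintro ⟨h1, h2⟩ i hi
        by_cases hic : i = c
        · subst hic
          simpa using h2
        · rw [Function.update_of_ne hic]
          exact h1 i (Finset.mem_erase.2 ⟨hic, hi⟩)
    rw [this, Measure.prod_prod, Measure.infinitePi_pi _ fun i _ => ht i, mul_comm,
      Finset.mul_prod_erase s (fun i => μ i (t i)) hc]
  · have : (fun p : (∀ i, X i) × X c => Function.update p.1 c p.2) ⁻¹' (Set.pi s t) =
        (Set.pi ↑s t) ×ˢ Set.univ := by
      ext p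
      simp only [Set.mem_preimage, Set.mem_pi, Finset.mem_coe, Set.mem_prod, Set.mem_univ, and_true]
      refine forall₂_congr fun i hi => ?_
      rw [Function.update_of_ne (by rintro rfl; exact hc hi)]
    rw [this, Measure.prod_prod, Measure.infinitePi_pi _ fun i _ => ht i, measure_univ, mul_one]

lemma lintegral_infinitePi_update {ι : Type*} [DecidableEq ι] {X : ι → Type*}
    [∀ i, MeasurableSpace (X i)] (μ : ∀ i, Measure (X i)) [∀ i, IsProbabilityMeasure (μ i)]
    (c : ι) {f : (∀ i, X i) → ℝ≥0∞} (hf : Measurable f) :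
    ∫⁻ w, f w ∂(Measure.infinitePi μ) =
      ∫⁻ w, ∫⁻ a, f (Function.update w c a) ∂(μ c) ∂(Measure.infinitePi μ) := by
  have h := measurePreserving_update_infinitePi μ c
  rw [← h.lintegral_comp hf, lintegral_prod (fun p : (∀ i, X i) × X c =>
    f (Function.update p.1 c p.2)) (hf.comp h.measurable).aemeasurable]

namespace ARW

variable {V : Type*}

instance (lam : ℝ≥0) : NullSingletonClass (expMeasure (1 + (lam : ℝ))) := by
  unfold expMeasure gammaMeasure
  infer_instance

instance [Countable V] : Countable (Instruction V) := by
  have : Function.Injective (fun s : Instruction V => match s with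
    | .sleep => (none : Option V)
    | .jump k => some k) := by
    rintro (_ | _) (_ | _) h <;> simp_all
  exact this.countable

open Classical in
/-- Replace one waiting time. -/
noncomputable def Sample.setGap (ω : Sample V) (c : V × ℕ × ℕ) (g : ℝ) : Sample V :=
  (ω.1, ω.2.1, Function.update ω.2.2 c g)

open Classical in
/-- Replace one instruction. -/
noncomputable def Sample.setInstr (ω : Sample V) (c : V × ℕ) (i : Instruction V) : Sample V :=
  (ω.1, Function.update ω.2.1 c i, ω.2.2)

lemma measurable_setGap (c : V × ℕ × ℕ) :
    Measurable (fun p : Sample V × ℝ => p.1.setGap c p.2) := by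
  classical
  refine (measurable_fst.comp measurable_fst).prodMk
    ((measurable_fst.comp (measurable_snd.comp measurable_fst)).prodMk ?_)
  refine measurable_pi_lambda _ fun i => ?_
  by_cases h : i = c
  · subst h
    simpa using measurable_snd
  · simp only [Function.update_of_ne h]
    exact (measurable_pi_apply i).comp (measurable_snd.comp (measurable_snd.comp measurable_fst))

lemma measurable_setInstr (c : V × ℕ) :
    Measurable (fun p : Sample V × Instruction V => p.1.setInstr c p.2) := by
  classical
  refine (measurable_fst.comp measurable_fst).prodMk
    (Measurable.prodMk ?_ (measurable_snd.comp (measurable_snd.comp measurable_fst)))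
  refine measurable_pi_lambda _ fun i => ?_
  by_cases h : i = c
  · subst h
    simpa using measurable_snd
  · simp only [Function.update_of_ne h]
    exact (measurable_pi_apply i).comp (measurable_fst.comp (measurable_snd.comp measurable_fst))

variable (G : SimpleGraph V) [G.LocallyFinite] (lam : ℝ≥0) (μ : unitInterval)

instance : IsProbabilityMeasure (law G lam μ) := by
  unfold law
  infer_instance

lemma lintegral_setGap (c : V × ℕ × ℕ) {f : Sample V → ℝ≥0∞} (hf : Measurable f) :
    ∫⁻ ω, f ω ∂(law G lam μ) =
      ∫⁻ ω, ∫⁻ g, f (ω.setGap c g) ∂(expMeasure (1 + (lam : ℝ))) ∂(law G lam μ) := by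
  classical
  have hf2 : Measurable fun ω : Sample V =>
      ∫⁻ g, f (ω.setGap c g) ∂(expMeasure (1 + (lam : ℝ))) :=
    (hf.comp (measurable_setGap c)).lintegral_prod_right'
  unfold law
  rw [lintegral_prod _ hf.aemeasurable, lintegral_prod _ hf2.aemeasurable]
  refine lintegral_congr fun η => ?_
  rw [lintegral_prod (fun y => f (η, y)) (hf.comp measurable_prodMk_left).aemeasurable,
    lintegral_prod (fun y => ∫⁻ g, f (Sample.setGap (η, y) c g) ∂_)
      (hf2.comp measurable_prodMk_left).aemeasurable]
  refine lintegral_congr fun i => ?_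
  exact lintegral_infinitePi_update (fun _ : V × ℕ × ℕ => expMeasure (1 + (lam : ℝ))) c
    (hf.comp (measurable_prodMk_left.comp measurable_prodMk_left))

lemma lintegral_setInstr (c : V × ℕ) {f : Sample V → ℝ≥0∞} (hf : Measurable f) :
    ∫⁻ ω, f ω ∂(law G lam μ) =
      ∫⁻ ω, ∫⁻ i, f (ω.setInstr c i) ∂(instructionLaw G lam c.1) ∂(law G lam μ) := by
  classical
  have hf2 : Measurable fun ω : Sample V =>
      ∫⁻ i, f (ω.setInstr c i) ∂(instructionLaw G lam c.1) :=
    (hf.comp (measurable_setInstr c)).lintegral_prod_right'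
  unfold law
  rw [lintegral_prod _ hf.aemeasurable, lintegral_prod _ hf2.aemeasurable]
  refine lintegral_congr fun η => ?_
  rw [lintegral_prod_symm (fun y => f (η, y)) (hf.comp measurable_prodMk_left).aemeasurable,
    lintegral_prod_symm (fun y => ∫⁻ i, f (Sample.setInstr (η, y) c i) ∂_)
      (hf2.comp measurable_prodMk_left).aemeasurable]
  refine lintegral_congr fun g => ?_
  exact lintegral_infinitePi_update (fun p : V × ℕ => instructionLaw G lam p.1) c
    (f := fun i => f (η, i, g))
    (hf.comp (measurable_prodMk_left.comp measurable_prodMk_right))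

lemma measurePreserving_init (x : V) : MeasurePreserving (fun ω : Sample V => ω.init x)
    (law G lam μ) (bernoulliMeasure (SiteState.active 1) (SiteState.active 0) μ) :=
  (measurePreserving_eval_infinitePi
    (fun _ : V => bernoulliMeasure (SiteState.active 1) (SiteState.active 0) μ) x).comp
    measurePreserving_fst

lemma measurePreserving_instr (c : V × ℕ) : MeasurePreserving (fun ω : Sample V => ω.instr c)
    (law G lam μ) (instructionLaw G lam c.1) :=
  (measurePreserving_eval_infinitePi (fun p : V × ℕ => instructionLaw G lam p.1) c).comp
    (measurePreserving_fst.comp measurePreserving_snd)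

lemma measurePreserving_gap (c : V × ℕ × ℕ) : MeasurePreserving (fun ω : Sample V => ω.gap c)
    (law G lam μ) (expMeasure (1 + (lam : ℝ))) :=
  (measurePreserving_eval_infinitePi (fun _ : V × ℕ × ℕ => expMeasure (1 + (lam : ℝ))) c).comp
    (measurePreserving_snd.comp measurePreserving_snd)

lemma lintegral_instructionLaw {x : V} (hx : (G.neighborFinset x).Nonempty)
    (f : Instruction V → ℝ≥0∞) :
    ∫⁻ i, f i ∂(instructionLaw G lam x) =
      (lam / (1 + lam) : ℝ≥0) * f .sleep +
        (1 / (1 + lam) : ℝ≥0) * ((G.degree x : ℝ≥0∞)⁻¹ *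
          ∑ y ∈ G.neighborFinset x, f (.jump y)) := by
  classical
  have hmeas : ((neighborLaw G x).map Instruction.jump).toMeasure =
      (G.degree x : ℝ≥0∞)⁻¹ • ∑ y ∈ G.neighborFinset x, Measure.dirac (Instruction.jump y) := by
    let _ : MeasurableSpace V := ⊤
    ext s hs
    rw [PMF.toMeasure_map_apply _ _ _ measurable_from_top hs, neighborLaw, dif_pos hx,
      PMF.toMeasure_uniformOfFinset_apply hx _ trivial]
    simp only [Measure.smul_apply, Measure.finsetSum_apply, Measure.dirac_apply' _ hs,
      smul_eq_mul, Set.indicator_apply, Pi.one_apply, Finset.sum_boole, Set.mem_preimage,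
      SimpleGraph.card_neighborFinset_eq_degree]
    rw [div_eq_mul_inv, mul_comm]
  rw [instructionLaw, lintegral_add_measure, lintegral_smul_measure, lintegral_smul_measure,
    hmeas, lintegral_smul_measure, lintegral_finsetSum_measure, lintegral_dirac' _ measurable_from_top]
  simp only [lintegral_dirac' _ (measurable_from_top (f := f)), ENNReal.smul_def, smul_eq_mul]

end ARW

namespace ARW

variable {V : Type*}

/-! ### Almost sure regularity -/

instance : DiscreteMeasurableSpace SiteState := ⟨fun _ => trivial⟩

instance : DiscreteMeasurableSpace (Instruction V) := ⟨fun _ => trivial⟩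

@[fun_prop]
lemma measurable_gap (c : V × ℕ × ℕ) : Measurable fun ω : Sample V => ω.gap c :=
  (measurable_pi_apply c).comp (measurable_snd.comp measurable_snd)

@[fun_prop]
lemma measurable_instr (c : V × ℕ) : Measurable fun ω : Sample V => ω.instr c :=
  (measurable_pi_apply c).comp (measurable_fst.comp measurable_snd)

@[fun_prop]
lemma measurable_init (x : V) : Measurable fun ω : Sample V => ω.init x :=
  (measurable_pi_apply x).comp measurable_fst

@[fun_prop]
lemma measurable_ringTime (r : V × ℕ × ℕ) : Measurable fun ω : Sample V => ringTime ω r := by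
  unfold ringTime
  fun_prop

/-- The time of the preceding ring of the same clock. -/
noncomputable def prevRingTime (ω : Sample V) (r : V × ℕ × ℕ) : ℝ :=
  ∑ j ∈ Finset.range r.2.2, ω.gap (r.1, r.2.1, j)

@[fun_prop]
lemma measurable_prevRingTime (r : V × ℕ × ℕ) :
    Measurable fun ω : Sample V => prevRingTime ω r := by
  unfold prevRingTime
  fun_prop

lemma ringTime_eq (ω : Sample V) (r : V × ℕ × ℕ) :
    ringTime ω r = prevRingTime ω r + ω.gap r := by
  rw [ringTime, prevRingTime, Finset.sum_range_succ]

lemma prevRingTime_succ (ω : Sample V) (x : V) (i k : ℕ) :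
    prevRingTime ω (x, i, k + 1) = ringTime ω (x, i, k) := rfl

@[simp]
lemma gap_setGap_self (ω : Sample V) (c : V × ℕ × ℕ) (g : ℝ) : (ω.setGap c g).gap c = g := by
  simp [Sample.gap, Sample.setGap]

lemma gap_setGap_of_ne (ω : Sample V) {c c' : V × ℕ × ℕ} (h : c' ≠ c) (g : ℝ) :
    (ω.setGap c g).gap c' = ω.gap c' := by
  simp [Sample.gap, Sample.setGap, h]

@[simp]
lemma prevRingTime_setGap (ω : Sample V) (r : V × ℕ × ℕ) (g : ℝ) :
    prevRingTime (ω.setGap r g) r = prevRingTime ω r := by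
  refine Finset.sum_congr rfl fun j hj => gap_setGap_of_ne _ (fun h => ?_) _
  have := congrArg (fun p => p.2.2) h
  simp only [Finset.mem_range] at hj this
  omega

lemma ringTime_setGap_self (ω : Sample V) (r : V × ℕ × ℕ) (g : ℝ) :
    ringTime (ω.setGap r g) r = prevRingTime ω r + g := by
  rw [ringTime_eq, prevRingTime_setGap, gap_setGap_self]

lemma ringTime_setGap_of_ne (ω : Sample V) {r r' : V × ℕ × ℕ}
    (h : (r'.1, r'.2.1) ≠ (r.1, r.2.1) ∨ r'.2.2 < r.2.2) (g : ℝ) :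
    ringTime (ω.setGap r g) r' = ringTime ω r' := by
  refine Finset.sum_congr rfl fun j hj => gap_setGap_of_ne _ ?_ _
  rintro rfl
  rcases h with h | h
  · simp at h
  · simp at hj h
    omega

lemma prevRingTime_nonneg {ω : Sample V} (hg : ∀ c, 0 < ω.gap c) (r : V × ℕ × ℕ) :
    0 ≤ prevRingTime ω r := Finset.sum_nonneg fun _ _ => (hg _).le

lemma ringTime_strictMono {ω : Sample V} (hg : ∀ c, 0 < ω.gap c) (x : V) (i : ℕ) :
    StrictMono fun k => ringTime ω (x, i, k) := by
  refine strictMono_nat_of_lt_succ fun k => ?_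
  rw [ringTime_eq ω (x, i, k + 1), prevRingTime_succ]
  linarith [hg (x, i, k + 1)]

lemma expMeasure_Iic_zero {r : ℝ} (hr : 0 < r) : expMeasure r (Set.Iic 0) = 0 := by
  have := isProbabilityMeasure_expMeasure hr
  have h := cdf_expMeasure_eq hr 0
  rw [cdf_eq_real] at h
  simpa [measureReal_eq_zero_iff] using h

variable (G : SimpleGraph V) [G.LocallyFinite] (lam : ℝ≥0) (μ : unitInterval)

lemma ae_gap_pos [Countable V] : ∀ᵐ ω ∂(law G lam μ), ∀ c, 0 < ω.gap c := by
  rw [ae_all_iff]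
  intro c
  have h : ∀ᵐ g ∂(expMeasure (1 + (lam : ℝ))), 0 < g := by
    rw [ae_iff]
    have : {g : ℝ | ¬ 0 < g} = Set.Iic 0 := by ext; simp
    rw [this]
    exact expMeasure_Iic_zero (by positivity)
  exact (measurePreserving_gap G lam μ c).quasiMeasurePreserving.ae h

/-- Refreshing the last waiting time before `r` moves `ringTime ω r` continuously and leaves the
ring of the other clock fixed, so equality has probability zero. -/
lemma ae_ringTime_ne {r r' : V × ℕ × ℕ} (h : (r'.1, r'.2.1) ≠ (r.1, r.2.1)) :
    ∀ᵐ ω ∂(law G lam μ), ringTime ω r ≠ ringTime ω r' := by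
  have hm : MeasurableSet {ω : Sample V | ringTime ω r = ringTime ω r'} :=
    measurableSet_eq_fun (by fun_prop) (by fun_prop)
  rw [ae_iff]
  simp only [ne_eq, not_not]
  rw [← lintegral_indicator_one hm, lintegral_setGap G lam μ r (measurable_one.indicator hm)]
  refine (lintegral_congr fun ω => ?_).trans lintegral_zero
  refine (lintegral_congr_ae ?_).trans lintegral_zero
  have hne : ∀ᵐ g ∂(expMeasure (1 + (lam : ℝ))), g ≠ ringTime ω r' - prevRingTime ω r := by
    rw [ae_iff]
    simp
  filter_upwards [hne] with g hg
  refine Set.indicator_of_notMem ?_ _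
  simp only [Set.mem_ofPred_eq]
  rw [ringTime_setGap_self, ringTime_setGap_of_ne _ (Or.inl h)]
  intro h'
  exact hg (by linarith)

/-- The Laplace transforms `E exp (-T_k) = θ ^ (k + 1)` are summable because `θ < 1`, so almost
surely `exp (-T_k)` tends to zero. -/
lemma ae_tendsto_ringTime [Countable V] (x : V) (i : ℕ) :
    ∀ᵐ ω ∂(law G lam μ), Tendsto (fun k => ringTime ω (x, i, k)) atTop atTop := by
  set ν := expMeasure (1 + (lam : ℝ))
  set θ : ℝ≥0∞ := ∫⁻ g, ENNReal.ofReal (Real.exp (-g)) ∂ν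
  have hpos : ∀ᵐ g ∂ν, 0 < g := by
    rw [ae_iff]
    have : {g : ℝ | ¬ 0 < g} = Set.Iic 0 := by ext; simp
    rw [this]
    exact expMeasure_Iic_zero (by positivity)
  have hθ : θ < 1 := by
    have h1 : ∫⁻ _, (1 : ℝ≥0∞) ∂ν = 1 := by simp [ν]
    rw [← h1]
    have hlt : ∀ᵐ g ∂ν, ENNReal.ofReal (Real.exp (-g)) < 1 := by
      filter_upwards [hpos] with g hg
      rw [ENNReal.ofReal_lt_one]
      simpa using hg
    refine lintegral_strict_mono (IsProbabilityMeasure.ne_zero ν) aemeasurable_const ?_ hlt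
    exact ((lintegral_mono_ae (hlt.mono fun g hg => hg.le)).trans_lt (by simp [ν])).ne
  have hE : ∀ k, ∫⁻ ω, ENNReal.ofReal (Real.exp (-ringTime ω (x, i, k))) ∂(law G lam μ) =
      θ ^ (k + 1) := by
    intro k
    have hstep : ∀ k, ∫⁻ ω, ENNReal.ofReal (Real.exp (-ringTime ω (x, i, k))) ∂(law G lam μ) =
        (∫⁻ ω, ENNReal.ofReal (Real.exp (-prevRingTime ω (x, i, k))) ∂(law G lam μ)) * θ := by
      intro k
      rw [lintegral_setGap G lam μ (x, i, k) (by fun_prop), ← lintegral_mul_const _ (by fun_prop)]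
      refine lintegral_congr fun ω => ?_
      rw [← lintegral_const_mul _ (by fun_prop)]
      refine lintegral_congr fun g => ?_
      rw [ringTime_setGap_self, ← ENNReal.ofReal_mul (Real.exp_nonneg _), ← Real.exp_add, neg_add]
    induction k with
    | zero =>
      rw [hstep]
      simp [prevRingTime]
    | succ k ih =>
      rw [hstep]
      simp only [prevRingTime_succ]
      rw [ih, ← pow_succ]
  have hsum : ∫⁻ ω, ∑' k, ENNReal.ofReal (Real.exp (-ringTime ω (x, i, k))) ∂(law G lam μ) ≠ ∞ := by
    rw [lintegral_tsum fun k => by fun_prop]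
    simp_rw [hE, pow_succ]
    rw [ENNReal.tsum_mul_right, ENNReal.tsum_geometric]
    refine ENNReal.mul_ne_top ?_ hθ.ne_top
    rw [ENNReal.inv_ne_top]
    exact (tsub_pos_of_lt hθ).ne'
  have hae := ae_lt_top (Measurable.tsum fun k => by fun_prop) hsum
  filter_upwards [hae] with ω hω
  have h0 := ENNReal.tendsto_atTop_zero_of_tsum_ne_top hω.ne
  have h1 : Tendsto (fun k => Real.exp (-ringTime ω (x, i, k))) atTop (nhds 0) := by
    have := (ENNReal.tendsto_toReal ENNReal.zero_ne_top).comp h0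
    refine (this.congr fun k => ?_)
    simp [ENNReal.toReal_ofReal (Real.exp_nonneg _)]
  rw [Real.tendsto_exp_comp_nhds_zero] at h1
  exact tendsto_neg_atBot_iff.1 h1

theorem ae_clocks [Countable V] : ∀ᵐ ω ∂(law G lam μ), Clocks ω := by
  have h2 : ∀ᵐ ω ∂(law G lam μ), ∀ r r' : V × ℕ × ℕ, (r'.1, r'.2.1) ≠ (r.1, r.2.1) →
      ringTime ω r ≠ ringTime ω r' := by
    simp_rw [ae_all_iff]
    exact fun r r' h => ae_ringTime_ne G lam μ h
  have h3 : ∀ᵐ ω ∂(law G lam μ), ∀ x i, Tendsto (fun k => ringTime ω (x, i, k)) atTop atTop := by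
    simp_rw [ae_all_iff]
    exact fun x i => ae_tendsto_ringTime G lam μ x i
  filter_upwards [ae_gap_pos G lam μ, h2, h3] with ω h1 h2 h3
  refine ⟨h1, ?_, h3⟩
  rintro ⟨x, i, k⟩ ⟨x', i', k'⟩ h
  by_cases hc : (x', i') = (x, i)
  · obtain ⟨rfl, rfl⟩ := Prod.mk.injEq .. ▸ hc
    rw [(ringTime_strictMono h1 _ _).injective h]
  · exact absurd h (h2 _ _ hc)

theorem ae_regular [Countable V] (hG : ∀ x, (G.neighborFinset x).Nonempty) :
    ∀ᵐ ω ∂(law G lam μ), Regular G ω := by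
  have h1 : ∀ᵐ ω ∂(law G lam μ), ∀ x, ω.init x = .active 0 ∨ ω.init x = .active 1 := by
    rw [ae_all_iff]
    intro x
    have h : ∀ᵐ s ∂(bernoulliMeasure (SiteState.active 1) (SiteState.active 0) μ),
        s = .active 0 ∨ s = .active 1 := by
      classical
      rw [ae_iff, bernoulliMeasure_apply _ (MeasurableSet.of_discrete)]
      simp
    exact (measurePreserving_init G lam μ x).quasiMeasurePreserving.ae h
  have h2 : ∀ᵐ ω ∂(law G lam μ), ∀ c : V × ℕ, ∀ y, ω.instr c = .jump y → G.Adj c.1 y := by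
    rw [ae_all_iff]
    intro c
    have h : ∀ᵐ i ∂(instructionLaw G lam c.1), ∀ y, i = .jump y → G.Adj c.1 y := by
      classical
      have hm : MeasurableSet {i : Instruction V | ¬ ∀ y, i = .jump y → G.Adj c.1 y} := trivial
      rw [ae_iff, ← lintegral_indicator_one hm, lintegral_instructionLaw G lam (hG _)]
      have hz : ∀ y ∈ G.neighborFinset c.1, {i : Instruction V | ¬ ∀ y, i = .jump y →
          G.Adj c.1 y}.indicator (1 : Instruction V → ℝ≥0∞) (.jump y) = 0 := by
        intro y hy
        refine Set.indicator_of_notMem ?_ _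
        simpa using hy
      rw [Finset.sum_eq_zero hz]
      simp
    exact (measurePreserving_instr G lam μ c).quasiMeasurePreserving.ae h
  filter_upwards [h1, h2] with ω h1 h2
  exact ⟨h1, fun x j y h => h2 (x, j) y h⟩

/-! ### Measurability -/

variable {G lam μ}

open Classical in
/-- The odometer after a list of rings. -/
noncomputable def countRings (l : List (V × ℕ × ℕ)) (x : V) : ℕ := l.countP (fun r => r.1 = x)

/-- For a fixed list the odometer does not depend on `ω`, so the index of the next instruction is
deterministic; measurability then follows by induction on the list. -/
lemma after_used_eq (ω : Sample V) (l : List (V × ℕ × ℕ)) (x : V) :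
    (after ω l).used x = countRings l x := by
  classical
  induction l with
  | nil => simp [after, start, countRings]
  | cons r l ih =>
    by_cases h : r.1 = x
    · subst h
      rw [after_used_self, ih]
      simp [countRings]
    · rw [after_used_of_ne _ _ (Ne.symm h), ih]
      simp [countRings, h]

lemma measurable_perform [Countable V] (x z : V) :
    Measurable fun p : Instruction V × (V → SiteState) => p.1.perform x p.2 z := by
  classical
  refine measurable_from_prod_countable_right fun i => ?_
  cases i with
  | sleep =>
    simp only [Instruction.perform]
    by_cases h : z = x
    · subst h
      simp only [Function.update_self]
      exact (Measurable.of_discrete (f := SiteState.sleep)).comp (measurable_pi_apply z)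
    · simp only [Function.update_of_ne h]
      exact measurable_pi_apply z
  | jump y =>
    simp only [Instruction.perform]
    have h1 : ∀ z, Measurable fun η : V → SiteState => Function.update η x (η x).remove z := by
      intro z
      by_cases h : z = x
      · subst h
        simp only [Function.update_self]
        exact (Measurable.of_discrete (f := SiteState.remove)).comp (measurable_pi_apply z)
      · simp only [Function.update_of_ne h]
        exact measurable_pi_apply z
    by_cases h : z = y
    · subst h
      simp only [Function.update_self]
      exact (Measurable.of_discrete (f := SiteState.add)).comp (h1 z)
    · simp only [Function.update_of_ne h]
      exact h1 z

lemma measurable_after_config [Countable V] (l : List (V × ℕ × ℕ)) :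
    Measurable fun ω : Sample V => (after ω l).config := by
  induction l with
  | nil => exact measurable_fst
  | cons r l ih =>
    refine measurable_pi_lambda _ fun z => ?_
    have : (fun ω : Sample V => (after ω (r :: l)).config z) = fun ω =>
        (ω.instr (r.1, countRings l r.1)).perform r.1 (after ω l).config z := by
      funext ω
      rw [← after_used_eq ω l r.1]
      rfl
    rw [this]
    exact (measurable_perform r.1 z).comp ((measurable_instr _).prodMk ih)

@[fun_prop]
lemma measurable_after_time (l : List (V × ℕ × ℕ)) :
    Measurable fun ω : Sample V => (after ω l).time := by
  cases l with
  | nil => exact measurable_const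
  | cons r l => exact measurable_ringTime r

lemma measurable_numActive [Countable V] (l : List (V × ℕ × ℕ)) (x : V) (i : ℕ) :
    Measurable fun ω : Sample V => i < ((after ω l).config x).numActive :=
  (Measurable.of_discrete (f := fun s : SiteState => i < s.numActive)).comp
    ((measurable_pi_apply x).comp (measurable_after_config l))

lemma measurable_lt_prop {α : Type*} [MeasurableSpace α] {f g : α → ℝ} (hf : Measurable f)
    (hg : Measurable g) : Measurable fun a => f a < g a :=
  measurableSet_setOfPred.1 (measurableSet_lt hf hg)

lemma measurable_le_prop {α : Type*} [MeasurableSpace α] {f g : α → ℝ} (hf : Measurable f)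
    (hg : Measurable g) : Measurable fun a => f a ≤ g a :=
  measurableSet_setOfPred.1 (measurableSet_le hf hg)

lemma measurable_isEffective [Countable V] (B : Finset V) (l : List (V × ℕ × ℕ))
    (r : V × ℕ × ℕ) : Measurable fun ω : Sample V => IsEffective ω B (after ω l) r :=
  measurable_const.and ((measurable_numActive l _ _).and
    (measurable_lt_prop (by fun_prop) (by fun_prop)))

lemma measurable_valid [Countable V] (B : Finset V) (l : List (V × ℕ × ℕ)) :
    Measurable fun ω : Sample V => Valid ω B l := by
  induction l with
  | nil => exact measurable_const
  | cons r l ih =>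
    refine ih.and ((measurable_isEffective B l r).and ?_)
    exact Measurable.forall fun r' => (measurable_isEffective B l r').imp
      (measurable_le_prop (by fun_prop) (by fun_prop))

end ARW

namespace ARW

variable {V : Type*} {ω ω' : Sample V} {B : Finset V}

/-! ### The rate of rings -/

/-- The ring `r` occurs in the system restricted to `B`. -/
def Occurs (ω : Sample V) (B : Finset V) (r : V × ℕ × ℕ) : Prop :=
  ∃ l, Valid ω B (r :: l)

/-- At time `s`, the system restricted to `B` has more than `i` active particles at `x`. -/
def ActiveAt (ω : Sample V) (B : Finset V) (s : ℝ) (x : V) (i : ℕ) : Prop :=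
  ∃ l, Valid ω B l ∧ (after ω l).time ≤ s ∧
    (∀ r, IsEffective ω B (after ω l) r → s < ringTime ω r) ∧
    i < ((after ω l).config x).numActive

/-- The number of rings at `x` up to time `t`. -/
noncomputable def numRings (ω : Sample V) (B : Finset V) (t : ℝ) (x : V) : ℝ≥0∞ :=
  ∑' p : ℕ × ℕ, {ω : Sample V | Occurs ω B (x, p) ∧ ringTime ω (x, p) ≤ t}.indicator 1 ω

lemma measurable_occurs [Countable V] (B : Finset V) (r : V × ℕ × ℕ) :
    Measurable fun ω : Sample V => Occurs ω B r :=
  Measurable.exists fun l => measurable_valid B (r :: l)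

lemma measurableSet_occurs [Countable V] (B : Finset V) (r : V × ℕ × ℕ) (t : ℝ) :
    MeasurableSet {ω : Sample V | Occurs ω B r ∧ ringTime ω r ≤ t} :=
  ((measurable_occurs B r).and (measurable_le_prop (by fun_prop) (by fun_prop))).setOf

lemma measurable_activeAt [Countable V] (B : Finset V) (x : V) (i : ℕ) :
    Measurable fun p : Sample V × ℝ => ActiveAt p.1 B p.2 x i := by
  refine Measurable.exists fun l => ?_
  refine ((measurable_valid B l).comp measurable_fst).and
    ((measurable_le_prop ((measurable_after_time l).comp measurable_fst) measurable_snd).and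
      (Measurable.and (Measurable.forall fun r => ?_)
        ((measurable_numActive l x i).comp measurable_fst)))
  exact ((measurable_isEffective B l r).comp measurable_fst).imp
    (measurable_lt_prop measurable_snd ((measurable_ringTime r).comp measurable_fst))

@[fun_prop]
lemma measurable_numRings [Countable V] (B : Finset V) (t : ℝ) (x : V) :
    Measurable fun ω : Sample V => numRings ω B t x :=
  Measurable.tsum fun p => measurable_one.indicator (measurableSet_occurs B (x, p) t)

/-- Histories up to time `s` only see the rings up to time `s`; changing waiting times whose rings
stay after `s` has no effect. -/
lemma Valid.congr (h1 : ω.init = ω'.init) (h2 : ω.instr = ω'.instr) {s : ℝ}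
    (hr : ∀ r, ringTime ω r = ringTime ω' r ∨ (s < ringTime ω r ∧ s < ringTime ω' r))
    {l : List (V × ℕ × ℕ)} (h : Valid ω B l) (hs : (after ω l).time ≤ s) :
    Valid ω' B l ∧ after ω' l = after ω l := by
  induction l with
  | nil => exact ⟨trivial, by simp [after, start, h1]⟩
  | cons r l ih =>
    rw [after_cons_time] at hs
    obtain ⟨hv, ha⟩ := ih h.1 (h.time_lt.le.trans hs)
    have hrr : ringTime ω r = ringTime ω' r := by
      rcases hr r with h | h
      · exact h
      · exact absurd h.1 (not_lt.2 hs)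
    refine ⟨⟨hv, ?_, fun r' hr' => ?_⟩, ?_⟩
    · rw [ha]
      exact ⟨h.2.1.1, h.2.1.2.1, hrr ▸ h.2.1.2.2⟩
    · rw [ha] at hr'
      rcases hr r' with h' | h'
      · rw [← hrr, ← h']
        exact h.2.2 r' ⟨hr'.1, hr'.2.1, by rw [h']; exact hr'.2.2⟩
      · rw [← hrr]
        exact hs.trans h'.2.le
    · simp only [after, ring, ha, hrr, h2]

/-- A waiting time influences only the ring it ends and the later rings of the same clock, and all
of these come no earlier than that ring, before and after the change. -/
lemma ringTime_setGap_cases (hg : ∀ c, 0 < ω.gap c) (r : V × ℕ × ℕ) {g : ℝ} (hg0 : 0 < g)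
    (r' : V × ℕ × ℕ) : ringTime (ω.setGap r g) r' = ringTime ω r' ∧ r' ≠ r ∨
      (ringTime ω r ≤ ringTime ω r' ∧ prevRingTime ω r + g ≤ ringTime (ω.setGap r g) r') := by
  obtain ⟨x, i, k⟩ := r
  obtain ⟨x', i', k'⟩ := r'
  by_cases h : (x', i') ≠ (x, i) ∨ k' < k
  · refine Or.inl ⟨ringTime_setGap_of_ne _ h _, ?_⟩
    rintro h'
    simp only [Prod.mk.injEq] at h'
    obtain ⟨rfl, rfl, rfl⟩ := h'
    simp at h
  · right
    push Not at h
    obtain ⟨h, hk⟩ := h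
    simp only [Prod.mk.injEq] at h
    obtain ⟨rfl, rfl⟩ := h
    have hg' : ∀ c, 0 < (ω.setGap (x', i', k) g).gap c := by
      intro c
      by_cases hc : c = (x', i', k)
      · rw [hc, gap_setGap_self]
        exact hg0
      · rw [gap_setGap_of_ne _ hc]
        exact hg c
    refine ⟨(ringTime_strictMono hg x' i').monotone hk, ?_⟩
    rw [← ringTime_setGap_self]
    exact (ringTime_strictMono hg' x' i').monotone hk

/-- The waiting time `t + 1` postpones `r` beyond `t`. The system up to `ringTime ω r` does not
notice, and its clock is still in use at that time: activity is expressed without the waiting time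
that ends at `r`. -/
lemma Occurs.activeAt_setGap (hc : Clocks ω) {r : V × ℕ × ℕ} (h : Occurs ω B r) {t : ℝ}
    (ht : ringTime ω r ≤ t) (ht0 : 0 ≤ t) :
    ActiveAt (ω.setGap r (t + 1)) B (ringTime ω r) r.1 r.2.1 := by
  obtain ⟨l, hl⟩ := h
  have hcases := ringTime_setGap_cases hc.gap_pos r (g := t + 1) (by linarith)
  have hprev := prevRingTime_nonneg hc.gap_pos r
  have hlt := hl.time_lt
  obtain ⟨hv, ha⟩ := Valid.congr (ω := ω) (ω' := ω.setGap r (t + 1)) rfl rfl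
    (s := (after ω l).time) (fun r' => (hcases r').imp (fun h => h.1.symm)
      fun h => ⟨by linarith, by linarith⟩) hl.1 le_rfl
  refine ⟨l, hv, by rw [ha]; exact hlt.le, fun r' hr' => ?_, by rw [ha]; exact hl.2.1.2.1⟩
  rw [ha] at hr'
  rcases hcases r' with ⟨h, hne⟩ | h
  · rw [h]
    refine lt_of_le_of_ne (hl.2.2 r' ⟨hr'.1, hr'.2.1, by rw [← h]; exact hr'.2.2⟩) ?_
    exact fun h' => hne (hc.injective h').symm
  · linarith

lemma ActiveAt.of_setGap (hg : ∀ c, 0 < ω.gap c) {r : V × ℕ × ℕ} {t s : ℝ} (hst : s ≤ t)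
    (ht0 : 0 ≤ t) (hs : s < ringTime ω r) {x : V} {i : ℕ}
    (h : ActiveAt (ω.setGap r (t + 1)) B s x i) : ActiveAt ω B s x i := by
  obtain ⟨l, hl, hls, hle, hact⟩ := h
  have hcases := ringTime_setGap_cases hg r (g := t + 1) (by linarith)
  have hprev := prevRingTime_nonneg hg r
  obtain ⟨hv, ha⟩ := Valid.congr (ω := ω.setGap r (t + 1)) (ω' := ω) rfl rfl (s := s)
    (fun r' => (hcases r').imp (fun h => h.1) fun h => ⟨by linarith, by linarith⟩) hl hls
  refine ⟨l, hv, by rw [ha]; exact hls, fun r' hr' => ?_, by rw [ha]; exact hact⟩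
  rcases hcases r' with ⟨h, hne⟩ | h
  · rw [← h]
    rw [ha] at hr'
    exact hle r' ⟨hr'.1, hr'.2.1, by rw [h]; exact hr'.2.2⟩
  · linarith

lemma expMeasure_Ioi {ρ : ℝ} (hρ : 0 < ρ) {a : ℝ} (ha : 0 ≤ a) :
    expMeasure ρ (Set.Ioi a) = ENNReal.ofReal (Real.exp (-(ρ * a))) := by
  have := isProbabilityMeasure_expMeasure hρ
  have h := cdf_expMeasure_eq hρ a
  rw [cdf_eq_real, if_pos ha] at h
  have h2 := probReal_add_probReal_compl (μ := expMeasure ρ) (measurableSet_Iic (a := a))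
  rw [h, Set.compl_Iic] at h2
  rw [← ENNReal.ofReal_toReal (measure_ne_top (expMeasure ρ) (Set.Ioi a))]
  congr 1
  rw [measureReal_def] at h2
  linarith

/-- The density of the exponential law is its rate times its survival function. -/
lemma lintegral_expMeasure {ρ : ℝ} (hρ : 0 < ρ) {f : ℝ → ℝ≥0∞} (hf : Measurable f)
    (h0 : ∀ g ≤ 0, f g = 0) :
    ∫⁻ g, f g ∂(expMeasure ρ) =
      ENNReal.ofReal ρ * ∫⁻ g, expMeasure ρ (Set.Ioi g) * f g := by
  have hm : Measurable (gammaPDF 1 ρ) := (measurable_gammaPDFReal 1 ρ).ennreal_ofReal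
  have hm2 : Measurable fun g : ℝ => expMeasure ρ (Set.Ioi g) := by
    have : Antitone fun g : ℝ => expMeasure ρ (Set.Ioi g) := fun a b h =>
      measure_mono (Set.Ioi_subset_Ioi h)
    exact this.measurable
  rw [← lintegral_const_mul _ (by fun_prop)]
  conv_lhs => rw [expMeasure, gammaMeasure, lintegral_withDensity_eq_lintegral_mul _ hm hf]
  refine lintegral_congr fun g => ?_
  rcases le_or_gt g 0 with hg | hg
  · simp [h0 g hg]
  · rw [expMeasure_Ioi hρ hg.le, ← mul_assoc, ← ENNReal.ofReal_mul hρ.le,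
      ← exponentialPDF_of_nonneg hg.le]
    rfl

variable (G : SimpleGraph V) [G.LocallyFinite] (lam : ℝ≥0) (μ : unitInterval)

/-- The probability that a given ring occurs is bounded by the rate of the clock times the
expected time during which the clock is in use before this ring. -/
theorem measure_occurs_le [Countable V] (B : Finset V) (r : V × ℕ × ℕ) {t : ℝ} (ht : 0 ≤ t) :
    law G lam μ {ω | Occurs ω B r ∧ ringTime ω r ≤ t} ≤
      ENNReal.ofReal (1 + lam) * ∫⁻ s in Set.Ioc 0 t, law G lam μ
        {ω | (prevRingTime ω r < s ∧ s < ringTime ω r) ∧ ActiveAt ω B s r.1 r.2.1} := by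
  classical
  set P := law G lam μ
  set ν := expMeasure (1 + (lam : ℝ))
  have hρ : 0 < 1 + (lam : ℝ) := by positivity
  -- Membership in `D` ignores the waiting time that ends at `r`, as recorded in `hfset`. This
  -- waiting time can therefore be integrated out with the rest frozen.
  let D : Set (Sample V × ℝ) := {p | (prevRingTime p.1 r < p.2 ∧ p.2 ≤ t) ∧
    ActiveAt (p.1.setGap r (t + 1)) B p.2 r.1 r.2.1}
  have hset : Measurable fun p : Sample V × ℝ => (p.1.setGap r (t + 1), p.2) :=
    ((measurable_setGap r).comp (measurable_fst.prodMk measurable_const)).prodMk measurable_snd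
  have hD : MeasurableSet D := by
    refine (((measurable_lt_prop ((measurable_prevRingTime r).comp measurable_fst)
      measurable_snd).and (measurable_le_prop measurable_snd measurable_const)).and ?_).setOf
    exact (measurable_activeAt B r.1 r.2.1).comp hset
  let f : Sample V × ℝ → ℝ≥0∞ := D.indicator 1
  have hf : Measurable f := measurable_one.indicator hD
  have hfset : ∀ ω g s, f (ω.setGap r g, s) = f (ω, s) := by
    intro ω g s
    have : (ω.setGap r g).setGap r (t + 1) = ω.setGap r (t + 1) := by
      simp [Sample.setGap]
    simp only [f, D, Set.indicator_apply, Set.mem_ofPred_eq, prevRingTime_setGap, this,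
      Pi.one_apply]
  have hsurv : Measurable fun g : ℝ => ν (Set.Ioi g) := by
    have : Antitone fun g : ℝ => ν (Set.Ioi g) := fun a b h =>
      measure_mono (Set.Ioi_subset_Ioi h)
    exact this.measurable
  calc P {ω | Occurs ω B r ∧ ringTime ω r ≤ t}
      = ∫⁻ ω, {ω | Occurs ω B r ∧ ringTime ω r ≤ t}.indicator 1 ω ∂P :=
        (lintegral_indicator_one (measurableSet_occurs B r t)).symm
    _ ≤ ∫⁻ ω, f (ω, ringTime ω r) ∂P := by
        refine lintegral_mono_ae ?_
        filter_upwards [ae_clocks G lam μ] with ω hc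
        simp only [f, Set.indicator_apply, Pi.one_apply]
        split_ifs with h1 h2 <;> try exact zero_le
        · exact le_rfl
        · refine absurd ⟨⟨?_, h1.2⟩, h1.1.activeAt_setGap hc h1.2 ht⟩ h2
          simp only
          rw [ringTime_eq]
          linarith [hc.gap_pos r]
    _ = ∫⁻ ω, ∫⁻ g, f (ω, prevRingTime ω r + g) ∂ν ∂P := by
        rw [lintegral_setGap G lam μ r (f := fun ω => f (ω, ringTime ω r))
          (hf.comp (measurable_id.prodMk (measurable_ringTime r)))]
        refine lintegral_congr fun ω => lintegral_congr fun g => ?_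
        simp only [ringTime_setGap_self, hfset]
    -- The exponential density is the rate times the survival function; substituting `s =
    -- prevRingTime ω r + g` turns the integral over the waiting time into one over the time of the
    -- ring.
    _ = ∫⁻ ω, ENNReal.ofReal (1 + lam) *
          (∫⁻ s, ν (Set.Ioi (s - prevRingTime ω r)) * f (ω, s)) ∂P := by
        refine lintegral_congr fun ω => ?_
        rw [lintegral_expMeasure hρ (f := fun g => f (ω, prevRingTime ω r + g)) (hf.comp (by fun_prop : Measurable fun g : ℝ =>
            (ω, prevRingTime ω r + g)))]
        · congr 1
          rw [← lintegral_add_left_eq_self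
            (fun s => ν (Set.Ioi (s - prevRingTime ω r)) * f (ω, s)) (prevRingTime ω r)]
          simp only [add_sub_cancel_left]
          rfl
        · intro g hg
          refine Set.indicator_of_notMem ?_ _
          simp only [D, Set.mem_ofPred_eq, not_and]
          intro h
          linarith [h.1]
    _ = ENNReal.ofReal (1 + lam) *
          ∫⁻ s, ∫⁻ ω, ν (Set.Ioi (s - prevRingTime ω r)) * f (ω, s) ∂P := by
        have hm : Measurable fun p : Sample V × ℝ =>
            ν (Set.Ioi (p.2 - prevRingTime p.1 r)) * f p :=
          (hsurv.comp (measurable_snd.sub ((measurable_prevRingTime r).comp measurable_fst))).mul hf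
        rw [lintegral_const_mul _ hm.lintegral_prod_right',
          lintegral_lintegral_swap hm.aemeasurable]
    _ ≤ _ := by
        refine mul_le_mul_right ?_ _
        rw [← lintegral_indicator measurableSet_Ioc]
        refine lintegral_mono fun s => ?_
        -- The survival function is read back as the probability that a fresh waiting time places
        -- `r` after `s`; on that event postponing `r` does not change the system up to `s`.
        have hback : ∫⁻ ω, ν (Set.Ioi (s - prevRingTime ω r)) * f (ω, s) ∂P =
            ∫⁻ ω, {ω | s < ringTime ω r}.indicator 1 ω * f (ω, s) ∂P := by
          have hms : MeasurableSet {ω : Sample V | s < ringTime ω r} :=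
            measurableSet_lt (by fun_prop) (by fun_prop)
          rw [lintegral_setGap G lam μ r (f := fun ω =>
            {ω | s < ringTime ω r}.indicator 1 ω * f (ω, s))
            ((measurable_one.indicator hms).mul (hf.comp measurable_prodMk_right))]
          refine lintegral_congr fun ω => ?_
          simp only [hfset]
          rw [lintegral_mul_const]
          · congr 1
            rw [← lintegral_indicator_one measurableSet_Ioi]
            refine lintegral_congr fun g => ?_
            simp only [Set.indicator_apply, Set.mem_Ioi, Set.mem_ofPred_eq, ringTime_setGap_self,
              sub_lt_iff_lt_add', Pi.one_apply]
          · exact (measurable_one.indicator hms).comp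
              ((measurable_setGap r).comp measurable_prodMk_left)
        rw [hback]
        have hmt : MeasurableSet {ω : Sample V | (prevRingTime ω r < s ∧ s < ringTime ω r) ∧
            ActiveAt ω B s r.1 r.2.1} :=
          (((measurable_lt_prop (by fun_prop) (by fun_prop)).and
            (measurable_lt_prop (by fun_prop) (by fun_prop))).and
            ((measurable_activeAt B r.1 r.2.1).comp measurable_prodMk_right)).setOf
        by_cases hs : s ∈ Set.Ioc 0 t
        · rw [Set.indicator_of_mem hs, ← lintegral_indicator_one hmt]
          refine lintegral_mono_ae ?_
          filter_upwards [ae_gap_pos G lam μ] with ω hg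
          simp only [f, D, Set.indicator_apply, Set.mem_ofPred_eq, Pi.one_apply, mul_ite, mul_one,
            mul_zero]
          by_cases h1 : s < ringTime ω r <;> by_cases h2 : (prevRingTime ω r < s ∧ s ≤ t) ∧
            ActiveAt (ω.setGap r (t + 1)) B s r.1 r.2.1
          · rw [if_pos h2, if_pos h1, if_pos]
            exact ⟨⟨h2.1.1, h1⟩, h2.2.of_setGap hg hs.2 ht h1⟩
          · rw [if_neg h2]
            exact zero_le
          · rw [if_pos h2, if_neg h1]
            exact zero_le
          · rw [if_neg h2]
            exact zero_le
        · rw [Set.indicator_of_notMem hs, nonpos_iff_eq_zero]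
          refine (lintegral_congr_ae ?_).trans lintegral_zero
          filter_upwards [ae_gap_pos G lam μ] with ω hg
          have hp := prevRingTime_nonneg hg r
          rw [show f (ω, s) = 0 from Set.indicator_of_notMem ?_ _, mul_zero]
          simp only [D, Set.mem_ofPred_eq, not_and]
          rintro ⟨h1, h2⟩
          exact absurd ⟨hp.trans_lt h1, h2⟩ hs

end ARW

/-! ### Non-explosion -/

/-- A Grönwall inequality with a bound not depending on the a priori bound `C`. -/
lemma gronwall_lintegral {F : ℝ → ℝ≥0∞} (hF : Monotone F) {a d : ℝ} (ha : 0 < a) (hd : 0 ≤ d)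
    {t : ℝ} (ht : 0 ≤ t) {C : ℝ≥0∞} (hC : C ≠ ∞) (hFC : F t ≤ C)
    (h : ∀ s, 0 ≤ s → s ≤ t →
      F s ≤ ENNReal.ofReal a * ∫⁻ v in Set.Ioc 0 s, (1 + ENNReal.ofReal d * F v)) :
    F t ≤ ENNReal.ofReal (2 * (a * t) * Real.exp ((2 * a * d + 1) * t)) := by
  -- With the weight `exp (-c s)`, the feedback coefficient is at most `a d / c ≤ 1/2`, so it can be
  -- absorbed; the `+ 1` keeps `c` positive when `d = 0`. The bound `C` only ensures that the
  -- weighted supremum `M` is finite.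
  set c := 2 * a * d + 1
  have hc : 0 < c := by positivity
  set M : ℝ≥0∞ := ⨆ s ∈ Set.Icc 0 t, ENNReal.ofReal (Real.exp (-(c * s))) * F s
  have hMC : M ≤ C := by
    refine iSup₂_le fun s hs => ?_
    calc ENNReal.ofReal (Real.exp (-(c * s))) * F s ≤ 1 * C := by
          refine mul_le_mul' ?_ ((hF hs.2).trans hFC)
          rw [ENNReal.ofReal_le_one]
          have : 0 ≤ c * s := mul_nonneg hc.le hs.1
          simpa using this
      _ = C := one_mul C
  have hMtop : M ≠ ∞ := ne_top_of_le_ne_top hC hMC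
  have hFM : ∀ s ∈ Set.Icc 0 t, F s ≤ ENNReal.ofReal (Real.exp (c * s)) * M := by
    intro s hs
    calc F s = ENNReal.ofReal (Real.exp (c * s)) * (ENNReal.ofReal (Real.exp (-(c * s))) * F s) := by
          rw [← mul_assoc, ← ENNReal.ofReal_mul (Real.exp_nonneg _), ← Real.exp_add]
          simp
      _ ≤ _ := by
          gcongr
          exact le_iSup₂ (f := fun s (_ : s ∈ Set.Icc 0 t) =>
            ENNReal.ofReal (Real.exp (-(c * s))) * F s) s hs
  have hintegral : ∀ s, 0 ≤ s → ∫⁻ v in Set.Ioc 0 s, ENNReal.ofReal (Real.exp (c * v)) ≤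
      ENNReal.ofReal (Real.exp (c * s) / c) := by
    intro s hs
    rw [← ofReal_integral_eq_lintegral_ofReal]
    · refine ENNReal.ofReal_le_ofReal ?_
      rw [← intervalIntegral.integral_of_le hs, intervalIntegral.integral_comp_mul_left
        (fun x => Real.exp x) hc.ne', integral_exp]
      simp only [mul_zero, Real.exp_zero, smul_eq_mul, div_eq_inv_mul]
      have : 0 < c⁻¹ := by positivity
      nlinarith
    · exact (by fun_prop : Continuous fun v => Real.exp (c * v)).integrableOn_Ioc
    · exact ae_of_all _ fun v => (Real.exp_nonneg _)
  have hstep : M ≤ ENNReal.ofReal (a * t) + ENNReal.ofReal (1 / 2) * M := by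
    refine iSup₂_le fun s hs => ?_
    have h1 : ∫⁻ v in Set.Ioc 0 s, (1 + ENNReal.ofReal d * F v) ≤
        ENNReal.ofReal t + ENNReal.ofReal d * (ENNReal.ofReal (Real.exp (c * s) / c) * M) := by
      calc ∫⁻ v in Set.Ioc 0 s, (1 + ENNReal.ofReal d * F v)
          ≤ ∫⁻ v in Set.Ioc 0 s, (1 + ENNReal.ofReal d * (ENNReal.ofReal (Real.exp (c * v)) * M)) := by
            refine setLIntegral_mono' measurableSet_Ioc fun v hv => ?_
            gcongr
            exact hFM v ⟨hv.1.le, hv.2.trans hs.2⟩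
        _ = ENNReal.ofReal s + ENNReal.ofReal d *
              ((∫⁻ v in Set.Ioc 0 s, ENNReal.ofReal (Real.exp (c * v))) * M) := by
            rw [lintegral_add_left measurable_const, lintegral_const_mul _ (by fun_prop),
              lintegral_mul_const _ (by fun_prop)]
            simp
        _ ≤ _ := by
            gcongr
            · exact hs.2
            · exact hintegral s hs.1
    calc ENNReal.ofReal (Real.exp (-(c * s))) * F s
        ≤ ENNReal.ofReal (Real.exp (-(c * s))) * (ENNReal.ofReal a * (ENNReal.ofReal t +
            ENNReal.ofReal d * (ENNReal.ofReal (Real.exp (c * s) / c) * M))) := by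
          gcongr
          exact (h s hs.1 hs.2).trans (by gcongr)
      _ = ENNReal.ofReal (Real.exp (-(c * s)) * (a * t)) +
            ENNReal.ofReal (Real.exp (-(c * s)) * (a * (d * (Real.exp (c * s) / c)))) * M := by
          rw [mul_add, mul_add, ENNReal.ofReal_mul (Real.exp_nonneg _), ENNReal.ofReal_mul ha.le,
            ENNReal.ofReal_mul (Real.exp_nonneg _), ENNReal.ofReal_mul ha.le, ENNReal.ofReal_mul hd]
          ring
      _ ≤ _ := by
          refine add_le_add (ENNReal.ofReal_le_ofReal ?_)
            (mul_le_mul_left (ENNReal.ofReal_le_ofReal ?_) _)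
          · have : Real.exp (-(c * s)) ≤ 1 := by
              have : 0 ≤ c * s := mul_nonneg hc.le hs.1
              simpa using this
            have : 0 ≤ a * t := by positivity
            nlinarith
          · have : Real.exp (-(c * s)) * (a * (d * (Real.exp (c * s) / c))) =
                (Real.exp (-(c * s)) * Real.exp (c * s)) * (a * d / c) := by ring
            rw [this, ← Real.exp_add]
            simp only [neg_add_cancel, Real.exp_zero, one_mul]
            rw [div_le_div_iff₀ hc two_pos]
            simp only [c]
            linarith
  have hM2 : M ≤ ENNReal.ofReal (2 * (a * t)) := by
    lift M to ℝ≥0 using hMtop with m hm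
    rw [← ENNReal.ofReal_coe_nnreal, ← ENNReal.ofReal_mul (by norm_num),
      ← ENNReal.ofReal_add (by positivity) (by positivity),
      ENNReal.ofReal_le_ofReal_iff (by positivity)] at hstep
    rw [← ENNReal.ofReal_coe_nnreal]
    refine ENNReal.ofReal_le_ofReal ?_
    linarith
  calc F t ≤ ENNReal.ofReal (Real.exp (c * t)) * M := hFM t ⟨ht, le_rfl⟩
    _ ≤ ENNReal.ofReal (Real.exp (c * t)) * ENNReal.ofReal (2 * (a * t)) := by gcongr
    _ = _ := by rw [← ENNReal.ofReal_mul (Real.exp_nonneg _), mul_comm]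

namespace ARW

variable {V : Type*} {ω : Sample V} {B : Finset V}

lemma Valid.used_le_numRings {l : List (V × ℕ × ℕ)} (h : Valid ω B l) {t : ℝ}
    (ht : (after ω l).time ≤ t) (x : V) : ((after ω l).used x : ℝ≥0∞) ≤ numRings ω B t x := by
  classical
  rw [after_used_eq]
  set S : Finset (ℕ × ℕ) := ((l.filter fun r => r.1 = x).map Prod.snd).toFinset
  have hnd : ((l.filter fun r => r.1 = x).map Prod.snd).Nodup := by
    refine List.Nodup.map_on ?_ (h.nodup.filter _)
    rintro ⟨x₁, p₁⟩ h₁ ⟨x₂, p₂⟩ h₂ hp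
    simp only [List.mem_filter, decide_eq_true_eq] at h₁ h₂
    simp_all
  have hS : S.card = countRings l x := by
    rw [List.toFinset_card_of_nodup hnd, List.length_map, countRings, List.countP_eq_length_filter]
  have hmem : ∀ p ∈ S, (x, p) ∈ l := by
    intro p hp
    simp only [S, List.mem_toFinset, List.mem_map, List.mem_filter, decide_eq_true_eq] at hp
    obtain ⟨⟨x', p'⟩, ⟨h1, rfl⟩, rfl⟩ := hp
    exact h1
  rw [← hS, Finset.card_eq_sum_ones, Nat.cast_sum]
  refine le_trans (Finset.sum_le_sum fun p hp => ?_) (ENNReal.sum_le_tsum S)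
  have hp := hmem p hp
  rw [Set.indicator_of_mem]
  · simp
  · refine ⟨?_, (h.ringTime_le hp).trans ht⟩
    obtain ⟨l₁, l₂, rfl⟩ := List.append_of_mem hp
    exact ⟨l₂, h.of_suffix (List.suffix_append _ _)⟩

lemma numRings_mono (ω : Sample V) (B : Finset V) (x : V) :
    Monotone fun t => numRings ω B t x := by
  intro s t hst
  refine ENNReal.tsum_le_tsum fun p => ?_
  refine Set.indicator_le_indicator_of_subset ?_ (fun _ => zero_le) ω
  exact fun ω hω => show _ ∧ _ from ⟨hω.1, hω.2.trans hst⟩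

/-- Among finitely many indices satisfying `p`, the largest one, `i`, forces their number to be at
most `i + 1`. -/
lemma tsum_indicator_le_of_imp {p : ℕ → Prop} {R : ℝ≥0∞} [DecidablePred p]
    (h : ∀ i, p i → ((i + 1 : ℕ) : ℝ≥0∞) ≤ R) : ∑' i, (if p i then (1 : ℝ≥0∞) else 0) ≤ R := by
  rw [ENNReal.tsum_eq_iSup_nat]
  refine iSup_le fun n => ?_
  by_cases hne : ((Finset.range n).filter p).Nonempty
  · obtain ⟨i, hi, hmax⟩ := Finset.exists_max_image _ id hne
    rw [Finset.sum_boole]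
    refine le_trans ?_ (h i (Finset.mem_filter.1 hi).2)
    rw [Nat.cast_le, ← Finset.card_range (i + 1)]
    exact Finset.card_le_card fun j hj => Finset.mem_range.2 (Nat.lt_succ_of_le (hmax j hj))
  · rw [Finset.not_nonempty_iff_eq_empty] at hne
    rw [Finset.sum_boole, hne]
    simp

variable {G : SimpleGraph V}

lemma tsum_activeAt_le_card (hω : Regular G ω) (s : ℝ) {x : V} (hx : x ∈ B) :
    ∑' i, {ω : Sample V | ActiveAt ω B s x i}.indicator (1 : Sample V → ℝ≥0∞) ω ≤ B.card := by
  classical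
  simp only [Set.indicator_apply, Set.mem_ofPred_eq, Pi.one_apply]
  refine tsum_indicator_le_of_imp fun i hi => ?_
  obtain ⟨l, hl, hls, -, hact⟩ := hi
  rw [Nat.cast_le]
  exact hact.trans_le (hl.numActive_le hω hx)

variable [G.LocallyFinite]

/-- The particles at `x` are at most the initial one and those sent by rings at neighbours. This
bound does not involve the size of `B` and closes the Grönwall argument. -/
lemma tsum_activeAt_le (hω : Regular G ω) (s : ℝ) (x : V) :
    ∑' i, {ω : Sample V | ActiveAt ω B s x i}.indicator (1 : Sample V → ℝ≥0∞) ω ≤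
      1 + ∑ y ∈ G.neighborFinset x, numRings ω B s y := by
  classical
  simp only [Set.indicator_apply, Set.mem_ofPred_eq, Pi.one_apply]
  refine tsum_indicator_le_of_imp fun i hi => ?_
  obtain ⟨l, hl, hls, -, hact⟩ := hi
  calc ((i + 1 : ℕ) : ℝ≥0∞) ≤ ((1 + ∑ y ∈ G.neighborFinset x, (after ω l).used y : ℕ) : ℝ≥0∞) := by
        rw [Nat.cast_le]
        exact hact.trans_le ((SiteState.numActive_le_total _).trans (hl.reach.total_le hω x))
    _ ≤ _ := by
        push_cast
        gcongr with y _
        exact hl.used_le_numRings hls y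

/-- The open intervals between consecutive rings of one clock are disjoint. -/
lemma tsum_between_le_one (hg : ∀ c, 0 < ω.gap c) (x : V) (i : ℕ) (s : ℝ) :
    ∑' k, {ω : Sample V | prevRingTime ω (x, i, k) < s ∧ s < ringTime ω (x, i, k)}.indicator
      (1 : Sample V → ℝ≥0∞) ω ≤ 1 := by
  classical
  simp only [Set.indicator_apply, Set.mem_ofPred_eq, Pi.one_apply]
  by_cases h : ∃ k, prevRingTime ω (x, i, k) < s ∧ s < ringTime ω (x, i, k)
  · obtain ⟨k, hk1, hk2⟩ := h
    rw [tsum_eq_single k]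
    · split_ifs <;> simp
    · intro k' hk'
      refine if_neg ?_
      rintro ⟨h1, h2⟩
      have hmono := (ringTime_strictMono hg x i).monotone
      rcases lt_or_gt_of_ne hk' with hlt | hlt
      · obtain ⟨m, rfl⟩ : ∃ m, k = m + 1 := ⟨k - 1, by omega⟩
        rw [prevRingTime_succ] at hk1
        have : ringTime ω (x, i, k') ≤ ringTime ω (x, i, m) := hmono (by omega)
        linarith
      · obtain ⟨m, rfl⟩ : ∃ m, k' = m + 1 := ⟨k' - 1, by omega⟩
        rw [prevRingTime_succ] at h1
        have : ringTime ω (x, i, k) ≤ ringTime ω (x, i, m) := hmono (by omega)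
        linarith
  · push Not at h
    have : ∀ k, (if prevRingTime ω (x, i, k) < s ∧ s < ringTime ω (x, i, k) then (1 : ℝ≥0∞) else 0)
        = 0 := fun k => if_neg fun hk => absurd (h k hk.1) (not_le.2 hk.2)
    simp [this]

variable (G) (lam : ℝ≥0) (μ : unitInterval)

theorem lintegral_numRings_le [Countable V] (B : Finset V) {t : ℝ} (ht : 0 ≤ t) (x : V) :
    ∫⁻ ω, numRings ω B t x ∂(law G lam μ) ≤ ENNReal.ofReal (1 + lam) * ∫⁻ s in Set.Ioc 0 t,
      ∫⁻ ω, ∑' i, {ω : Sample V | ActiveAt ω B s x i}.indicator (1 : Sample V → ℝ≥0∞) ω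
        ∂(law G lam μ) := by
  classical
  set P := law G lam μ
  have hmA : ∀ i, MeasurableSet {p : Sample V × ℝ | ActiveAt p.1 B p.2 x i} := fun i =>
    (measurable_activeAt B x i).setOf
  have hmI : ∀ r : V × ℕ × ℕ, MeasurableSet {p : Sample V × ℝ |
      prevRingTime p.1 r < p.2 ∧ p.2 < ringTime p.1 r} := fun r =>
    ((measurable_lt_prop ((measurable_prevRingTime r).comp measurable_fst) measurable_snd).and
      (measurable_lt_prop measurable_snd ((measurable_ringTime r).comp measurable_fst))).setOf
  have hs1 : ∀ s i, MeasurableSet {ω : Sample V | ActiveAt ω B s x i} := fun s i =>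
    measurable_prodMk_right (hmA i)
  have hs2 : ∀ s (r : V × ℕ × ℕ), MeasurableSet {ω : Sample V |
      prevRingTime ω r < s ∧ s < ringTime ω r} := fun s r => measurable_prodMk_right (hmI r)
  have hmeas : ∀ p : ℕ × ℕ, Measurable fun s : ℝ => P {ω | (prevRingTime ω (x, p) < s ∧
      s < ringTime ω (x, p)) ∧ ActiveAt ω B s x p.1} := fun p =>
    measurable_measure_prodMk_right ((hmI (x, p)).inter (hmA p.1))
  calc ∫⁻ ω, numRings ω B t x ∂P
      = ∑' p : ℕ × ℕ, P {ω | Occurs ω B (x, p) ∧ ringTime ω (x, p) ≤ t} := by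
        unfold numRings
        rw [lintegral_tsum fun p =>
          (measurable_one.indicator (measurableSet_occurs B (x, p) t)).aemeasurable]
        exact tsum_congr fun p => lintegral_indicator_one (measurableSet_occurs B (x, p) t)
    _ ≤ ∑' p : ℕ × ℕ, ENNReal.ofReal (1 + lam) * ∫⁻ s in Set.Ioc 0 t, P {ω |
          (prevRingTime ω (x, p) < s ∧ s < ringTime ω (x, p)) ∧ ActiveAt ω B s x p.1} :=
        ENNReal.tsum_le_tsum fun p => measure_occurs_le G lam μ B (x, p) ht
    _ = ENNReal.ofReal (1 + lam) * ∫⁻ s in Set.Ioc 0 t, ∑' p : ℕ × ℕ, P {ω |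
          (prevRingTime ω (x, p) < s ∧ s < ringTime ω (x, p)) ∧ ActiveAt ω B s x p.1} := by
        rw [ENNReal.tsum_mul_left, lintegral_tsum fun p => (hmeas p).aemeasurable]
    _ ≤ _ := by
        refine mul_le_mul_right (lintegral_mono fun s => ?_) _
        have h1 : ∀ p : ℕ × ℕ, P {ω | (prevRingTime ω (x, p) < s ∧ s < ringTime ω (x, p)) ∧
            ActiveAt ω B s x p.1} = ∫⁻ ω, {ω : Sample V | prevRingTime ω (x, p) < s ∧
              s < ringTime ω (x, p)}.indicator 1 ω *
              {ω : Sample V | ActiveAt ω B s x p.1}.indicator 1 ω ∂P := by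
          intro p
          refine (lintegral_indicator_one ((hs2 s (x, p)).inter (hs1 s p.1))).symm.trans ?_
          refine lintegral_congr fun ω => ?_
          rw [Set.inter_indicator_one]
          rfl
        simp_rw [h1]
        rw [← lintegral_tsum (f := fun (p : ℕ × ℕ) ω => {ω : Sample V | prevRingTime ω (x, p) < s ∧
          s < ringTime ω (x, p)}.indicator 1 ω * {ω : Sample V | ActiveAt ω B s x p.1}.indicator 1 ω)
          fun p => ((measurable_one.indicator (hs2 s (x, p))).mul
          (measurable_one.indicator (hs1 s p.1))).aemeasurable]
        refine lintegral_mono_ae ?_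
        filter_upwards [ae_gap_pos G lam μ] with ω hg
        rw [ENNReal.tsum_prod (f := fun i k => {ω : Sample V | prevRingTime ω (x, i, k) < s ∧
          s < ringTime ω (x, i, k)}.indicator 1 ω * {ω : Sample V | ActiveAt ω B s x i}.indicator 1 ω)]
        refine ENNReal.tsum_le_tsum fun i => ?_
        rw [ENNReal.tsum_mul_right]
        calc _ ≤ 1 * {ω : Sample V | ActiveAt ω B s x i}.indicator (1 : Sample V → ℝ≥0∞) ω := by
              gcongr
              exact tsum_between_le_one hg x i s
          _ = _ := one_mul _

theorem lintegral_numRings_le_of_degree_le [Countable V]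
    (hG : ∀ x, (G.neighborFinset x).Nonempty) {d : ℕ} (hd : ∀ x, G.degree x ≤ d) (B : Finset V)
    {t : ℝ} (ht : 0 ≤ t) (x : V) :
    ∫⁻ ω, numRings ω B t x ∂(law G lam μ) ≤ ENNReal.ofReal
      (2 * ((1 + lam) * t) * Real.exp ((2 * (1 + lam) * d + 1) * t)) := by
  set P := law G lam μ
  let F : ℝ → ℝ≥0∞ := fun t => ⨆ x, ∫⁻ ω, numRings ω B t x ∂P
  have hFmono : Monotone F := fun s t hst =>
    iSup_mono fun x => lintegral_mono fun ω => numRings_mono ω B x hst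
  -- Finiteness for each `B`, from the crude bound of `B.card` active particles; it disappears from
  -- the final estimate, which is uniform in `B`.
  have hC : F t ≤ ENNReal.ofReal (1 + lam) * (B.card * ENNReal.ofReal t) := by
    refine iSup_le fun x => ?_
    by_cases hx : x ∈ B
    · refine (lintegral_numRings_le G lam μ B ht x).trans (mul_le_mul_right ?_ _)
      calc _ ≤ ∫⁻ s in Set.Ioc 0 t, (B.card : ℝ≥0∞) := by
            refine lintegral_mono fun s => ?_
            calc _ ≤ ∫⁻ ω, (B.card : ℝ≥0∞) ∂P := by
                  refine lintegral_mono_ae ?_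
                  filter_upwards [ae_regular G lam μ hG] with ω hω
                  exact tsum_activeAt_le_card hω s hx
              _ = B.card := by simp
        _ = _ := by simp
    · have h0 : ∀ ω, numRings ω B t x = 0 := by
        intro ω
        rw [numRings, ENNReal.tsum_eq_zero]
        intro p
        refine Set.indicator_of_notMem ?_ _
        rintro ⟨⟨l, hl⟩, -⟩
        exact hx hl.2.1.1
      simp [h0]
  refine (le_iSup (fun x => ∫⁻ ω, numRings ω B t x ∂P) x).trans ?_
  refine gronwall_lintegral (F := F) hFmono (by positivity) (by positivity) ht (C := _) ?_ hC
    fun s hs _ => ?_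
  · exact ENNReal.mul_ne_top ENNReal.ofReal_ne_top
      (ENNReal.mul_ne_top (ENNReal.natCast_ne_top _) ENNReal.ofReal_ne_top)
  refine iSup_le fun x => (lintegral_numRings_le G lam μ B hs x).trans
    (mul_le_mul_right (lintegral_mono fun v => ?_) _)
  calc _ ≤ ∫⁻ ω, (1 + ∑ y ∈ G.neighborFinset x, numRings ω B v y) ∂P := by
        refine lintegral_mono_ae ?_
        filter_upwards [ae_regular G lam μ hG] with ω hω
        exact tsum_activeAt_le hω v x
    _ = 1 + ∑ y ∈ G.neighborFinset x, ∫⁻ ω, numRings ω B v y ∂P := by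
        rw [lintegral_add_left measurable_const, lintegral_finsetSum _ fun y _ => by fun_prop]
        simp
    _ ≤ 1 + ∑ y ∈ G.neighborFinset x, F v := by
        gcongr with y _
        exact le_iSup (fun x => ∫⁻ ω, numRings ω B v x ∂P) y
    _ ≤ _ := by
        rw [Finset.sum_const, nsmul_eq_mul, ENNReal.ofReal_natCast]
        gcongr
        exact hd x

/-- Fatou's lemma along an exhaustion by finite sets makes the lower limit of the numbers of rings
finite almost surely, and monotonicity in `B` turns it into a bound for every finite system. Integer
times suffice. -/
theorem ae_nonExplosive [Countable V] (hG : ∀ x, (G.neighborFinset x).Nonempty) {d : ℕ}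
    (hd : ∀ x, G.degree x ≤ d) : ∀ᵐ ω ∂(law G lam μ), NonExplosive ω := by
  obtain ⟨e, he⟩ := Countable.exists_injective_nat V
  have hfin : ∀ n : ℕ, {x | e x < n}.Finite := fun n =>
    (Set.finite_Iio n).preimage he.injOn
  let C : ℕ → Finset V := fun n => (hfin n).toFinset
  have hae : ∀ᵐ ω ∂(law G lam μ), ∀ (n : ℕ) (x : V),
      liminf (fun m => numRings ω (C m) n x) atTop < ∞ := by
    simp_rw [ae_all_iff]
    intro n x
    refine ae_lt_top (Measurable.liminf fun m => by fun_prop) ?_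
    refine ne_top_of_le_ne_top ?_ (lintegral_liminf_le fun m => by fun_prop)
    refine ne_top_of_le_ne_top (b := ENNReal.ofReal
      (2 * ((1 + lam) * n) * Real.exp ((2 * (1 + lam) * d + 1) * n))) ENNReal.ofReal_ne_top ?_
    refine (liminf_le_liminf (Eventually.of_forall fun m =>
      lintegral_numRings_le_of_degree_le G lam μ hG hd (C m) n.cast_nonneg x)).trans ?_
    simp
  filter_upwards [hae, ae_regular G lam μ hG, ae_clocks G lam μ] with ω hae hω hc
  intro t x
  obtain ⟨n, hn⟩ := exists_nat_ge t
  obtain ⟨K, hK⟩ := ENNReal.exists_nat_gt (hae n x).ne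
  refine ⟨K, fun B l hl hlt => ?_⟩
  have hev : ∀ᶠ m in atTop, ((after ω l).used x : ℝ≥0∞) ≤ numRings ω (C m) n x := by
    obtain ⟨N, hN⟩ : ∃ N, ∀ y ∈ B, e y < N := by
      refine ⟨B.sup e + 1, fun y hy => Nat.lt_succ_of_le (Finset.le_sup hy)⟩
    filter_upwards [eventually_ge_atTop N] with m hm
    have hsub : B ⊆ C m := fun y hy => by
      simpa [C] using (hN y hy).trans_le hm
    obtain ⟨l', hl'⟩ := exists_terminal hω hc (C m) (Nat.cast_nonneg (α := ℝ) n)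
    refine le_trans ?_ (hl'.valid.used_le_numRings hl'.time_le x)
    exact Nat.cast_le.2 (hl.used_le hω hc hsub (hlt.trans hn) hl' x)
  have hle := le_liminf_of_le (by isBoundedDefault) hev
  exact_mod_cast (hle.trans_lt hK).le

end ARW

/-! ### Balls -/

lemma SimpleGraph.Connected.dist_le_succ {V : Type*} {G : SimpleGraph V}
    (hG : G.Connected) (o : V) {x y : V} (h : G.Adj x y) :
    G.dist o y ≤ G.dist o x + 1 := by
  have := hG.dist_triangle (u := o) (v := x) (w := y)
  rwa [SimpleGraph.dist_eq_one_iff_adj.2 h] at this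

section Balls

variable {V : Type*} (G : SimpleGraph V) [G.LocallyFinite]

open Classical in
/-- A finite set containing the ball of radius `n` around `o`. -/
noncomputable def SimpleGraph.ballFinset (o : V) : ℕ → Finset V
  | 0 => {o}
  | n + 1 => (ballFinset o n).biUnion fun y => insert y (G.neighborFinset y)

lemma SimpleGraph.ballFinset_mono (o : V) : Monotone (G.ballFinset o) := by
  classical
  refine monotone_nat_of_le_succ fun n x hx => ?_
  exact Finset.mem_biUnion.2 ⟨x, hx, Finset.mem_insert_self _ _⟩

lemma SimpleGraph.Walk.mem_ballFinset {o z : V} (p : G.Walk z o) : z ∈ G.ballFinset o p.length := by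
  classical
  induction p with
  | nil => simp [SimpleGraph.ballFinset]
  | @cons u v w h q ih =>
    refine Finset.mem_biUnion.2 ⟨v, ih, Finset.mem_insert_of_mem ?_⟩
    simpa using h.symm

variable {G}

lemma SimpleGraph.Connected.mem_ballFinset (hG : G.Connected) {o z : V} {n : ℕ}
    (h : G.dist o z ≤ n) : z ∈ G.ballFinset o n := by
  obtain ⟨p, hp⟩ := hG.exists_walk_length_eq_dist z o
  refine G.ballFinset_mono o ?_ (p.mem_ballFinset)
  rw [hp, G.dist_comm]
  exact h

lemma SimpleGraph.Connected.countable (hG : G.Connected) : Countable V := by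
  obtain ⟨o⟩ := hG.nonempty
  refine Set.countable_univ_iff.1 ((Set.countable_iUnion fun n =>
    (G.ballFinset o n).countable_toSet).mono fun z _ => ?_)
  exact Set.mem_iUnion.2 ⟨G.dist o z, hG.mem_ballFinset le_rfl⟩

lemma SimpleGraph.Connected.neighborFinset_nonempty [Infinite V] (hG : G.Connected) (x : V) :
    (G.neighborFinset x).Nonempty := by
  obtain ⟨y, hy⟩ := exists_ne x
  obtain ⟨p⟩ := hG.preconnected x y
  cases p with
  | nil => exact absurd rfl hy
  | @cons _ v _ h q => exact ⟨v, by simpa using h⟩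

lemma IsVertexTransitive.degree_eq (h : IsVertexTransitive G) (x y : V) :
    G.degree x = G.degree y := by
  obtain ⟨φ, rfl⟩ := h x y
  exact (φ.degree_eq x).symm

end Balls

/-! ### Simple random walk -/

namespace IsSimpleRandomWalk

variable {V : Type*} {G : SimpleGraph V} [G.LocallyFinite] {o : V} {Ω : Type*} [MeasurableSpace Ω]
  {P : Measure Ω} {X : ℕ → Ω → V}

/-! ### Markov property and Green functions of the killed walk -/

/-- The predicate on trajectories only depends on the first `n + 1` positions. -/
def DependsUpTo (n : ℕ) (φ : (ℕ → V) → Prop) : Prop :=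
  ∀ p q : ℕ → V, (∀ i ≤ n, p i = q i) → φ p → φ q

lemma dependsUpTo_forall_mem (D : Set V) (j : ℕ) :
    DependsUpTo j fun p : ℕ → V => ∀ i, 1 ≤ i → i ≤ j → p i ∈ D :=
  fun _ _ h hp i h1 h2 => h i h2 ▸ hp i h1 h2

/-- The probability that the walk stays in `D` at times `1, …, j` and is at `y` at time `j`. -/
noncomputable def killed (P : Measure Ω) (X : ℕ → Ω → V) (D : Set V) (j : ℕ) (y : V) : ℝ :=
  P.real {ω | (∀ i, 1 ≤ i → i ≤ j → X i ω ∈ D) ∧ X j ω = y}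

lemma killed_succ_of_notMem (D : Set V) (j : ℕ) {y : V} (hy : y ∉ D) :
    killed P X D (j + 1) y = 0 := by
  have : {ω | (∀ i, 1 ≤ i → i ≤ j + 1 → X i ω ∈ D) ∧ X (j + 1) ω = y} = ∅ := by
    ext ω
    simp only [Set.mem_ofPred_eq, Set.mem_empty_iff_false, iff_false]
    rintro ⟨h, h'⟩
    exact hy (h' ▸ h (j + 1) (by omega) le_rfl)
  rw [killed, this]
  simp

lemma killed_nonneg (D : Set V) (j : ℕ) (y : V) : 0 ≤ killed P X D j y := measureReal_nonneg

/-- The expected number of visits to `y`, up to time `n`, of the walk killed when leaving `D`. -/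
noncomputable def green (P : Measure Ω) (X : ℕ → Ω → V) (D : Set V) (n : ℕ) (y : V) : ℝ :=
  ∑ j ∈ Finset.range (n + 1), killed P X D j y

lemma green_nonneg (D : Set V) (n : ℕ) (y : V) : 0 ≤ green P X D n y :=
  Finset.sum_nonneg fun _ _ => killed_nonneg _ _ _

lemma measurableSet_path (hX : IsSimpleRandomWalk G o P X) (n : ℕ) (p : ℕ → V) :
    MeasurableSet {ω | ∀ i ≤ n, X i ω = p i} := by
  have : {ω | ∀ i ≤ n, X i ω = p i} = ⋂ i, ⋂ (_ : i ≤ n), {ω | X i ω = p i} := by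
    ext
    simp
  rw [this]
  exact MeasurableSet.iInter fun i => MeasurableSet.iInter fun _ => hX.measurable i _

lemma measure_path_adj (hX : IsSimpleRandomWalk G o P X) (n : ℕ) (p : ℕ → V) (h0 : p 0 = o)
    (hp : ∀ i < n, G.Adj (p i) (p (i + 1))) {y : V} (hy : G.Adj (p n) y) :
    P {ω | (∀ i ≤ n, X i ω = p i) ∧ X (n + 1) ω = y} =
      P {ω | ∀ i ≤ n, X i ω = p i} * (G.degree (p n) : ℝ≥0∞)⁻¹ := by
  classical
  have hne : ∀ i ≤ n, Function.update p (n + 1) y i = p i := fun i hi =>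
    Function.update_of_ne (by omega) _ _
  have h1 := hX.path (n + 1) (Function.update p (n + 1) y) (by rw [hne 0 (by omega), h0])
    (fun i hi => by
      rw [hne i (by omega)]
      rcases Nat.lt_succ_iff_lt_or_eq.1 hi with hi | rfl
      · rw [hne (i + 1) (by omega)]
        exact hp i hi
      · simpa using hy)
  have h2 : {ω | ∀ i ≤ n + 1, X i ω = Function.update p (n + 1) y i} =
      {ω | (∀ i ≤ n, X i ω = p i) ∧ X (n + 1) ω = y} := by
    ext ω
    constructor
    · intro h
      exact ⟨fun i hi => (h i (by omega)).trans (hne i hi), (h (n + 1) le_rfl).trans (by simp)⟩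
    · rintro ⟨h, h'⟩ i hi
      rcases Nat.lt_or_ge n i with hi' | hi'
      · obtain rfl : i = n + 1 := by omega
        simpa using h'
      · rw [hne i hi']
        exact h i hi'
  rw [h2] at h1
  rw [h1, hX.path n p h0 hp, Finset.prod_range_succ, hne n le_rfl]
  congr 1
  exact Finset.prod_congr rfl fun i hi => by rw [hne i (Finset.mem_range.1 hi).le]

lemma measurableSet_of_dependsUpTo [Countable V] (hX : IsSimpleRandomWalk G o P X) {n : ℕ}
    {φ : (ℕ → V) → Prop} (hφ : DependsUpTo n φ) : MeasurableSet {ω | φ fun i => X i ω} := by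
  have : {ω | φ fun i => X i ω} = ⋃ q : Fin (n + 1) → V,
      ⋃ (_ : φ fun i => q (Fin.ofNat (n + 1) i)),
        {ω | ∀ i ≤ n, X i ω = q (Fin.ofNat (n + 1) i)} := by
    ext ω
    simp only [Set.mem_iUnion, Set.mem_ofPred_eq, exists_prop]
    constructor
    · intro h
      refine ⟨fun i => X i ω, hφ _ _ (fun i hi => ?_) h, fun i hi => ?_⟩ <;>
        simp [Nat.mod_eq_of_lt (Nat.lt_succ_of_le hi)]
    · rintro ⟨q, hq, h⟩
      exact hφ _ _ (fun i hi => (h i hi).symm) hq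
  rw [this]
  exact MeasurableSet.iUnion fun q => MeasurableSet.iUnion fun _ =>
    hX.measurableSet_path n fun i => q (Fin.ofNat (n + 1) i)

variable [IsProbabilityMeasure P]

/-- The definition of the walk only prescribes probabilities along edges. The neighbours already
exhaust the probability of the path so far, so nothing remains for a non-neighbour. -/
lemma measure_path_not_adj (hX : IsSimpleRandomWalk G o P X) (hdeg : ∀ x, G.degree x ≠ 0) (n : ℕ)
    (p : ℕ → V) (h0 : p 0 = o) (hp : ∀ i < n, G.Adj (p i) (p (i + 1))) {y : V}
    (hy : ¬ G.Adj (p n) y) : P {ω | (∀ i ≤ n, X i ω = p i) ∧ X (n + 1) ω = y} = 0 := by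
  classical
  set E := {ω | ∀ i ≤ n, X i ω = p i}
  have hE : MeasurableSet E := hX.measurableSet_path n p
  have hm : ∀ y, MeasurableSet (E ∩ {ω | X (n + 1) ω = y}) := fun y =>
    hE.inter (hX.measurable _ _)
  have hdisj : Set.PairwiseDisjoint (↑(insert y (G.neighborFinset (p n))) : Set V)
      fun z => E ∩ {ω | X (n + 1) ω = z} := by
    intro y₁ _ y₂ _ hne
    refine Set.disjoint_left.2 fun ω h₁ h₂ => hne ?_
    exact h₁.2.symm.trans h₂.2
  have hle := measure_mono (μ := P) (show (⋃ z ∈ insert y (G.neighborFinset (p n)),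
    E ∩ {ω | X (n + 1) ω = z}) ⊆ E from Set.iUnion₂_subset fun _ _ => Set.inter_subset_left)
  rw [measure_biUnion_finset hdisj fun y _ => hm y, Finset.sum_insert (by simpa using hy)] at hle
  have hsum : ∑ y ∈ G.neighborFinset (p n), P (E ∩ {ω | X (n + 1) ω = y}) = P E := by
    have : ∀ y ∈ G.neighborFinset (p n), P (E ∩ {ω | X (n + 1) ω = y}) =
        P E * (G.degree (p n) : ℝ≥0∞)⁻¹ := fun y hy =>
      hX.measure_path_adj n p h0 hp (by simpa using hy)
    rw [Finset.sum_congr rfl this, Finset.sum_const, SimpleGraph.card_neighborFinset_eq_degree,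
      nsmul_eq_mul, mul_left_comm, ENNReal.mul_inv_cancel (by exact_mod_cast hdeg _)
      (ENNReal.natCast_ne_top _), mul_one]
  rw [hsum] at hle
  have h3 : P (E ∩ {ω | X (n + 1) ω = y}) + P E ≤ 0 + P E := by rwa [zero_add]
  exact nonpos_iff_eq_zero.1 ((ENNReal.add_le_add_iff_right (measure_ne_top P E)).1 h3)

lemma measure_path_succ (hX : IsSimpleRandomWalk G o P X) {d : ℕ} (hd : d ≠ 0)
    (hdeg : ∀ x, G.degree x = d) (n : ℕ) (p : ℕ → V) (y : V) [DecidableRel G.Adj] :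
    P {ω | (∀ i ≤ n, X i ω = p i) ∧ X (n + 1) ω = y} =
      if G.Adj (p n) y then P {ω | ∀ i ≤ n, X i ω = p i} * (d : ℝ≥0∞)⁻¹ else 0 := by
  have hdeg' : ∀ x, G.degree x ≠ 0 := fun x => by rwa [hdeg]
  by_cases h0 : p 0 = o
  · by_cases hp : ∀ i < n, G.Adj (p i) (p (i + 1))
    · split_ifs with hy
      · rw [hX.measure_path_adj n p h0 hp hy, hdeg]
      · exact hX.measure_path_not_adj hdeg' n p h0 hp hy
    · have hex : ∃ i, i < n ∧ ¬ G.Adj (p i) (p (i + 1)) := by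
        push Not at hp
        exact hp
      classical
      obtain ⟨hi, hna⟩ := Nat.find_spec hex
      have hmin : ∀ j < Nat.find hex, G.Adj (p j) (p (j + 1)) := fun j hj => by
        by_contra h
        exact Nat.find_min hex hj ⟨by omega, h⟩
      have hz := hX.measure_path_not_adj hdeg' _ p h0 hmin hna
      have hE : P {ω | ∀ i ≤ n, X i ω = p i} = 0 :=
        measure_mono_null (fun ω hω => show _ ∧ _ from
          ⟨fun j hj => hω j (by omega), hω _ (by omega)⟩) hz
      have hE' : P {ω | (∀ i ≤ n, X i ω = p i) ∧ X (n + 1) ω = y} = 0 :=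
        measure_mono_null (fun ω hω => hω.1) hE
      simp [hE, hE']
  · have hz : P {ω | ¬ X 0 ω = o} = 0 := hX.start
    have hE : P {ω | ∀ i ≤ n, X i ω = p i} = 0 :=
      measure_mono_null (fun ω hω => show ¬ _ from fun h =>
        h0 ((hω 0 (Nat.zero_le _)).symm.trans h)) hz
    have hE' : P {ω | (∀ i ≤ n, X i ω = p i) ∧ X (n + 1) ω = y} = 0 :=
      measure_mono_null (fun ω hω => hω.1) hE
    simp [hE, hE']

/-- The Markov property. -/
lemma markov [Countable V] (hX : IsSimpleRandomWalk G o P X) {d : ℕ} (hd : d ≠ 0)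
    (hdeg : ∀ x, G.degree x = d) {n : ℕ} {φ : (ℕ → V) → Prop} (hφ : DependsUpTo n φ) (x y : V)
    [DecidableRel G.Adj] :
    P {ω | ((φ fun i => X i ω) ∧ X n ω = x) ∧ X (n + 1) ω = y} =
      if G.Adj x y then P {ω | (φ fun i => X i ω) ∧ X n ω = x} * (d : ℝ≥0∞)⁻¹ else 0 := by
  let ψ : (ℕ → V) → Prop := fun p => φ p ∧ p n = x
  have hψ : DependsUpTo n ψ := fun p q h hp => ⟨hφ p q h hp.1, (h n le_rfl) ▸ hp.2⟩
  let ext : (Fin (n + 1) → V) → ℕ → V := fun q i => q (Fin.ofNat (n + 1) i)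
  let Q := {q : Fin (n + 1) → V // ψ (ext q)}
  have hdecomp : ∀ A : Set Ω, {ω | ψ fun i => X i ω} ∩ A =
      ⋃ q : Q, {ω | ∀ i ≤ n, X i ω = ext q.1 i} ∩ A := by
    intro A
    ext ω
    simp only [Set.mem_iUnion, Set.mem_inter_iff, Set.mem_ofPred_eq]
    constructor
    · rintro ⟨h, hA⟩
      have he : ∀ i ≤ n, X i ω = ext (fun i => X i ω) i := fun i hi => by
        simp [ext, Nat.mod_eq_of_lt (Nat.lt_succ_of_le hi)]
      exact ⟨⟨fun i => X i ω, hψ _ _ he h⟩, he, hA⟩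
    · rintro ⟨q, h, hA⟩
      exact ⟨hψ _ _ (fun i hi => (h i hi).symm) q.2, hA⟩
  have hmeas : ∀ A : Set Ω, MeasurableSet A → P ({ω | ψ fun i => X i ω} ∩ A) =
      ∑' q : Q, P ({ω | ∀ i ≤ n, X i ω = ext q.1 i} ∩ A) := by
    intro A hA
    rw [hdecomp A, measure_iUnion]
    · intro q q' hne
      refine Set.disjoint_left.2 fun ω h h' => hne (Subtype.ext (funext fun i => ?_))
      have h1 := h.1 i (Nat.lt_succ_iff.1 i.2)
      have h2 := h'.1 i (Nat.lt_succ_iff.1 i.2)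
      simpa [ext] using h1.symm.trans h2
    · exact fun q => (hX.measurableSet_path n _).inter hA
  have h1 := hmeas {ω | X (n + 1) ω = y} (hX.measurable _ _)
  have h2 := hmeas Set.univ MeasurableSet.univ
  simp only [Set.inter_univ] at h2
  refine Eq.trans h1 ?_
  have h3 : ∀ q : Q, P ({ω | ∀ i ≤ n, X i ω = ext q.1 i} ∩ {ω | X (n + 1) ω = y}) =
      if G.Adj x y then P {ω | ∀ i ≤ n, X i ω = ext q.1 i} * (d : ℝ≥0∞)⁻¹ else 0 := by
    intro q
    have := hX.measure_path_succ hd hdeg n (ext q.1) y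
    have hx : ext q.1 n = x := q.2.2
    simp only [hx] at this
    exact this
  rw [tsum_congr h3]
  split_ifs
  · rw [ENNReal.tsum_mul_right, ← h2]
  · simp

/-- The last step is decomposed according to the previous position. On a regular graph the
transition probabilities are symmetric, so this forward equation has the same form as the backward
equation for hitting probabilities. -/
lemma markov_sum [Countable V] (hX : IsSimpleRandomWalk G o P X) {d : ℕ} (hd : d ≠ 0)
    (hdeg : ∀ x, G.degree x = d) {n : ℕ} {φ : (ℕ → V) → Prop} (hφ : DependsUpTo n φ) (y : V) :
    P.real {ω | (φ fun i => X i ω) ∧ X (n + 1) ω = y} =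
      (d : ℝ)⁻¹ * ∑ x ∈ G.neighborFinset y, P.real {ω | (φ fun i => X i ω) ∧ X n ω = x} := by
  classical
  have hdec : {ω | (φ fun i => X i ω) ∧ X (n + 1) ω = y} =
      ⋃ x, {ω | ((φ fun i => X i ω) ∧ X n ω = x) ∧ X (n + 1) ω = y} := by
    ext ω
    simp
  have hmx : ∀ x, MeasurableSet {ω | ((φ fun i => X i ω) ∧ X n ω = x) ∧ X (n + 1) ω = y} :=
    fun x => ((hX.measurableSet_of_dependsUpTo hφ).inter (hX.measurable n x)).inter
      (hX.measurable (n + 1) y)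
  have hP : P {ω | (φ fun i => X i ω) ∧ X (n + 1) ω = y} =
      ∑ x ∈ G.neighborFinset y, P {ω | (φ fun i => X i ω) ∧ X n ω = x} * (d : ℝ≥0∞)⁻¹ := by
    rw [hdec, measure_iUnion _ hmx]
    · simp_rw [hX.markov hd hdeg hφ]
      rw [tsum_eq_sum (s := G.neighborFinset y)]
      · refine Finset.sum_congr rfl fun x hx => if_pos ?_
        simpa [G.adj_comm] using hx
      · intro x hx
        refine if_neg fun h => hx ?_
        simpa [G.adj_comm] using h
    · intro x x' hne
      exact Set.disjoint_left.2 fun ω h h' => hne (h.1.2.symm.trans h'.1.2)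
  rw [measureReal_def, hP, ENNReal.toReal_sum fun x _ => ENNReal.mul_ne_top (measure_ne_top _ _)
    (by simpa using hd), Finset.mul_sum]
  refine Finset.sum_congr rfl fun x _ => ?_
  rw [ENNReal.toReal_mul, ENNReal.toReal_inv, ENNReal.toReal_natCast, mul_comm]
  rfl

lemma ae_adj [Countable V] (hX : IsSimpleRandomWalk G o P X) {d : ℕ} (hd : d ≠ 0)
    (hdeg : ∀ x, G.degree x = d) : ∀ᵐ ω ∂P, ∀ n, G.Adj (X n ω) (X (n + 1) ω) := by
  classical
  rw [ae_all_iff]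
  intro n
  have hz : ∀ x y, ¬ G.Adj x y → ∀ᵐ ω ∂P, ¬ (X n ω = x ∧ X (n + 1) ω = y) := by
    intro x y hxy
    have := hX.markov hd hdeg (n := n) (φ := fun _ => True) (fun _ _ _ _ => trivial) x y
    simp only [true_and, if_neg hxy] at this
    rw [ae_iff]
    simpa using this
  have : ∀ᵐ ω ∂P, ∀ x y, ¬ G.Adj x y → ¬ (X n ω = x ∧ X (n + 1) ω = y) := by
    simp_rw [ae_all_iff]
    exact hz
  filter_upwards [this] with ω h
  by_contra hna
  exact h _ _ hna ⟨rfl, rfl⟩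

lemma killed_zero [DecidableEq V] (hX : IsSimpleRandomWalk G o P X) (D : Set V) (y : V) :
    killed P X D 0 y = if y = o then 1 else 0 := by
  split_ifs with h
  · subst h
    have : ∀ᵐ ω ∂P, ω ∈ {ω | (∀ i, 1 ≤ i → i ≤ 0 → X i ω ∈ D) ∧ X 0 ω = y} := by
      filter_upwards [hX.start] with ω hω
      exact ⟨fun i h1 h2 => by omega, hω⟩
    have h1 : P {ω | (∀ i, 1 ≤ i → i ≤ 0 → X i ω ∈ D) ∧ X 0 ω = y} = 1 :=
      (measure_congr (eventuallyEq_univ.2 this)).trans measure_univ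
    rw [killed, measureReal_def, h1, ENNReal.toReal_one]
  · rw [killed, measureReal_eq_zero_iff]
    refine measure_mono_null (fun ω hω => show ¬ _ from fun h' => h ?_) hX.start
    exact hω.2.symm.trans h'

lemma killed_succ_aux [Countable V] (hX : IsSimpleRandomWalk G o P X) {d : ℕ} (hd : d ≠ 0)
    (hdeg : ∀ x, G.degree x = d) (D : Set V) (j : ℕ) (y : V) :
    P.real {ω | (∀ i, 1 ≤ i → i ≤ j → X i ω ∈ D) ∧ X (j + 1) ω = y} =
      (d : ℝ)⁻¹ * ∑ x ∈ G.neighborFinset y, killed P X D j x :=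
  hX.markov_sum hd hdeg (dependsUpTo_forall_mem D j) y

lemma killed_succ [Countable V] (hX : IsSimpleRandomWalk G o P X) {d : ℕ} (hd : d ≠ 0)
    (hdeg : ∀ x, G.degree x = d) (D : Set V) (j : ℕ) {y : V} (hy : y ∈ D) :
    killed P X D (j + 1) y = (d : ℝ)⁻¹ * ∑ x ∈ G.neighborFinset y, killed P X D j x := by
  rw [← hX.killed_succ_aux hd hdeg, killed]
  congr 1
  ext ω
  simp only [Set.mem_ofPred_eq]
  refine and_congr_left fun hω => ⟨fun h i h1 h2 => h i h1 (by omega), fun h i h1 h2 => ?_⟩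
  rcases Nat.lt_or_ge j i with hi | hi
  · obtain rfl : i = j + 1 := by omega
    rwa [hω]
  · exact h i h1 hi

lemma killed_mono {D D' : Set V} (h : D ⊆ D') (j : ℕ) (y : V) :
    killed P X D j y ≤ killed P X D' j y :=
  measureReal_mono fun _ hω => ⟨fun i h1 h2 => h (hω.1 i h1 h2), hω.2⟩

lemma green_mono {D D' : Set V} (h : D ⊆ D') {n n' : ℕ} (hn : n ≤ n') (y : V) :
    green P X D n y ≤ green P X D' n' y :=
  (Finset.sum_le_sum fun j _ => killed_mono h j y).trans
    (Finset.sum_le_sum_of_subset_of_nonneg (Finset.range_mono (by omega))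
      fun _ _ _ => killed_nonneg _ _ _)

lemma green_self (hX : IsSimpleRandomWalk G o P X) {D : Set V} (ho : o ∉ D) (n : ℕ) :
    green P X D n o = 1 := by
  classical
  rw [green, Finset.sum_range_succ', hX.killed_zero, if_pos rfl,
    Finset.sum_eq_zero fun j _ => killed_succ_of_notMem D j ho, zero_add]

lemma green_of_notMem (hX : IsSimpleRandomWalk G o P X) {D : Set V} {y : V} (hy : y ∉ D)
    (hyo : y ≠ o) (n : ℕ) : green P X D n y = 0 := by
  classical
  rw [green, Finset.sum_range_succ', hX.killed_zero, if_neg hyo,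
    Finset.sum_eq_zero fun j _ => killed_succ_of_notMem D j hy, zero_add]

lemma green_zero (hX : IsSimpleRandomWalk G o P X) (D : Set V) {y : V} (hyo : y ≠ o) :
    green P X D 0 y = 0 := by
  classical
  simp [green, hX.killed_zero, hyo]

/-- Reversibility in disguise: with the boundary values above (one at `o`, zero elsewhere outside
`D`) this is the recursion for the probability of hitting `o` from `y` within a given number of
steps without first leaving `D`. No walk started at `y` is needed. -/
lemma green_succ [Countable V] (hX : IsSimpleRandomWalk G o P X) {d : ℕ} (hd : d ≠ 0)
    (hdeg : ∀ x, G.degree x = d) {D : Set V} {y : V} (hy : y ∈ D) (hyo : y ≠ o) (n : ℕ) :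
    green P X D (n + 1) y = (d : ℝ)⁻¹ * ∑ x ∈ G.neighborFinset y, green P X D n x := by
  classical
  rw [green, Finset.sum_range_succ', hX.killed_zero, if_neg hyo, add_zero,
    Finset.sum_congr rfl fun j _ => hX.killed_succ hd hdeg D j hy, ← Finset.mul_sum,
    Finset.sum_comm]
  rfl

/-- At each time the walk is at one vertex at most, so the sum over vertices is at most the
probability of not being killed yet; time `0` contributes nothing because `o ∉ F`. -/
lemma sum_green_le [Countable V] (hX : IsSimpleRandomWalk G o P X) (D : Set V) (F : Finset V) (ho : o ∉ F)
    (n : ℕ) : ∑ z ∈ F, green P X D n z ≤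
      ∑ j ∈ Finset.range n, P.real {ω | ∀ i, 1 ≤ i → i ≤ j + 1 → X i ω ∈ D} := by
  classical
  simp only [green]
  rw [Finset.sum_comm, Finset.sum_range_succ']
  have h0 : ∑ z ∈ F, killed P X D 0 z = 0 := Finset.sum_eq_zero fun z hz => by
    rw [hX.killed_zero, if_neg]
    rintro rfl
    exact ho hz
  rw [h0, add_zero]
  refine Finset.sum_le_sum fun j _ => ?_
  have hm : ∀ z ∈ F, MeasurableSet {ω | (∀ i, 1 ≤ i → i ≤ j + 1 → X i ω ∈ D) ∧ X (j + 1) ω = z} := by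
    exact fun z _ => (hX.measurableSet_of_dependsUpTo (dependsUpTo_forall_mem D (j + 1))).inter
      (hX.measurable (j + 1) z)
  simp only [killed]
  rw [← measureReal_biUnion_finset _ hm]
  · refine measureReal_mono (Set.iUnion₂_subset fun z _ ω hω => hω.1)
  · intro z _ z' _ hne
    exact Set.disjoint_left.2 fun ω h h' => hne (h.2.symm.trans h'.2)

end IsSimpleRandomWalk

/-! ### Escape from the origin and speed of the walk -/

namespace IsSimpleRandomWalk

variable {V : Type*} {G : SimpleGraph V} [G.LocallyFinite] {o : V} {Ω : Type*} [MeasurableSpace Ω]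
  {P : Measure Ω} {X : ℕ → Ω → V}

lemma measure_eq_tsum [Countable V] (hX : IsSimpleRandomWalk G o P X) {E : Set Ω}
    (hE : MeasurableSet E) (n : ℕ) : P E = ∑' y, P (E ∩ {ω | X n ω = y}) := by
  rw [← measure_iUnion]
  · congr 1
    ext ω
    simp
  · intro x x' hne
    exact Set.disjoint_left.2 fun ω h h' => hne (h.2.symm.trans h'.2)
  · exact fun y => hE.inter (hX.measurable n y)

lemma measurable_lowerSpeed [Countable V] (hX : IsSimpleRandomWalk G o P X) :
    Measurable fun ω => lowerSpeed G o (fun t => X t ω) := by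
  refine Measurable.liminf fun t => ?_
  let _ : MeasurableSpace V := ⊤
  have hXt : Measurable (X t) := measurable_to_countable' fun v => hX.measurable t v
  exact (measurable_of_countable fun v : V => (G.dist o v : ℝ) / t).comp hXt

variable [IsProbabilityMeasure P]

lemma ae_dist_le [Countable V] (hX : IsSimpleRandomWalk G o P X) (hG : G.Connected) {d : ℕ}
    (hd : d ≠ 0) (hdeg : ∀ x, G.degree x = d) : ∀ᵐ ω ∂P, ∀ n, G.dist o (X n ω) ≤ n := by
  filter_upwards [hX.start, hX.ae_adj hd hdeg] with ω h0 hadj n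
  induction n with
  | zero => simp [h0]
  | succ n ih => exact (hG.dist_le_succ o (hadj n)).trans (by omega)

/-- The walk cannot reach distance `k` without visiting the sphere of radius `k`. -/
lemma le_sum_sphere [Countable V] (hX : IsSimpleRandomWalk G o P X) (hG : G.Connected) {d : ℕ}
    (hd : d ≠ 0) (hdeg : ∀ x, G.degree x = d) {k : ℕ} (hk : 1 ≤ k) (K : ℕ) (S : Finset V)
    (hS : ∀ z, G.dist o z = k → z ∈ S) :
    P.real {ω | (∀ t ≥ 1, X t ω ≠ o) ∧ k ≤ G.dist o (X (K + 1) ω)} ≤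
      ∑ z ∈ S, (d : ℝ)⁻¹ * ∑ y ∈ G.neighborFinset z, green P X {y | y ≠ o ∧ G.dist o y < k} K y := by
  classical
  set D : Set V := {y | y ≠ o ∧ G.dist o y < k} with hD
  set E : ℕ → V → Set Ω := fun j z => {ω | (∀ i, 1 ≤ i → i ≤ j → X i ω ∈ D) ∧ X (j + 1) ω = z}
  have hsub : {ω | (∀ t ≥ 1, X t ω ≠ o) ∧ k ≤ G.dist o (X (K + 1) ω)} ≤ᵐ[P]
      ⋃ j ∈ Finset.range (K + 1), ⋃ z ∈ S, E j z := by
    filter_upwards [hX.start, hX.ae_adj hd hdeg] with ω h0 hadj hω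
    obtain ⟨hret, hfar⟩ := hω
    -- The first time at distance at least `k` is positive, and the distance is then exactly `k`
    -- because steps change it by at most one; before that time the walk stays in `D`.
    have hex : ∃ i, k ≤ G.dist o (X i ω) := ⟨K + 1, hfar⟩
    obtain ⟨j, hj⟩ : ∃ j, Nat.find hex = j + 1 := by
      refine Nat.exists_eq_succ_of_ne_zero fun h => ?_
      have := Nat.find_spec hex
      rw [h, h0, SimpleGraph.dist_self] at this
      omega
    have hspec := Nat.find_spec hex
    have hmin : ∀ i ≤ j, G.dist o (X i ω) < k := fun i hi =>
      not_le.1 (Nat.find_min hex (by omega))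
    have hjK : j < K + 1 := by
      have := Nat.find_min' hex hfar
      omega
    rw [hj] at hspec
    have heq : G.dist o (X (j + 1) ω) = k := by
      have := hG.dist_le_succ o (hadj j)
      have := hmin j le_rfl
      omega
    show ω ∈ ⋃ j ∈ Finset.range (K + 1), ⋃ z ∈ S, E j z
    simp only [Set.mem_iUnion]
    exact ⟨j, Finset.mem_range.2 hjK, _, hS _ heq,
      ⟨fun i h1 h2 => ⟨hret i h1, hmin i h2⟩, rfl⟩⟩
  calc P.real {ω | (∀ t ≥ 1, X t ω ≠ o) ∧ k ≤ G.dist o (X (K + 1) ω)}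
      ≤ P.real (⋃ j ∈ Finset.range (K + 1), ⋃ z ∈ S, E j z) :=
        ENNReal.toReal_mono (measure_ne_top _ _) (measure_mono_ae hsub)
    _ ≤ ∑ j ∈ Finset.range (K + 1), ∑ z ∈ S, P.real (E j z) :=
        (measureReal_biUnion_finset_le _ _).trans
          (Finset.sum_le_sum fun j _ => measureReal_biUnion_finset_le _ _)
    _ = _ := by
        simp only [E, hX.killed_succ_aux hd hdeg, green]
        rw [Finset.sum_comm]
        refine Finset.sum_congr rfl fun z _ => ?_
        rw [← Finset.mul_sum, Finset.sum_comm]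

/-- The probability of no return up to time `n`. -/
noncomputable def noReturn (P : Measure Ω) (X : ℕ → Ω → V) (o : V) (n : ℕ) : ℝ :=
  P.real {ω | ∀ i, 1 ≤ i → i ≤ n → X i ω ∈ {y | y ≠ o}}

lemma tendsto_noReturn [Countable V] (hX : IsSimpleRandomWalk G o P X) :
    Tendsto (noReturn P X o) atTop (nhds (P.real {ω | ∀ t ≥ 1, X t ω ≠ o})) := by
  have hanti : Antitone fun n => {ω | ∀ i, 1 ≤ i → i ≤ n → X i ω ∈ {y | y ≠ o}} :=
    fun n m hnm ω hω i h1 h2 => hω i h1 (h2.trans hnm)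
  have := tendsto_measure_iInter_atTop (μ := P)
    (fun n => (hX.measurableSet_of_dependsUpTo
      (dependsUpTo_forall_mem {y | y ≠ o} n)).nullMeasurableSet) hanti ⟨0, measure_ne_top _ _⟩
  have heq : (⋂ n, {ω | ∀ i, 1 ≤ i → i ≤ n → X i ω ∈ {y | y ≠ o}}) =
      {ω | ∀ t ≥ 1, X t ω ≠ o} := by
    ext ω
    simp only [Set.mem_iInter, Set.mem_ofPred_eq]
    exact ⟨fun h t ht => h t t ht le_rfl, fun h n i h1 _ => h i h1⟩
  rw [heq] at this
  exact (ENNReal.tendsto_toReal (measure_ne_top _ _)).comp this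

/-- The walk restarts at each visit to `o`. The proof compares the one-step recursions of both
sides, which avoids shifting trajectories. -/
lemma measure_visit_no_return [Countable V] (hX : IsSimpleRandomWalk G o P X) {d : ℕ}
    (hd : d ≠ 0) (hdeg : ∀ x, G.degree x = d) (t n : ℕ) (y : V) :
    P.real {ω | (X t ω = o ∧ ∀ i, t < i → i ≤ t + n → X i ω ≠ o) ∧ X (t + n) ω = y} =
      P.real {ω | X t ω = o} * killed P X {y | y ≠ o} n y := by
  classical
  induction n generalizing y with
  | zero =>
    rw [hX.killed_zero]
    split_ifs with hy
    · subst hy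
      rw [mul_one]
      congr 1
      ext ω
      simp only [add_zero, Set.mem_ofPred_eq]
      exact ⟨fun h => h.2, fun h => ⟨⟨h, fun i h1 h2 => by omega⟩, h⟩⟩
    · rw [mul_zero]
      convert measureReal_empty
      ext ω
      simp only [add_zero, Set.mem_ofPred_eq, Set.mem_empty_iff_false, iff_false]
      rintro ⟨⟨h, -⟩, h'⟩
      exact hy (h'.symm.trans h)
  | succ n ih =>
    by_cases hy : y = o
    · rw [killed_succ_of_notMem _ _ (by simpa using hy), mul_zero]
      convert measureReal_empty
      ext ω
      simp only [Set.mem_ofPred_eq, Set.mem_empty_iff_false, iff_false]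
      rintro ⟨⟨-, h⟩, h'⟩
      exact h (t + (n + 1)) (by omega) le_rfl (h'.trans hy)
    · rw [hX.killed_succ hd hdeg _ _ (by simpa using hy), mul_left_comm, Finset.mul_sum]
      simp_rw [← ih]
      rw [← hX.markov_sum hd hdeg (n := t + n)
        (φ := fun p => p t = o ∧ ∀ i, t < i → i ≤ t + n → p i ≠ o)
        (fun p q h hp => ⟨h t (by omega) ▸ hp.1, fun i h1 h2 => h i h2 ▸ hp.2 i h1 h2⟩)]
      congr 1
      ext ω
      simp only [Set.mem_ofPred_eq]
      refine and_congr_left fun hω => and_congr_right fun _ =>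
        ⟨fun h i h1 h2 => h i h1 (by omega), fun h i h1 h2 => ?_⟩
      rcases Nat.lt_or_ge (t + n) i with hi | hi
      · obtain rfl : i = t + (n + 1) := by omega
        rwa [hω]
      · exact h i h1 hi

lemma visit_no_return_le [Countable V] (hX : IsSimpleRandomWalk G o P X) {d : ℕ}
    (hd : d ≠ 0) (hdeg : ∀ x, G.degree x = d) (t n : ℕ) :
    P.real {ω | X t ω = o ∧ ∀ i, t < i → X i ω ≠ o} ≤ noReturn P X o n := by
  have hm : MeasurableSet {ω | X t ω = o ∧ ∀ i, t < i → i ≤ t + n → X i ω ≠ o} :=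
    hX.measurableSet_of_dependsUpTo (n := t + n)
      (φ := fun p => p t = o ∧ ∀ i, t < i → i ≤ t + n → p i ≠ o)
      (fun p q h hp => ⟨h t (by omega) ▸ hp.1, fun i h1 h2 => h i h2 ▸ hp.2 i h1 h2⟩)
  have hm' : MeasurableSet {ω | ∀ i, 1 ≤ i → i ≤ n → X i ω ∈ {y | y ≠ o}} :=
    hX.measurableSet_of_dependsUpTo (dependsUpTo_forall_mem {y | y ≠ o} n)
  refine (measureReal_mono (s₂ := {ω | X t ω = o ∧ ∀ i, t < i → i ≤ t + n → X i ω ≠ o})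
    fun ω hω => ⟨hω.1, fun i h1 _ => hω.2 i h1⟩).trans ?_
  refine ENNReal.toReal_mono (measure_ne_top _ _) ?_
  rw [hX.measure_eq_tsum hm (t + n), hX.measure_eq_tsum hm' n]
  refine ENNReal.tsum_le_tsum fun y => ?_
  have h := hX.measure_visit_no_return hd hdeg t n y
  refine (ENNReal.toReal_le_toReal (measure_ne_top _ _) (measure_ne_top _ _)).1 ?_
  refine le_trans (le_of_eq h) ?_
  refine le_trans (mul_le_of_le_one_left (killed_nonneg _ _ _) measureReal_le_one) (le_of_eq rfl)

/-- Positive speed forces a last visit to `o`. If the escape probability were zero, then for each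
`t` a last visit at time `t` would have probability zero. -/
lemma noReturn_pos [Countable V] (hX : IsSimpleRandomWalk G o P X) {d : ℕ} (hd : d ≠ 0)
    (hdeg : ∀ x, G.degree x = d) (hspeed : ∀ᵐ ω ∂P, 0 < lowerSpeed G o (fun t => X t ω)) :
    0 < P.real {ω | ∀ t ≥ 1, X t ω ≠ o} := by
  refine measureReal_nonneg.lt_of_ne fun hzero => ?_
  have hnull : ∀ t, P {ω | X t ω = o ∧ ∀ i, t < i → X i ω ≠ o} = 0 := by
    intro t
    rw [← measureReal_eq_zero_iff]
    refine le_antisymm ?_ measureReal_nonneg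
    rw [hzero]
    exact ge_of_tendsto' hX.tendsto_noReturn fun n => hX.visit_no_return_le hd hdeg t n
  have hae : ∀ᵐ ω ∂P, ∀ t, ¬ (X t ω = o ∧ ∀ i, t < i → X i ω ≠ o) := by
    rw [ae_all_iff]
    exact fun t => by simpa [ae_iff] using hnull t
  have hfalse : ∀ᵐ ω ∂P, False := by
    filter_upwards [hae, hspeed, hX.start] with ω h hs h0
    have hev : ∀ᶠ t in atTop, 0 < (G.dist o (X t ω) : ℝ) / t := by
      refine eventually_lt_of_lt_liminf hs ?_
      exact isBoundedUnder_of ⟨0, fun t => by positivity⟩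
    obtain ⟨N, hN⟩ := eventually_atTop.1 hev
    have hbound : ∀ t, X t ω = o → t ≤ N := fun t ht => by
      by_contra hlt
      have := hN t (by omega)
      simp [ht] at this
    classical
    have hex : ∃ t, X t ω = o := ⟨0, h0⟩
    have h1 := Nat.findGreatest_spec (P := fun t => X t ω = o) (Nat.zero_le N) h0
    refine h _ ⟨h1, fun i hi hio => ?_⟩
    exact absurd (Nat.le_findGreatest (P := fun t => X t ω = o) (hbound i hio) hio) (by omega)
  exact (IsProbabilityMeasure.ne_zero P) (by simpa [Filter.eventually_false_iff_eq_bot] using hfalse)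

/-- The walk may step to a neighbour and straight back. This is the source of the strict inequality
in the quantitative bound. -/
lemma noReturn_lt_one [Infinite V] (hX : IsSimpleRandomWalk G o P X) (hG : G.Connected) :
    P.real {ω | ∀ t ≥ 1, X t ω ≠ o} < 1 := by
  obtain ⟨y, hy⟩ := hG.neighborFinset_nonempty o
  have hoy : G.Adj o y := by simpa using hy
  let p : ℕ → V := fun i => if i = 1 then y else o
  have h := hX.path 2 p (by simp [p]) (fun i hi => by
    interval_cases i
    · simpa [p] using hoy
    · simpa [p] using hoy.symm)
  have hpos : 0 < P {ω | ∀ i ≤ 2, X i ω = p i} := by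
    rw [h, pos_iff_ne_zero, Finset.prod_ne_zero_iff]
    exact fun i _ => ENNReal.inv_ne_zero.2 (ENNReal.natCast_ne_top _)
  have hm := hX.measurableSet_path 2 p
  have hle : P.real {ω | ∀ t ≥ 1, X t ω ≠ o} ≤ P.real {ω | ∀ i ≤ 2, X i ω = p i}ᶜ :=
    measureReal_mono fun ω hω h2 => hω 2 (by norm_num) ((h2 2 le_rfl).trans (by simp [p]))
  rw [probReal_compl_eq_one_sub hm] at hle
  have : 0 < P.real {ω | ∀ i ≤ 2, X i ω = p i} := ENNReal.toReal_pos hpos.ne' (measure_ne_top _ _)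
  linarith

lemma lowerSpeed_le_one [Countable V] (hX : IsSimpleRandomWalk G o P X) (hG : G.Connected) {d : ℕ}
    (hd : d ≠ 0) (hdeg : ∀ x, G.degree x = d) :
    ∀ᵐ ω ∂P, lowerSpeed G o (fun t => X t ω) ≤ 1 := by
  filter_upwards [hX.ae_dist_le hG hd hdeg] with ω h
  refine liminf_le_of_frequently_le (Eventually.frequently (Eventually.of_forall fun t => ?_))
    (isBoundedUnder_of ⟨0, fun t => by positivity⟩)
  exact div_le_one_of_le₀ (by exact_mod_cast h t) (by positivity)

/-- If the distance at a time `K L ≥ c L` is below `L` for infinitely many `L`, the lower speed is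
at most `c⁻¹`; continuity from above then bounds the tail unions of these events. -/
lemma eventually_dist_lt_le [Countable V] (hX : IsSimpleRandomWalk G o P X) {c b : ℝ} (hc : 0 < c)
    (hb : P.real {ω | lowerSpeed G o (fun t => X t ω) ≤ c⁻¹} < b) {K : ℕ → ℕ}
    (hK : ∀ L, c * L ≤ K L) :
    ∀ᶠ L in atTop, P.real {ω | G.dist o (X (K L) ω) < L} < b := by
  let C : ℕ → Set Ω := fun n => ⋃ L ≥ n, {ω | G.dist o (X (K L) ω) < L}
  have hm : ∀ L, MeasurableSet {ω | G.dist o (X (K L) ω) < L} := fun L =>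
    hX.measurableSet_of_dependsUpTo (n := K L) (φ := fun p => G.dist o (p (K L)) < L)
      fun p q h (hp : _ < _) => show _ < _ by rwa [← h (K L) le_rfl]
  have hanti : Antitone C := fun n m hnm =>
    Set.biUnion_subset_biUnion_left fun L hL => le_trans hnm hL
  have ht := tendsto_measure_iInter_atTop (μ := P) (fun n => (MeasurableSet.iUnion fun L =>
    MeasurableSet.iUnion fun _ => hm L : MeasurableSet (C n)).nullMeasurableSet) hanti
    ⟨0, measure_ne_top _ _⟩
  have hsub : ⋂ n, C n ⊆ {ω | lowerSpeed G o (fun t => X t ω) ≤ c⁻¹} := by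
    intro ω hω
    by_contra hlt
    have hlt : c⁻¹ < lowerSpeed G o (fun t => X t ω) := not_le.1 hlt
    have hev : ∀ᶠ t in atTop, c⁻¹ < (G.dist o (X t ω) : ℝ) / t :=
      eventually_lt_of_lt_liminf hlt (isBoundedUnder_of ⟨0, fun t => by positivity⟩)
    obtain ⟨N, hN⟩ := eventually_atTop.1 hev
    obtain ⟨M, hM⟩ := exists_nat_ge (N / c : ℝ)
    have hmem := Set.mem_iInter.1 hω (M + 1)
    simp only [C, Set.mem_iUnion, exists_prop] at hmem
    obtain ⟨L, hL, hd⟩ := hmem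
    have hd : G.dist o (X (K L) ω) < L := hd
    have hLM : (M : ℝ) + 1 ≤ L := by exact_mod_cast hL
    have hNc : (N : ℝ) ≤ c * L := by
      rw [div_le_iff₀ hc] at hM
      nlinarith
    have hKL := hK L
    have hNK : N ≤ K L := by exact_mod_cast hNc.trans hKL
    have h1 := hN (K L) hNK
    have hLpos : (0 : ℝ) < L := by linarith [(Nat.cast_nonneg M : (0 : ℝ) ≤ M)]
    have hKpos : (0 : ℝ) < K L := lt_of_lt_of_le (by positivity) hKL
    rw [lt_div_iff₀ hKpos, inv_mul_lt_iff₀ hc] at h1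
    have hd' : (G.dist o (X (K L) ω) : ℝ) < L := by exact_mod_cast hd
    nlinarith
  have ht' := (ENNReal.tendsto_toReal (measure_ne_top _ _)).comp ht
  have hlt : (P (⋂ n, C n)).toReal < b := (measureReal_mono hsub).trans_lt hb
  filter_upwards [ht'.eventually_lt_const hlt] with L hL
  refine lt_of_le_of_lt (measureReal_mono (s₂ := C L) (fun ω hω => ?_) (measure_ne_top _ _)) hL
  exact Set.mem_biUnion (le_refl L) hω

lemma exists_lowerSpeed_le_lt [Countable V] (hX : IsSimpleRandomWalk G o P X)
    (hspeed : ∀ᵐ ω ∂P, 0 < lowerSpeed G o (fun t => X t ω)) {b : ℝ} (hb : 0 < b) :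
    ∃ c : ℝ, 0 < c ∧ P.real {ω | lowerSpeed G o (fun t => X t ω) ≤ c⁻¹} < b := by
  let C : ℕ → Set Ω := fun n => {ω | lowerSpeed G o (fun t => X t ω) ≤ ((n : ℝ) + 1)⁻¹}
  have hanti : Antitone C := by
    intro n m hnm ω hω
    have h : lowerSpeed G o (fun t => X t ω) ≤ ((m : ℝ) + 1)⁻¹ := hω
    have hnm' : (n : ℝ) ≤ m := by exact_mod_cast hnm
    exact show lowerSpeed G o (fun t => X t ω) ≤ ((n : ℝ) + 1)⁻¹ from
      h.trans (inv_anti₀ (by positivity) (by linarith))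
  have ht := tendsto_measure_iInter_atTop (μ := P) (fun n => (measurableSet_le
    hX.measurable_lowerSpeed measurable_const : MeasurableSet (C n)).nullMeasurableSet) hanti
    ⟨0, measure_ne_top _ _⟩
  have hzero : P (⋂ n, C n) = 0 := by
    refine measure_mono_null (fun ω hω => ?_) hspeed
    show ¬ (0 < lowerSpeed G o (fun t => X t ω))
    rw [not_lt]
    have hle : ∀ n : ℕ, lowerSpeed G o (fun t => X t ω) ≤ ((n : ℝ) + 1)⁻¹ := fun n =>
      Set.mem_iInter.1 hω n
    have hlim : Tendsto (fun n : ℕ => ((n : ℝ) + 1)⁻¹) atTop (nhds 0) := by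
      simpa using tendsto_one_div_add_atTop_nhds_zero_nat (𝕜 := ℝ)
    exact ge_of_tendsto' hlim hle
  have ht' := (ENNReal.tendsto_toReal (measure_ne_top _ _)).comp ht
  rw [show P (⋂ n : ℕ, {ω | lowerSpeed G o (fun t => X t ω) ≤ ((n : ℝ) + 1)⁻¹}) = 0 from hzero,
    ENNReal.toReal_zero] at ht'
  obtain ⟨n, hn⟩ := (ht'.eventually_lt_const hb).exists
  exact ⟨n + 1, by positivity, hn⟩

end IsSimpleRandomWalk

namespace ARW

variable {V : Type*}

/-! ### Sweeping a ball towards its centre -/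

/-- A stage of the sweeping procedure.
* The vertices of `todo` are still to be swept;
* the vertices of `todo` which belong to `occ` hold an active particle;
* `arrived` counts the particles that have been brought to the centre;
* `walker = some (k, n, y)` means that, in addition, an active particle at `y` is being moved; it
  was released at distance `k` from the centre and may make `n + 1` further jumps;
* `hist` lists the vertices where instructions have been used. -/
@[ext]
structure Sweep (V : Type*) where
  occ : Finset V
  arrived : ℕ
  todo : List V
  walker : Option (ℕ × ℕ × V)
  hist : List V

namespace Sweep

instance : MeasurableSpace (Sweep V) := ⊤

instance : DiscreteMeasurableSpace (Sweep V) := ⟨fun _ => trivial⟩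

instance [Countable V] : Countable (Sweep V) := by
  refine Function.Injective.countable
    (f := fun s : Sweep V => (s.occ, s.arrived, s.todo, s.walker, s.hist)) fun s t h => ?_
  simp only [Prod.mk.injEq] at h
  ext1
  exacts [h.1, h.2.1, h.2.2.1, h.2.2.2.1, h.2.2.2.2]

open Classical in
/-- The moving particle arrives at `y` with `n` jumps left: it is counted at the centre `o`, and
stops there, at distance at least `k`, at a vacant vertex, and when no jump is left. -/
noncomputable def arrive (G : SimpleGraph V) (o : V) (k n : ℕ) (y : V) (s : Sweep V) : Sweep V :=
  if y = o then { s with arrived := s.arrived + 1, walker := none }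
  else if k ≤ G.dist o y then { s with walker := none }
  else if y ∈ s.occ then
    match n with
    | 0 => { s with walker := none }
    | n + 1 => { s with walker := some (k, n, y) }
  else { s with occ := insert y s.occ, walker := none }

/-- The vertex where the next instruction is used. -/
noncomputable def site (s : Sweep V) : Option V :=
  open Classical in
  match s.walker, s.todo with
  | some (_, _, y), _ => some y
  | none, [] => none
  | none, z :: _ => if z ∈ s.occ then some z else none

open Classical in
/-- The effect of an instruction used at `s.site`. -/
noncomputable def step (G : SimpleGraph V) (o : V) (K : ℕ) (s : Sweep V) (i : Instruction V) :
    Sweep V :=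
  match s.walker, s.todo with
  | some (k, n, y), _ =>
    match i with
    | .sleep => { s with hist := y :: s.hist }
    | .jump x => arrive G o k n x { s with hist := y :: s.hist }
  | none, [] => s
  | none, z :: r =>
    if z ∈ s.occ then
      match i with
      | .sleep => { s with todo := r, hist := z :: s.hist }
      | .jump y => arrive G o (G.dist o z) K y { s with todo := r, hist := z :: s.hist }
    else { s with todo := r, occ := insert z s.occ }

open Classical in
/-- The next instruction to be used. -/
noncomputable def coord (s : Sweep V) : Option (V × ℕ) := s.site.map fun x => (x, s.hist.count x)

open Classical in
/-- The instruction of `ω` which is used next. -/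
noncomputable def instrAt (s : Sweep V) (ω : Sample V) : Instruction V :=
  match s.coord with
  | none => .sleep
  | some c => ω.instr c

open Classical in
/-- The beginning of the procedure sweeping `l`. -/
noncomputable def begin (l : List V) (ω : Sample V) : Sweep V where
  occ := l.toFinset.filter fun z => ω.init z = .active 1
  arrived := 0
  todo := l
  walker := none
  hist := []

/-- The procedure sweeping `l`, driven by `ω`. -/
noncomputable def run (G : SimpleGraph V) (o : V) (K : ℕ) (l : List V) (ω : Sample V) : ℕ → Sweep V
  | 0 => begin l ω
  | m + 1 => step G o K (run G o K l ω m) ((run G o K l ω m).instrAt ω)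

variable {G : SimpleGraph V} {o : V} {K : ℕ}

lemma hist_arrive (k n : ℕ) (y : V) (s : Sweep V) : (arrive G o k n y s).hist = s.hist := by
  unfold arrive
  split_ifs
  · rfl
  · rfl
  · split <;> rfl
  · rfl

lemma step_of_site_eq_none {s : Sweep V} (h : s.site = none) (i j : Instruction V) :
    step G o K s i = step G o K s j := by
  obtain ⟨occ, A, todo, walker, hist⟩ := s
  rcases walker with _ | ⟨k, n, y⟩
  · rcases todo with _ | ⟨z, r⟩
    · rfl
    · have hz : z ∉ occ := by
        intro hz
        simp [site, hz] at h
      simp [step, hz]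
  · simp [site] at h

lemma hist_step_of_site_eq_none {s : Sweep V} (h : s.site = none) (i : Instruction V) :
    (step G o K s i).hist = s.hist := by
  obtain ⟨occ, A, todo, walker, hist⟩ := s
  rcases walker with _ | ⟨k, n, y⟩
  · rcases todo with _ | ⟨z, r⟩
    · rfl
    · have hz : z ∉ occ := by
        intro hz
        simp [site, hz] at h
      simp [step, hz]
  · simp [site] at h

lemma hist_step_of_site_eq_some {s : Sweep V} {x : V} (h : s.site = some x) (i : Instruction V) :
    (step G o K s i).hist = x :: s.hist := by
  obtain ⟨occ, A, todo, walker, hist⟩ := s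
  rcases walker with _ | ⟨k, n, y⟩
  · rcases todo with _ | ⟨z, r⟩
    · simp [site] at h
    · by_cases hz : z ∈ occ
      · obtain rfl : z = x := by simpa [site, hz] using h
        cases i <;> simp [step, hz, hist_arrive]
      · simp [site, hz] at h
  · obtain rfl : y = x := by simpa [site] using h
    cases i <;> simp [step, hist_arrive]

/-! ### Independence of the successive instructions -/

open Classical in
lemma count_hist_step_le (s : Sweep V) (i : Instruction V) (x : V) :
    s.hist.count x ≤ (step G o K s i).hist.count x := by
  rcases h : s.site with _ | y
  · rw [hist_step_of_site_eq_none h]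
  · rw [hist_step_of_site_eq_some h]
    exact List.count_le_count_cons

open Classical in
lemma count_hist_run_mono (l : List V) (ω : Sample V) (x : V) :
    Monotone fun m => (run G o K l ω m).hist.count x :=
  monotone_nat_of_le_succ fun _ => count_hist_step_le _ _ _

/-- Using an instruction at `x` increases the count of `x` in the history for ever, so each
instruction is read at most once. -/
lemma coord_run_ne {l : List V} {ω : Sample V} {j m : ℕ} (hjm : j < m) {c : V × ℕ}
    (hj : (run G o K l ω j).coord = some c) : (run G o K l ω m).coord ≠ some c := by
  classical
  intro hm
  obtain ⟨x, hx, hxc⟩ := Option.map_eq_some_iff.1 hj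
  obtain ⟨y, hy, hyc⟩ := Option.map_eq_some_iff.1 hm
  obtain rfl : x = y := by
    have := hxc.trans hyc.symm
    exact (Prod.ext_iff.1 this).1
  have heq : (run G o K l ω j).hist.count x = (run G o K l ω m).hist.count x :=
    (Prod.ext_iff.1 (hxc.trans hyc.symm)).2
  have hlt : (run G o K l ω j).hist.count x < (run G o K l ω (j + 1)).hist.count x := by
    rw [run, hist_step_of_site_eq_some hx]
    simp
  have hle := count_hist_run_mono (G := G) (o := o) (K := K) l ω x (Nat.succ_le_of_lt hjm)
  simp only [Nat.succ_eq_add_one] at hle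
  omega

lemma instr_setInstr_self (ω : Sample V) (c : V × ℕ) (i : Instruction V) :
    (ω.setInstr c i).instr c = i := by
  simp [Sample.setInstr, Sample.instr]

lemma instr_setInstr_of_ne (ω : Sample V) {c c' : V × ℕ} (h : c' ≠ c) (i : Instruction V) :
    (ω.setInstr c i).instr c' = ω.instr c' := by
  classical
  simp [Sample.setInstr, Sample.instr, Function.update_of_ne h]

lemma setInstr_setInstr (ω : Sample V) (c : V × ℕ) (i : Instruction V) :
    (ω.setInstr c i).setInstr c (ω.instr c) = ω := by
  simp [Sample.setInstr, Sample.instr]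

lemma run_setInstr {l : List V} {ω : Sample V} {m : ℕ} {c : V × ℕ}
    (hc : ∀ j < m, (run G o K l ω j).coord ≠ some c) (i : Instruction V) :
    run G o K l (ω.setInstr c i) m = run G o K l ω m := by
  induction m with
  | zero => rfl
  | succ m ih =>
    rw [run, run, ih fun j hj => hc j (by omega)]
    congr 1
    unfold instrAt
    split
    · rfl
    · rename_i c' hc'
      refine instr_setInstr_of_ne _ (fun h => hc m (by omega) ?_) _
      rw [hc', h]

lemma run_setInstr_of_coord {l : List V} {ω : Sample V} {m : ℕ} {c : V × ℕ}
    (hc : (run G o K l ω m).coord = some c) (i : Instruction V) :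
    run G o K l (ω.setInstr c i) m = run G o K l ω m :=
  run_setInstr (fun _ hj h => coord_run_ne hj h hc) i

/-- Which instruction comes next is decided without looking at it, so the event survives refreshing
that instruction. -/
lemma coord_run_setInstr_iff {l : List V} {ω : Sample V} {m : ℕ} {c : V × ℕ} (i : Instruction V) :
    (run G o K l (ω.setInstr c i) m).coord = some c ↔ (run G o K l ω m).coord = some c := by
  refine ⟨fun h => ?_, fun h => by rwa [run_setInstr_of_coord h]⟩
  have := run_setInstr_of_coord h (ω.instr c)
  rw [setInstr_setInstr] at this
  rwa [this]

lemma measurable_comp_countable {α β γ : Type*} [MeasurableSpace α] [MeasurableSpace β]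
    [MeasurableSpace γ] [Countable β] [MeasurableSingletonClass β] {f : α → β} (hf : Measurable f)
    {F : β → α → γ} (hF : ∀ b, Measurable (F b)) : Measurable fun a => F (f a) a :=
  (measurable_from_prod_countable_left (f := fun p : α × β => F p.2 p.1) hF).comp
    (measurable_id.prodMk hf)

lemma measurable_instrAt (s : Sweep V) : Measurable fun ω => s.instrAt ω := by
  unfold instrAt
  split
  · exact measurable_const
  · exact measurable_instr _

lemma measurable_begin [Countable V] (l : List V) : Measurable (begin l : Sample V → Sweep V) := by
  classical
  let f : Finset V → Sweep V := fun S => ⟨S, 0, l, none, []⟩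
  let _ : MeasurableSpace (Finset V) := ⊤
  have hf : Measurable f := measurable_from_top
  refine hf.comp (f := fun ω : Sample V => l.toFinset.filter fun z => ω.init z = .active 1)
    (measurable_to_countable' fun T => ?_)
  have : (fun ω : Sample V => l.toFinset.filter fun z => ω.init z = .active 1) ⁻¹' {T} =
      ⋂ z : V, (fun ω : Sample V => ω.init z) ⁻¹'
        {q | (z ∈ l.toFinset ∧ q = .active 1) ↔ z ∈ T} := by
    ext ω
    simp [Finset.ext_iff]
  rw [this]
  exact MeasurableSet.iInter fun z => measurable_init z trivial

lemma measurable_run [Countable V] (l : List V) (m : ℕ) :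
    Measurable fun ω => run G o K l ω m := by
  induction m with
  | zero => exact measurable_begin l
  | succ m ih =>
    exact measurable_comp_countable (F := fun s ω => step G o K s (s.instrAt ω)) ih fun s =>
      (Measurable.of_discrete (f := step G o K s)).comp (measurable_instrAt s)

variable [G.LocallyFinite] {lam : ℝ≥0} {μ : unitInterval}

/-- The expectation of `F` after one step from `s`. -/
noncomputable def mean (G : SimpleGraph V) [G.LocallyFinite] (o : V) (K : ℕ) (lam : ℝ≥0)
    (F : Sweep V → ℝ≥0∞) (s : Sweep V) : ℝ≥0∞ :=
  match s.site with
  | none => F (step G o K s .sleep)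
  | some x => ∫⁻ i, F (step G o K s i) ∂(instructionLaw G lam x)

/-- The procedure is a Markov chain: on the event that `c` is the next coordinate, refreshing it
leaves the first `m` stages unchanged, so the step is driven by an instruction independent of them.
-/
lemma lintegral_run_succ [Countable V] (l : List V) (m : ℕ) (F : Sweep V → ℝ≥0∞) :
    ∫⁻ ω, F (run G o K l ω (m + 1)) ∂(law G lam μ) =
      ∫⁻ ω, mean G o K lam F (run G o K l ω m) ∂(law G lam μ) := by
  classical
  have hrun := measurable_run (G := G) (o := o) (K := K) l m
  have hsplit : ∀ f : Sample V → ℝ≥0∞, Measurable f → ∫⁻ ω, f ω ∂(law G lam μ) =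
      ∑' c : Option (V × ℕ), ∫⁻ ω in {ω | (run G o K l ω m).coord = c}, f ω ∂(law G lam μ) := by
    intro f hf
    rw [← lintegral_iUnion]
    · have : (⋃ c, {ω | (run G o K l ω m).coord = c}) = Set.univ := by
        ext ω
        simp
      rw [this, Measure.restrict_univ]
    · exact fun c => hrun (t := {s | s.coord = c}) trivial
    · intro c c' hne
      exact Set.disjoint_left.2 fun ω h h' => hne (h.symm.trans h')
  have hF : Measurable fun ω => F (run G o K l ω (m + 1)) :=
    Measurable.of_discrete.comp (measurable_run l (m + 1))
  have hmean : Measurable fun ω => mean G o K lam F (run G o K l ω m) :=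
    (Measurable.of_discrete (f := mean G o K lam F)).comp hrun
  rw [hsplit _ hF, hsplit _ hmean]
  refine tsum_congr fun c => ?_
  have hmc : MeasurableSet {ω | (run G o K l ω m).coord = c} :=
    hrun (t := {s | s.coord = c}) trivial
  rcases c with _ | c
  · refine setLIntegral_congr_fun hmc fun ω hω => ?_
    have hs : (run G o K l ω m).site = none := Option.map_eq_none_iff.1 hω
    simp only [mean, hs, run]
    rw [step_of_site_eq_none hs]
  · rw [← lintegral_indicator hmc, ← lintegral_indicator hmc,
      lintegral_setInstr G lam μ c (hF.indicator hmc)]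
    set E := {ω | (run G o K l ω m).coord = some c}
    refine lintegral_congr fun ω => ?_
    by_cases hω : (run G o K l ω m).coord = some c
    · have hx : (run G o K l ω m).site = some c.1 := by
        obtain ⟨x, hx, rfl⟩ := Option.map_eq_some_iff.1 hω
        exact hx
      rw [Set.indicator_of_mem (show ω ∈ E from hω)]
      simp only [mean, hx]
      refine lintegral_congr fun i => ?_
      rw [Set.indicator_of_mem (show _ ∈ E from (coord_run_setInstr_iff i).2 hω)]
      simp only [run, run_setInstr_of_coord hω, instrAt, hω, instr_setInstr_self]
    · rw [Set.indicator_of_notMem (show ω ∉ E from hω)]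
      refine (lintegral_congr fun i => ?_).trans lintegral_zero
      exact Set.indicator_of_notMem
        (show _ ∉ E from fun h => hω ((coord_run_setInstr_iff i).1 h)) _

end Sweep

end ARW

namespace ARW

variable {V : Type*}

/-! ### Invariants and legality of the sweeping procedure -/

namespace Sweep

variable {G : SimpleGraph V} {o : V} {K : ℕ} {l : List V}

/-- The vertices are swept by decreasing distance to `o`. -/
structure Ordered (G : SimpleGraph V) (o : V) (l : List V) (s : Sweep V) : Prop where
  nodup : s.todo.Nodup
  sorted : s.todo.Pairwise fun a b => G.dist o b ≤ G.dist o a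
  todo_subset : ∀ z ∈ s.todo, z ∈ l
  lower : ∀ z ∈ s.todo, ∀ x, x ≠ o → G.dist o x < G.dist o z → x ∈ s.todo
  occ_subset : ∀ z ∈ s.occ, z ∈ l

/-- The properties which hold at each stage. -/
structure Inv (G : SimpleGraph V) (o : V) (K : ℕ) (l : List V) (s : Sweep V) : Prop
    extends Ordered G o l s where
  walker_mem : ∀ k n y, s.walker = some (k, n, y) →
    y ≠ o ∧ G.dist o y < k ∧ y ∈ s.occ ∧ n + 1 ≤ K ∧ ∀ x, x ≠ o → G.dist o x < k → x ∈ s.todo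

lemma Ordered.tail {occ : Finset V} {A : ℕ} {z : V} {r : List V} {w : Option (ℕ × ℕ × V)}
    {hist : List V} (h : Ordered G o l ⟨occ, A, z :: r, w, hist⟩) (w' : Option (ℕ × ℕ × V))
    (hist' : List V) : Ordered G o l ⟨occ, A, r, w', hist'⟩ ∧
      ∀ x, x ≠ o → G.dist o x < G.dist o z → x ∈ r := by
  have hnd := List.nodup_cons.1 h.nodup
  have hs := List.pairwise_cons.1 h.sorted
  have hlow : ∀ x, x ≠ o → G.dist o x < G.dist o z → x ∈ r := by
    intro x hx hlt
    rcases List.mem_cons.1 (h.lower z (List.mem_cons_self) x hx hlt) with rfl | hr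
    · exact absurd hlt (lt_irrefl _)
    · exact hr
  exact ⟨⟨hnd.2, hs.2, fun y hy => h.todo_subset y (List.mem_cons_of_mem _ hy),
    fun y hy x hx hlt => hlow x hx (hlt.trans_le (hs.1 y hy)), h.occ_subset⟩, hlow⟩

/-- A particle that continues or settles does so at distance less than `k`, hence at a vertex still
to be swept: the moving particle always shares its vertex with one awaiting release. -/
lemma Ordered.inv_arrive {s : Sweep V} (h : Ordered G o l s) {k n : ℕ} (hn : n ≤ K)
    (hk : ∀ x, x ≠ o → G.dist o x < k → x ∈ s.todo) (y : V) :
    Inv G o K l (arrive G o k n y s) := by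
  classical
  obtain ⟨h1, h2, h3, h4, h5⟩ := h
  unfold arrive
  split_ifs with hy hky hocc
  · exact ⟨⟨h1, h2, h3, h4, h5⟩, by simp⟩
  · exact ⟨⟨h1, h2, h3, h4, h5⟩, by simp⟩
  · split
    · exact ⟨⟨h1, h2, h3, h4, h5⟩, by simp⟩
    · refine ⟨⟨h1, h2, h3, h4, h5⟩, fun k' n' y' h' => ?_⟩
      simp only [Option.some.injEq, Prod.mk.injEq] at h'
      obtain ⟨rfl, rfl, rfl⟩ := h'
      exact ⟨hy, not_le.1 hky, hocc, hn, hk⟩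
  · refine ⟨⟨h1, h2, h3, h4, ?_⟩, by simp⟩
    intro z hz
    rcases Finset.mem_insert.1 hz with rfl | hz
    · exact h3 z (hk z hy (not_le.1 hky))
    · exact h5 z hz

lemma Inv.step {s : Sweep V} (h : Inv G o K l s) (i : Instruction V) :
    Inv G o K l (step G o K s i) := by
  classical
  obtain ⟨occ, A, todo, walker, hist⟩ := s
  rcases walker with _ | ⟨k, n, y⟩
  · rcases todo with _ | ⟨z, r⟩
    · exact h
    · by_cases hz : z ∈ occ
      · cases i with
        | sleep =>
          simp only [Sweep.step, hz, if_true]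
          exact ⟨(h.tail none _).1, by simp⟩
        | jump y =>
          simp only [Sweep.step, hz, if_true]
          exact (h.tail none _).1.inv_arrive le_rfl (h.tail none []).2 y
      · simp only [Sweep.step, hz, if_false]
        obtain ⟨⟨h1, h2, h3, h4, h5⟩, -⟩ := h.tail none hist
        refine ⟨⟨h1, h2, h3, h4, fun x hx => ?_⟩, by simp⟩
        rcases Finset.mem_insert.1 hx with rfl | hx
        · exact h.todo_subset x List.mem_cons_self
        · exact h5 x hx
  · obtain ⟨⟨h1, h2, h3, h4, h5⟩, hw⟩ := h
    cases i with
    | sleep =>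
      simp only [Sweep.step]
      exact ⟨⟨h1, h2, h3, h4, h5⟩, hw⟩
    | jump x =>
      obtain ⟨-, -, -, hn, hk⟩ := hw k n y rfl
      simp only [Sweep.step]
      exact Ordered.inv_arrive (s := ⟨occ, A, todo, some (k, n, y), y :: hist⟩)
        ⟨h1, h2, h3, h4, h5⟩ (by omega) hk x

lemma inv_begin (hnd : l.Nodup) (hs : l.Pairwise fun a b => G.dist o b ≤ G.dist o a)
    (hlow : ∀ z ∈ l, ∀ x, x ≠ o → G.dist o x < G.dist o z → x ∈ l) (ω : Sample V) :
    Inv G o K l (begin l ω) := by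
  classical
  refine ⟨⟨hnd, hs, fun _ h => h, hlow, fun z hz => ?_⟩, by simp [begin]⟩
  simpa using (Finset.mem_filter.1 hz).1

lemma inv_run (hnd : l.Nodup) (hs : l.Pairwise fun a b => G.dist o b ≤ G.dist o a)
    (hlow : ∀ z ∈ l, ∀ x, x ≠ o → G.dist o x < G.dist o z → x ∈ l) (ω : Sample V) (m : ℕ) :
    Inv G o K l (run G o K l ω m) := by
  induction m with
  | zero => exact inv_begin hnd hs hlow ω
  | succ m ih => exact ih.step _

/-! ### The sweeping procedure uses legal topplings -/

/-- The particles are where the procedure believes them to be. -/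
structure Realized (o : V) (s : Sweep V) (η : V → SiteState) : Prop where
  occ : ∀ y ∈ s.todo, y ∈ s.occ → 1 ≤ (η y).numActive
  walker : ∀ k n y, s.walker = some (k, n, y) → 2 ≤ (η y).numActive
  arrived : s.arrived ≤ (η o).numActive

lemma Realized.arrive {s : Sweep V} {η η' : V → SiteState}
    (hocc : ∀ y ∈ s.todo, y ∈ s.occ → 1 ≤ (η y).numActive) (harr : s.arrived ≤ (η o).numActive)
    {k : ℕ} (hk : ∀ x, x ≠ o → G.dist o x < k → x ∈ s.todo) (n : ℕ) {y : V}
    (hle : ∀ v, (η v).numActive ≤ (η' v).numActive)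
    (hy : (η y).numActive + 1 ≤ (η' y).numActive) :
    Realized o (arrive G o k n y s) η' := by
  classical
  have hocc' : ∀ y ∈ s.todo, y ∈ s.occ → 1 ≤ (η' y).numActive := fun v h h' =>
    (hocc v h h').trans (hle v)
  have harr' := harr.trans (hle o)
  unfold Sweep.arrive
  split_ifs with hyo hky hyocc
  · subst hyo
    exact ⟨hocc', by simp, show _ + 1 ≤ _ by omega⟩
  · exact ⟨hocc', by simp, harr'⟩
  · split
    · exact ⟨hocc', by simp, harr'⟩
    · refine ⟨hocc', fun k' n' y' h' => ?_, harr'⟩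
      simp only [Option.some.injEq, Prod.mk.injEq] at h'
      obtain ⟨rfl, rfl, rfl⟩ := h'
      have := hocc y (hk y hyo (not_le.1 hky)) hyocc
      omega
  · refine ⟨fun v hv hv' => ?_, by simp, harr'⟩
    rcases Finset.mem_insert.1 hv' with rfl | hv'
    · omega
    · exact hocc' v hv hv'

open Classical in
lemma numActive_perform_jump (η : V → SiteState) (x y v : V) :
    (Function.update η x (η x).remove v).numActive ≤
      ((Instruction.jump y).perform x η v).numActive := by
  simp only [Instruction.perform]
  by_cases h : v = y
  · subst h
    simp only [Function.update_self]
    exact (Nat.le_succ _).trans (SiteState.numActive_add _)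
  · simp only [Function.update_of_ne h, le_refl]

open Classical in
lemma numActive_perform_jump_self (η : V → SiteState) (x y : V) :
    (Function.update η x (η x).remove y).numActive + 1 ≤
      ((Instruction.jump y).perform x η y).numActive := by
  simp only [Instruction.perform, Function.update_self]
  exact SiteState.numActive_add _

lemma _root_.ARW.SiteState.numActive_remove (s : SiteState) :
    s.remove.numActive = s.numActive - 1 := by
  cases s <;> rfl

lemma Realized.step (ho : o ∉ l) {s : Sweep V} (hs : Inv G o K l s) {η : V → SiteState}
    (h : Realized o s η) {x : V} (hx : s.site = some x) (i : Instruction V) :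
    1 ≤ (η x).numActive ∧ Realized o (step G o K s i) (i.perform x η) := by
  classical
  obtain ⟨occ, A, todo, walker, hist⟩ := s
  rcases walker with _ | ⟨k, n, y⟩
  · rcases todo with _ | ⟨z, r⟩
    · simp [site] at hx
    · by_cases hz : z ∈ occ
      · obtain rfl : z = x := by simpa [site, hz] using hx
        have hne : ∀ y ∈ r, y ≠ z := fun y hy hyz =>
          (List.nodup_cons.1 hs.nodup).1 (hyz ▸ hy)
        have hoz : o ≠ z := by
          rintro rfl
          exact ho (hs.todo_subset o List.mem_cons_self)
        have hocc : ∀ y ∈ r, y ∈ occ → 1 ≤ (η y).numActive := fun y hy hy' =>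
          h.occ y (List.mem_cons_of_mem _ hy) hy'
        refine ⟨h.occ z List.mem_cons_self hz, ?_⟩
        cases i with
        | sleep =>
          simp only [Sweep.step, hz, if_true, Instruction.perform]
          refine ⟨fun y hy hy' => ?_, by simp, ?_⟩
          · rw [Function.update_of_ne (hne y hy)]
            exact hocc y hy hy'
          · rw [Function.update_of_ne hoz]
            exact h.arrived
        | jump y =>
          simp only [Sweep.step, hz, if_true]
          refine Realized.arrive (η := Function.update η z (η z).remove) (fun v hv hv' => ?_) ?_
            (hs.tail none []).2 _ (numActive_perform_jump η z y) (numActive_perform_jump_self η z y)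
          · rw [Function.update_of_ne (hne v hv)]
            exact hocc v hv hv'
          · rw [Function.update_of_ne hoz]
            exact h.arrived
      · simp [site, hz] at hx
  · obtain rfl : y = x := by simpa [site] using hx
    have h2 := h.walker k n y rfl
    obtain ⟨hyo, -, -, -, hk⟩ := hs.walker_mem k n y rfl
    refine ⟨by omega, ?_⟩
    cases i with
    | sleep =>
      simp only [Sweep.step, Instruction.perform]
      -- The moving particle is not alone, so the sleep instruction is consumed without effect; only
      -- the first instruction after a release can lose a particle to sleep.
      rw [SiteState.sleep_eq_self h2, Function.update_eq_self]
      exact ⟨h.occ, h.walker, h.arrived⟩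
    | jump x =>
      simp only [Sweep.step]
      refine Realized.arrive (s := ⟨occ, A, todo, some (k, n, y), y :: hist⟩)
        (η := Function.update η y (η y).remove) (fun v hv hv' => ?_) ?_
        hk _ (numActive_perform_jump η y x) (numActive_perform_jump_self η y x)
      · by_cases hvy : v = y
        · subst hvy
          rw [Function.update_self, SiteState.numActive_remove]
          omega
        · rw [Function.update_of_ne hvy]
          exact h.occ v hv hv'
      · rw [Function.update_of_ne hyo.symm]
        exact h.arrived

/-- A vertex found vacant is crossed off and entered in `occ` although it may hold no particle. This
is harmless since `occ` makes a claim only about vertices still to be swept, and the potential needs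
it. -/
lemma Realized.step_of_site_eq_none {s : Sweep V} (hs : Inv G o K l s) {η : V → SiteState}
    (h : Realized o s η) (hx : s.site = none) (i : Instruction V) :
    Realized o (Sweep.step G o K s i) η := by
  classical
  obtain ⟨occ, A, todo, walker, hist⟩ := s
  rcases walker with _ | ⟨k, n, y⟩
  · rcases todo with _ | ⟨z, r⟩
    · exact h
    · have hz : z ∉ occ := by
        intro hz
        simp [site, hz] at hx
      simp only [Sweep.step, hz, if_false]
      refine ⟨fun y hy hy' => h.occ y (List.mem_cons_of_mem _ hy) ?_, by simp, h.arrived⟩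
      rcases Finset.mem_insert.1 hy' with rfl | hy'
      · exact absurd hy (List.nodup_cons.1 hs.nodup).1
      · exact hy'
  · simp [site] at hx

open Classical in
lemma exists_reach_run (ho : o ∉ l) (hnd : l.Nodup)
    (hs : l.Pairwise fun a b => G.dist o b ≤ G.dist o a)
    (hlow : ∀ z ∈ l, ∀ x, x ≠ o → G.dist o x < G.dist o z → x ∈ l) (ω : Sample V) (m : ℕ) :
    ∃ η, Reach ω η (fun x => (run G o K l ω m).hist.count x) ∧
      Realized o (run G o K l ω m) η := by
  induction m with
  | zero =>
    refine ⟨ω.init, Reach.init, fun y _ hy => ?_, by simp [run, begin], Nat.zero_le _⟩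
    rw [(Finset.mem_filter.1 hy).2]
    exact le_rfl
  | succ m ih =>
    obtain ⟨η, hr, hη⟩ := ih
    have hinv := inv_run (K := K) hnd hs hlow ω m
    rcases hsite : (run G o K l ω m).site with _ | x
    · refine ⟨η, ?_, hη.step_of_site_eq_none hinv hsite _⟩
      simp only [run, hist_step_of_site_eq_none hsite]
      exact hr
    · have hi : (run G o K l ω m).instrAt ω = ω.instr (x, (run G o K l ω m).hist.count x) := by
        simp [instrAt, coord, hsite]
      have hstep := hη.step ho hinv hsite ((run G o K l ω m).instrAt ω)
      refine ⟨_, ?_, hstep.2⟩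
      have := hr.topple x hstep.1
      rw [hi]
      convert this using 1
      funext v
      simp only [run, hist_step_of_site_eq_some hsite, List.count_cons, Function.update_apply]
      by_cases hv : v = x
      · simp [hv]
      · simp [hv, Ne.symm hv]

/-- The number of particles brought to `o` is bounded by the odometer around `o`. -/
lemma arrived_run_le [G.LocallyFinite] (ho : o ∉ l) (hnd : l.Nodup)
    (hs : l.Pairwise fun a b => G.dist o b ≤ G.dist o a)
    (hlow : ∀ z ∈ l, ∀ x, x ≠ o → G.dist o x < G.dist o z → x ∈ l) {ω : Sample V}
    (hω : Regular G ω) {U : V → ℕ} (hU : ∀ η u, Reach ω η u → ∀ x, u x ≤ U x) (m : ℕ) :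
    (run G o K l ω m).arrived ≤ 1 + ∑ y ∈ G.neighborFinset o, U y := by
  classical
  obtain ⟨η, hr, hη⟩ := exists_reach_run (K := K) ho hnd hs hlow ω m
  refine hη.arrived.trans ((SiteState.numActive_le_total _).trans ((hr.total_le hω o).trans ?_))
  exact Nat.add_le_add_left (Finset.sum_le_sum fun y _ => hU _ _ hr y) 1

end Sweep

end ARW

namespace ARW

variable {V : Type*}

namespace Sweep

variable {G : SimpleGraph V} {o : V} {K d : ℕ} {l : List V} {lam : ℝ≥0}
  {γ : ℕ → ℕ → V → ℝ} {h : V → ℝ}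

/-! ### Potentials -/

/-- `γ k n y` has the properties of the probability that a simple random walk from `y` hits `o`
within `n` steps before reaching distance `k`, and `h` dominates it. -/
structure IsHitting (G : SimpleGraph V) [G.LocallyFinite] (o : V) (K d : ℕ)
    (γ : ℕ → ℕ → V → ℝ) (h : V → ℝ) : Prop where
  degree_ne_zero : d ≠ 0
  degree_eq : ∀ x, G.degree x = d
  nonneg : ∀ k n y, 0 ≤ γ k n y
  center : ∀ k n, γ k n o = 1
  far : ∀ k n y, y ≠ o → k ≤ G.dist o y → γ k n y = 0
  zero : ∀ k y, y ≠ o → γ k 0 y = 0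
  succ : ∀ k n y, y ≠ o → G.dist o y < k →
    γ k (n + 1) y = (d : ℝ)⁻¹ * ∑ x ∈ G.neighborFinset y, γ k n x
  dom_nonneg : ∀ y, 0 ≤ h y
  le_dom : ∀ k n y, y ≠ o → n ≤ K → γ k n y ≤ h y
  mean_le_dom : ∀ k y, y ≠ o → (d : ℝ)⁻¹ * ∑ x ∈ G.neighborFinset y, γ k K x ≤ h y

/-- The expected contribution of the particle at `z`. -/
noncomputable def yield (G : SimpleGraph V) [G.LocallyFinite] (o : V) (K d : ℕ) (lam : ℝ≥0)
    (γ : ℕ → ℕ → V → ℝ) (z : V) : ℝ :=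
  (1 + (lam : ℝ))⁻¹ * ((d : ℝ)⁻¹ * ∑ y ∈ G.neighborFinset z, γ (G.dist o z) K y)

/-- The expected contribution of the moving particle. -/
def walkerValue (γ : ℕ → ℕ → V → ℝ) : Option (ℕ × ℕ × V) → ℝ
  | none => 0
  | some (k, n, y) => γ k (n + 1) y

/-- The total contribution of the vertices yet to be swept. -/
noncomputable def pending (a : V → ℝ) (s : Sweep V) : ℝ := (s.todo.map a).sum

/-- A submartingale. -/
noncomputable def lowerPotential (γ : ℕ → ℕ → V → ℝ) (h a : V → ℝ) (s : Sweep V) : ℝ :=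
  s.arrived + walkerValue γ s.walker + pending a s + ∑ z ∈ s.occ, h z

/-- A supermartingale dominating the square of the number of arrivals. -/
noncomputable def squarePotential (γ : ℕ → ℕ → V → ℝ) (a : V → ℝ) (s : Sweep V) : ℝ :=
  (s.arrived + pending a s) ^ 2 + (2 * (s.arrived + pending a s) + 1) * walkerValue γ s.walker +
    pending a s

/-- The number of jumps that the moving particle may still make. -/
def walkerBudget : Option (ℕ × ℕ × V) → ℝ
  | none => 0
  | some (_, n, _) => n + 1

/-- A bound on the number of jumps and vertices which are left. -/
noncomputable def budget (K : ℕ) (s : Sweep V) : ℝ :=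
  (K + 2) * s.todo.length + walkerBudget s.walker

lemma budget_arrive_le (s : Sweep V) (k n : ℕ) (y : V) :
    budget K (arrive G o k n y s) ≤ (K + 2) * s.todo.length + n := by
  have hn : (0 : ℝ) ≤ n := Nat.cast_nonneg n
  unfold arrive
  split_ifs with hy hky hocc
  · simp only [budget, walkerBudget]
    linarith
  · simp only [budget, walkerBudget]
    linarith
  · cases n with
    | zero => simp [budget, walkerBudget]
    | succ n => simp [budget, walkerBudget]
  · simp only [budget, walkerBudget]
    linarith

variable [G.LocallyFinite]

/-- The real-valued version of `mean`, on a graph of degree `d`. -/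
noncomputable def realMean (G : SimpleGraph V) [G.LocallyFinite] (o : V) (K d : ℕ) (lam : ℝ≥0)
    (f : Sweep V → ℝ) (s : Sweep V) : ℝ :=
  match s.site with
  | none => f (step G o K s .sleep)
  | some x => lam / (1 + lam) * f (step G o K s .sleep) +
      (1 + (lam : ℝ))⁻¹ * ((d : ℝ)⁻¹ * ∑ y ∈ G.neighborFinset x, f (step G o K s (.jump y)))

lemma mean_ofReal (hd : d ≠ 0) (hdeg : ∀ x, G.degree x = d) {f : Sweep V → ℝ} (hf : ∀ s, 0 ≤ f s)
    (s : Sweep V) :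
    mean G o K lam (fun s => ENNReal.ofReal (f s)) s = ENNReal.ofReal (realMean G o K d lam f s) := by
  rcases hsite : s.site with _ | x
  · simp only [mean, realMean, hsite]
  · simp only [mean, realMean, hsite]
    have hx : (G.neighborFinset x).Nonempty := by
      rw [← Finset.card_pos, SimpleGraph.card_neighborFinset_eq_degree, hdeg]
      omega
    have hsum : 0 ≤ ∑ y ∈ G.neighborFinset x, f (step G o K s (.jump y)) :=
      Finset.sum_nonneg fun _ _ => hf _
    rw [lintegral_instructionLaw G lam hx, hdeg, ENNReal.ofReal_add (mul_nonneg (by positivity)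
      (hf _)) (by positivity), ENNReal.ofReal_mul (by positivity), ENNReal.ofReal_mul (by positivity),
      ENNReal.ofReal_mul (by positivity), ENNReal.ofReal_sum_of_nonneg fun _ _ => hf _,
      ENNReal.ofReal_inv_of_pos (x := (d : ℝ)) (by positivity), ENNReal.ofReal_natCast]
    congr 2
    · rw [ENNReal.ofReal, ← NNReal.coe_one, ← NNReal.coe_add, ← NNReal.coe_div, Real.toNNReal_coe]
    · rw [one_div, ENNReal.ofReal, ← NNReal.coe_one, ← NNReal.coe_add, ← NNReal.coe_inv,
        Real.toNNReal_coe]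

namespace IsHitting

lemma card_neighborFinset (H : IsHitting G o K d γ h) (x : V) :
    ((G.neighborFinset x).card : ℝ) = d := by
  rw [SimpleGraph.card_neighborFinset_eq_degree, H.degree_eq]

lemma mean_affine (H : IsHitting G o K d γ h) (x : V) (c b : ℝ) (g : V → ℝ) :
    (d : ℝ)⁻¹ * ∑ y ∈ G.neighborFinset x, (c + b * g y) =
      c + b * ((d : ℝ)⁻¹ * ∑ y ∈ G.neighborFinset x, g y) := by
  have hd : (d : ℝ) ≠ 0 := by exact_mod_cast H.degree_ne_zero
  rw [Finset.sum_add_distrib, Finset.sum_const, nsmul_eq_mul, H.card_neighborFinset,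
    ← Finset.mul_sum]
  field_simp

lemma mean_le (H : IsHitting G o K d γ h) (x : V) {c b : ℝ} {g F : V → ℝ}
    (hF : ∀ y, F y ≤ c + b * g y) :
    (d : ℝ)⁻¹ * ∑ y ∈ G.neighborFinset x, F y ≤
      c + b * ((d : ℝ)⁻¹ * ∑ y ∈ G.neighborFinset x, g y) := by
  rw [← H.mean_affine]
  exact mul_le_mul_of_nonneg_left (Finset.sum_le_sum fun y _ => hF y) (by positivity)

lemma le_mean (H : IsHitting G o K d γ h) (x : V) {c b : ℝ} {g F : V → ℝ}
    (hF : ∀ y, c + b * g y ≤ F y) :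
    c + b * ((d : ℝ)⁻¹ * ∑ y ∈ G.neighborFinset x, g y) ≤
      (d : ℝ)⁻¹ * ∑ y ∈ G.neighborFinset x, F y := by
  rw [← H.mean_affine]
  exact mul_le_mul_of_nonneg_left (Finset.sum_le_sum fun y _ => hF y) (by positivity)

lemma yield_nonneg (H : IsHitting G o K d γ h) (z : V) : 0 ≤ yield G o K d lam γ z :=
  mul_nonneg (by positivity) (mul_nonneg (by positivity) (Finset.sum_nonneg fun _ _ => H.nonneg _ _ _))

/-- Crossing off a vacant `z` removes its yield from the pending total and adds `h z` for its entry
in `occ`; this inequality makes the exchange favourable. -/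
lemma yield_le (H : IsHitting G o K d γ h) {z : V} (hz : z ≠ o) : yield G o K d lam γ z ≤ h z := by
  refine le_trans (mul_le_of_le_one_left (mul_nonneg (by positivity)
    (Finset.sum_nonneg fun _ _ => H.nonneg _ _ _)) ?_) (H.mean_le_dom (G.dist o z) z hz)
  exact inv_le_one_of_one_le₀ (by simp)

lemma walkerValue_nonneg (H : IsHitting G o K d γ h) (w : Option (ℕ × ℕ × V)) :
    0 ≤ walkerValue γ w := by
  rcases w with _ | ⟨k, n, y⟩
  · exact le_rfl
  · exact H.nonneg _ _ _

lemma pending_nonneg (H : IsHitting G o K d γ h) (s : Sweep V) : 0 ≤ pending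
    (yield G o K d lam γ) s :=
  List.sum_nonneg fun x hx => by
    obtain ⟨z, -, rfl⟩ := List.mem_map.1 hx
    exact H.yield_nonneg z

lemma lowerPotential_nonneg (H : IsHitting G o K d γ h) (s : Sweep V) :
    0 ≤ lowerPotential γ h (yield G o K d lam γ) s := by
  have h1 := H.walkerValue_nonneg s.walker
  have h2 := H.pending_nonneg (lam := lam) s
  have h3 := Finset.sum_nonneg fun z (_ : z ∈ s.occ) => H.dom_nonneg z
  unfold lowerPotential
  positivity

lemma squarePotential_nonneg (H : IsHitting G o K d γ h) (s : Sweep V) :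
    0 ≤ squarePotential γ (yield G o K d lam γ) s := by
  have h1 := H.walkerValue_nonneg s.walker
  have h2 := H.pending_nonneg (lam := lam) s
  unfold squarePotential
  positivity

lemma sq_arrived_le (H : IsHitting G o K d γ h) (s : Sweep V) :
    (s.arrived : ℝ) ^ 2 ≤ squarePotential γ (yield G o K d lam γ) s := by
  have h1 := H.walkerValue_nonneg s.walker
  have h2 := H.pending_nonneg (lam := lam) s
  have h3 : (0 : ℝ) ≤ s.arrived := Nat.cast_nonneg _
  have h4 : (s.arrived : ℝ) ^ 2 ≤ (s.arrived + pending (yield G o K d lam γ) s) ^ 2 := by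
    gcongr
    linarith
  unfold squarePotential
  have h5 : 0 ≤ (2 * (s.arrived + pending (yield G o K d lam γ) s) + 1) *
      walkerValue γ s.walker := by positivity
  linarith

/-- In each way of stopping, the hitting value `γ k n y` is accounted for: it is one at `o`, zero at
distance at least `k` or without jumps left, and at most the gain `h y` when a vacant vertex is
filled. -/
lemma le_lowerPotential_arrive (H : IsHitting G o K d γ h) (a : V → ℝ) (s : Sweep V) (k : ℕ)
    {n : ℕ} (hn : n ≤ K) (y : V) :
    s.arrived + pending a s + ∑ z ∈ s.occ, h z + γ k n y ≤
      lowerPotential γ h a (arrive G o k n y s) := by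
  classical
  unfold arrive
  split_ifs with hy hky hocc
  · subst hy
    rw [H.center]
    simp only [lowerPotential, walkerValue, pending]
    push_cast
    linarith
  · rw [H.far k n y hy hky]
    simp only [lowerPotential, walkerValue, pending]
    linarith
  · cases n with
    | zero =>
      rw [H.zero k y hy]
      simp only [lowerPotential, walkerValue, pending]
      linarith
    | succ n =>
      simp only [lowerPotential, walkerValue, pending]
      linarith
  · have := H.le_dom k n y hy hn
    simp only [lowerPotential, walkerValue, pending]
    rw [Finset.sum_insert hocc]
    linarith

/-- `squarePotential` is the second-moment bound that future arrivals would satisfy if they were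
independent Bernoulli variables; an arrival changes the square of `x` by `2 * x + 1`, whence the
coefficient of the walker's value. -/
lemma squarePotential_arrive_le (H : IsHitting G o K d γ h) {a : V → ℝ} {s : Sweep V} (hs :
    0 ≤ pending a s) (k n : ℕ) (y : V) :
    squarePotential γ a (arrive G o k n y s) ≤
      ((s.arrived + pending a s) ^ 2 + pending a s) +
        (2 * (s.arrived + pending a s) + 1) * γ k n y := by
  have hnn := H.nonneg k n y
  have hA : (0 : ℝ) ≤ s.arrived := Nat.cast_nonneg _
  have hmul : 0 ≤ (2 * (s.arrived + pending a s) + 1) * γ k n y := by positivity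
  unfold arrive
  split_ifs with hy hky hocc
  · subst hy
    rw [H.center]
    simp only [squarePotential, walkerValue, pending]
    push_cast
    refine le_of_eq ?_
    ring
  · simp only [squarePotential, walkerValue, pending] at hmul ⊢
    linarith
  · cases n with
    | zero =>
      simp only [squarePotential, walkerValue, pending] at hmul ⊢
      linarith
    | succ n =>
      simp only [squarePotential, walkerValue, pending] at hmul ⊢
      linarith
  · simp only [squarePotential, walkerValue, pending] at hmul ⊢
    linarith

end IsHitting

lemma rates_add (lam : ℝ≥0) : (lam : ℝ) / (1 + lam) + (1 + (lam : ℝ))⁻¹ = 1 := by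
  have : (1 + (lam : ℝ)) ≠ 0 := by positivity
  field_simp
  ring

namespace IsHitting

/-- A release replaces the yield of `z` by its average, sleep included; a moving step uses the
recursion for `γ`, and a sleep during the motion changes nothing. -/
lemma le_realMean_lowerPotential (H : IsHitting G o K d γ h) (ho : o ∉ l) {s : Sweep V}
    (hs : Inv G o K l s) :
    lowerPotential γ h (yield G o K d lam γ) s ≤
      realMean G o K d lam (lowerPotential γ h (yield G o K d lam γ)) s := by
  classical
  set a := yield G o K d lam γ with ha
  have hqp := rates_add lam
  have hq : 0 ≤ (lam : ℝ) / (1 + lam) := by positivity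
  have hp : 0 ≤ (1 + (lam : ℝ))⁻¹ := by positivity
  obtain ⟨occ, A, todo, walker, hist⟩ := s
  rcases walker with _ | ⟨k, n, y⟩
  · rcases todo with _ | ⟨z, r⟩
    · simp [realMean, site, step]
    · have hzo : z ≠ o := by
        rintro rfl
        exact ho (hs.todo_subset z List.mem_cons_self)
      by_cases hz : z ∈ occ
      · have hm := H.le_mean z (F := fun y => lowerPotential γ h a
          (arrive G o (G.dist o z) K y ⟨occ, A, r, none, z :: hist⟩)) (b := 1)
          (g := γ (G.dist o z) K) (c := A + (r.map a).sum + ∑ z ∈ occ, h z) fun y => by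
            have := H.le_lowerPotential_arrive a ⟨occ, A, r, none, z :: hist⟩ (G.dist o z) le_rfl y
            simp only [pending] at this
            linarith
        have hm' := mul_le_mul_of_nonneg_left hm hp
        have haz : a z = (1 + (lam : ℝ))⁻¹ *
          ((d : ℝ)⁻¹ * ∑ y ∈ G.neighborFinset z, γ (G.dist o z) K y) := rfl
        simp only [realMean, site, hz, if_true, step]
        refine le_trans (le_of_eq ?_) (add_le_add le_rfl hm')
        simp only [lowerPotential, walkerValue, pending, List.map_cons, List.sum_cons]
        rw [haz]
        linear_combination (-(A + (r.map a).sum + ∑ z ∈ occ, h z)) * hqp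
      · have := H.yield_le (lam := lam) hzo
        simp only [realMean, site, hz, if_false, step, lowerPotential, walkerValue, pending,
          List.map_cons, List.sum_cons]
        rw [Finset.sum_insert hz]
        linarith
  · obtain ⟨hyo, hyk, hy, hn, hk⟩ := hs.walker_mem k n y rfl
    have hm := H.le_mean y (F := fun x => lowerPotential γ h a
      (arrive G o k n x ⟨occ, A, todo, some (k, n, y), y :: hist⟩)) (b := 1)
      (g := γ k n) (c := A + (todo.map a).sum + ∑ z ∈ occ, h z) fun x => by
        have := H.le_lowerPotential_arrive a ⟨occ, A, todo, some (k, n, y), y :: hist⟩ k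
          (n := n) (by omega) x
        simp only [pending] at this
        linarith
    rw [← H.succ k n y hyo hyk] at hm
    have hm' := mul_le_mul_of_nonneg_left hm hp
    simp only [realMean, site, step]
    refine le_trans (le_of_eq ?_) (add_le_add le_rfl hm')
    simp only [lowerPotential, walkerValue, pending]
    linear_combination (-(A + γ k (n + 1) y + (todo.map a).sum + ∑ z ∈ occ, h z)) * hqp

lemma realMean_squarePotential_le (H : IsHitting G o K d γ h) {s : Sweep V} (hs : Inv G o K l s) :
    realMean G o K d lam (squarePotential γ (yield G o K d lam γ)) s ≤
      squarePotential γ (yield G o K d lam γ) s := by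
  classical
  have hpend := fun s => H.pending_nonneg (lam := lam) s
  have hnn := fun z => H.yield_nonneg (lam := lam) z
  set a := yield G o K d lam γ with ha
  have hqp := rates_add lam
  have hq : 0 ≤ (lam : ℝ) / (1 + lam) := by positivity
  have hp : 0 ≤ (1 + (lam : ℝ))⁻¹ := by positivity
  obtain ⟨occ, A, todo, walker, hist⟩ := s
  have hA : (0 : ℝ) ≤ A := Nat.cast_nonneg _
  rcases walker with _ | ⟨k, n, y⟩
  · rcases todo with _ | ⟨z, r⟩
    · simp [realMean, site, step]
    · have hR := hpend ⟨occ, A, r, none, z :: hist⟩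
      simp only [pending] at hR
      by_cases hz : z ∈ occ
      · have hm := H.mean_le z (F := fun y => squarePotential γ a
          (arrive G o (G.dist o z) K y ⟨occ, A, r, none, z :: hist⟩))
          fun y => H.squarePotential_arrive_le (hpend ⟨occ, A, r, none, z :: hist⟩) (G.dist o z) K y
        have hm' := mul_le_mul_of_nonneg_left hm hp
        have haz : a z = (1 + (lam : ℝ))⁻¹ *
          ((d : ℝ)⁻¹ * ∑ y ∈ G.neighborFinset z, γ (G.dist o z) K y) := rfl
        simp only [realMean, site, hz, if_true, step]
        refine le_trans (add_le_add le_rfl hm') ?_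
        simp only [squarePotential, walkerValue, pending, List.map_cons, List.sum_cons]
        have hsq := sq_nonneg (a z)
        have key : (lam : ℝ) / (1 + lam) * ((A + (r.map a).sum) ^ 2 +
            (2 * (A + (r.map a).sum) + 1) * 0 + (r.map a).sum) +
            (1 + (lam : ℝ))⁻¹ * (((A + (r.map a).sum) ^ 2 + (r.map a).sum) +
              (2 * (A + (r.map a).sum) + 1) *
                ((d : ℝ)⁻¹ * ∑ y ∈ G.neighborFinset z, γ (G.dist o z) K y)) =
            (A + (r.map a).sum) ^ 2 + (r.map a).sum + (2 * (A + (r.map a).sum) + 1) * a z := by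
          rw [haz]
          linear_combination ((A + (r.map a).sum) ^ 2 + (r.map a).sum) * hqp
        rw [key]
        -- The slack is `a z ^ 2`: a Bernoulli variable of mean `a z` has variance at most `a z`.
        nlinarith
      · simp only [realMean, site, hz, if_false, step, squarePotential, walkerValue, pending,
          List.map_cons, List.sum_cons]
        have hz0 := hnn z
        have : (A + (r.map a).sum) ^ 2 ≤ (A + (a z + (r.map a).sum)) ^ 2 := by
          gcongr
          linarith
        linarith
  · obtain ⟨hyo, hyk, hy, hn, hk⟩ := hs.walker_mem k n y rfl
    have hm := H.mean_le y (F := fun x => squarePotential γ a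
      (arrive G o k n x ⟨occ, A, todo, some (k, n, y), y :: hist⟩))
      fun x => H.squarePotential_arrive_le (hpend ⟨occ, A, todo, some (k, n, y), y :: hist⟩) k n x
    rw [← H.succ k n y hyo hyk] at hm
    have hm' := mul_le_mul_of_nonneg_left hm hp
    simp only [realMean, site, step]
    refine le_trans (add_le_add le_rfl hm') (le_of_eq ?_)
    simp only [squarePotential, walkerValue, pending]
    linear_combination ((A + (todo.map a).sum) ^ 2 +
      (2 * (A + (todo.map a).sum) + 1) * γ k (n + 1) y + (todo.map a).sum) * hqp

/-- An ineffective sleep of the moving particle leaves the budget unchanged, whereas every other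
step lowers it by at least one. A jump has probability `1 / (1 + λ)`, which is the guaranteed mean
decrease. -/
lemma realMean_budget_add_le (H : IsHitting G o K d γ h) (s : Sweep V) :
    realMean G o K d lam (budget K) s +
      (if s.todo = [] ∧ s.walker = none then 0 else (1 + (lam : ℝ))⁻¹) ≤ budget K s := by
  classical
  have hqp := rates_add lam
  have hq : 0 ≤ (lam : ℝ) / (1 + lam) := by positivity
  have hp : 0 ≤ (1 + (lam : ℝ))⁻¹ := by positivity
  have hK : (0 : ℝ) ≤ K := Nat.cast_nonneg _
  obtain ⟨occ, A, todo, walker, hist⟩ := s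
  rcases walker with _ | ⟨k, n, y⟩
  · rcases todo with _ | ⟨z, r⟩
    · simp [realMean, site, step]
    · have hr : (0 : ℝ) ≤ r.length := Nat.cast_nonneg _
      by_cases hz : z ∈ occ
      · have hm := H.mean_le z (F := fun y => budget K
          (arrive G o (G.dist o z) K y ⟨occ, A, r, none, z :: hist⟩))
          (c := (K + 2) * r.length + K) (b := 0) (g := 0) fun y =>
            (budget_arrive_le _ _ _ _).trans (by simp)
        have hm' := mul_le_mul_of_nonneg_left hm hp
        simp only [realMean, site, hz, if_true, step]
        refine le_trans (add_le_add_left (add_le_add le_rfl hm') _) ?_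
        simp only [budget, walkerBudget, List.length_cons]
        push_cast
        simp only [false_and, if_false]
        have : (lam : ℝ) / (1 + lam) = 1 - (1 + (lam : ℝ))⁻¹ := by linarith
        rw [this]
        nlinarith
      · simp only [realMean, site, hz, if_false, step, budget, walkerBudget, List.length_cons,
          reduceCtorEq, false_and]
        push_cast
        nlinarith
  · have hm := H.mean_le y (F := fun x => budget K
      (arrive G o k n x ⟨occ, A, todo, some (k, n, y), y :: hist⟩))
      (c := (K + 2) * todo.length + n) (b := 0) (g := 0) fun x =>
        (budget_arrive_le _ _ _ _).trans (by simp)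
    have hm' := mul_le_mul_of_nonneg_left hm hp
    simp only [realMean, site, step]
    refine le_trans (add_le_add_left (add_le_add le_rfl hm') _) (le_of_eq ?_)
    simp only [budget, walkerBudget, reduceCtorEq, and_false, if_false]
    linear_combination ((K + 2) * todo.length + n + 1 : ℝ) * hqp

end IsHitting

end Sweep

end ARW

/-! ### First and second moments of the number of arrivals -/

namespace ARW

variable {V : Type*}

namespace Sweep

variable {G : SimpleGraph V} {o : V} {K d : ℕ} {l : List V} {lam : ℝ≥0}
  {γ : ℕ → ℕ → V → ℝ} {h : V → ℝ}

/-- `l` lists some vertices other than `o` by decreasing distance to `o`, and contains all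
vertices which are closer to `o` than one of them. -/
structure IsSweepable (G : SimpleGraph V) (o : V) (l : List V) : Prop where
  center : o ∉ l
  nodup : l.Nodup
  sorted : l.Pairwise fun a b => G.dist o b ≤ G.dist o a
  lower : ∀ z ∈ l, ∀ x, x ≠ o → G.dist o x < G.dist o z → x ∈ l

lemma budget_nonneg (s : Sweep V) : 0 ≤ budget K s := by
  obtain ⟨occ, A, todo, walker, hist⟩ := s
  rcases walker with _ | ⟨k, n, y⟩ <;> simp only [budget, walkerBudget] <;> positivity

lemma measurable_apply_run [Countable V] (l : List V) (m : ℕ) {β : Type*} [MeasurableSpace β]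
    (f : Sweep V → β) : Measurable fun ω => f (run G o K l ω m) :=
  (Measurable.of_discrete (f := f)).comp (measurable_run l m)

variable [G.LocallyFinite]

lemma realMean_nonneg {f : Sweep V → ℝ} (hf : ∀ s, 0 ≤ f s) (s : Sweep V) :
    0 ≤ realMean G o K d lam f s := by
  unfold realMean
  split
  · exact hf _
  · exact add_nonneg (mul_nonneg (by positivity) (hf _)) (mul_nonneg (by positivity)
      (mul_nonneg (by positivity) (Finset.sum_nonneg fun _ _ => hf _)))

/-- The procedure is not finished. -/
def Unfinished (s : Sweep V) : Prop := ¬ (s.todo = [] ∧ s.walker = none)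

namespace IsHitting

lemma lintegral_lowerPotential_zero (H : IsHitting G o K d γ h) (hl : l.Nodup) (lam : ℝ≥0)
    (μ : unitInterval) :
    ∫⁻ ω, ENNReal.ofReal (lowerPotential γ h (yield G o K d lam γ) (run G o K l ω 0))
      ∂(law G lam μ) =
    ENNReal.ofReal ((l.map (yield G o K d lam γ)).sum + μ * (l.map h).sum) := by
  classical
  have hR : 0 ≤ (l.map (yield G o K d lam γ)).sum := H.pending_nonneg ⟨∅, 0, l, none, []⟩
  have hμ : (0 : ℝ) ≤ μ := μ.2.1
  have hsum : (l.map h).sum = ∑ z ∈ l.toFinset, h z := (List.sum_toFinset h hl).symm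
  have hprob : ∀ z, law G lam μ {ω | ω.init z = .active 1} = ENNReal.ofReal μ := by
    intro z
    have := (measurePreserving_init G lam μ z).measure_preimage
      (s := {SiteState.active 1}) MeasurableSet.of_discrete.nullMeasurableSet
    refine this.trans ?_
    rw [bernoulliMeasure_apply_of_mem_of_notMem _ MeasurableSet.of_discrete (by simp) (by simp)]
    rw [ENNReal.ofReal]
    congr 1
    ext
    simp [hμ]
  have hpt : ∀ ω : Sample V,
      ENNReal.ofReal (lowerPotential γ h (yield G o K d lam γ) (run G o K l ω 0)) =
        ENNReal.ofReal (l.map (yield G o K d lam γ)).sum + ∑ z ∈ l.toFinset,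
          {ω : Sample V | ω.init z = .active 1}.indicator (fun _ => ENNReal.ofReal (h z)) ω := by
    intro ω
    have hnn := Finset.sum_nonneg fun z (_ : z ∈ (begin l ω).occ) => H.dom_nonneg z
    have : lowerPotential γ h (yield G o K d lam γ) (run G o K l ω 0) =
        (l.map (yield G o K d lam γ)).sum + ∑ z ∈ (begin l ω).occ, h z := by
      simp [lowerPotential, run, begin, walkerValue, pending]
    rw [this, ENNReal.ofReal_add hR hnn, ENNReal.ofReal_sum_of_nonneg fun z _ => H.dom_nonneg z]
    congr 1
    simp only [begin, Finset.sum_filter]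
    refine Finset.sum_congr rfl fun z _ => ?_
    by_cases hz : ω.init z = .active 1
    · rw [if_pos hz, Set.indicator_of_mem (s := {ω : Sample V | ω.init z = .active 1}) hz]
    · rw [if_neg hz, Set.indicator_of_notMem (s := {ω : Sample V | ω.init z = .active 1}) hz]
  have hms : ∀ z, MeasurableSet {ω : Sample V | ω.init z = .active 1} := fun z =>
    measurable_init z (t := {SiteState.active 1}) trivial
  rw [lintegral_congr hpt, lintegral_add_left measurable_const, lintegral_const, measure_univ,
    mul_one, lintegral_finsetSum _ fun z _ => measurable_const.indicator (hms z), hsum,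
    Finset.mul_sum, ENNReal.ofReal_add hR (Finset.sum_nonneg fun z _ =>
      mul_nonneg hμ (H.dom_nonneg z)),
    ENNReal.ofReal_sum_of_nonneg fun z _ => mul_nonneg hμ (H.dom_nonneg z)]
  congr 1
  refine Finset.sum_congr rfl fun z _ => ?_
  rw [lintegral_indicator_const (hms z), hprob, mul_comm, ENNReal.ofReal_mul hμ]

/-- At the end nothing is pending and `occ` lies in `l`, so the potential exceeds the number of
arrivals by at most the sum of `h`. Before the end only a crude bound is needed, as the unfinished
event will have small probability. -/
lemma lowerPotential_le (H : IsHitting G o K d γ h) (hl : IsSweepable G o l) {s : Sweep V}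
    (hs : Inv G o K l s) [Decidable s.Unfinished] :
    lowerPotential γ h (yield G o K d lam γ) s ≤ s.arrived + (l.map h).sum +
      if s.Unfinished then (l.map (yield G o K d lam γ)).sum + (l.map h).sum else 0 := by
  classical
  have hsum : (l.map h).sum = ∑ z ∈ l.toFinset, h z := (List.sum_toFinset h hl.nodup).symm
  have hsum' : (l.map (yield G o K d lam γ)).sum = ∑ z ∈ l.toFinset, yield G o K d lam γ z :=
    (List.sum_toFinset _ hl.nodup).symm
  have hocc : ∑ z ∈ s.occ, h z ≤ (l.map h).sum := by
    rw [hsum]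
    exact Finset.sum_le_sum_of_subset_of_nonneg
      (fun z hz => List.mem_toFinset.2 (hs.occ_subset z hz)) fun z _ _ => H.dom_nonneg z
  split_ifs with hu
  · have hp : pending (yield G o K d lam γ) s ≤ (l.map (yield G o K d lam γ)).sum := by
      rw [hsum', pending, ← List.sum_toFinset _ hs.nodup]
      exact Finset.sum_le_sum_of_subset_of_nonneg
        (fun z hz => List.mem_toFinset.2 (hs.todo_subset z (List.mem_toFinset.1 hz)))
        fun z _ _ => H.yield_nonneg z
    have hw : walkerValue γ s.walker ≤ (l.map h).sum := by
      rcases hw : s.walker with _ | ⟨k, n, y⟩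
      · rw [hsum]
        exact Finset.sum_nonneg fun z _ => H.dom_nonneg z
      · obtain ⟨hyo, -, hy, hn, -⟩ := hs.walker_mem k n y hw
        refine (H.le_dom k (n + 1) y hyo hn).trans ?_
        rw [hsum]
        exact Finset.single_le_sum (fun z _ => H.dom_nonneg z)
          (List.mem_toFinset.2 (hs.occ_subset y hy))
    unfold lowerPotential
    linarith
  · obtain ⟨ht, hw⟩ := not_not.1 hu
    simp only [lowerPotential, pending, ht, hw, walkerValue, List.map_nil, List.sum_nil]
    linarith

variable [Countable V]

lemma lintegral_lowerPotential_mono (H : IsHitting G o K d γ h) (hl : IsSweepable G o l)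
    (lam : ℝ≥0) (μ : unitInterval) (m : ℕ) :
    ∫⁻ ω, ENNReal.ofReal (lowerPotential γ h (yield G o K d lam γ) (run G o K l ω 0))
      ∂(law G lam μ) ≤
    ∫⁻ ω, ENNReal.ofReal (lowerPotential γ h (yield G o K d lam γ) (run G o K l ω m))
      ∂(law G lam μ) := by
  induction m with
  | zero => exact le_rfl
  | succ m ih =>
    refine ih.trans ?_
    rw [lintegral_run_succ (F := fun s =>
      ENNReal.ofReal (lowerPotential γ h (yield G o K d lam γ) s))]
    refine lintegral_mono fun ω => ?_
    rw [mean_ofReal H.degree_ne_zero H.degree_eq fun s => H.lowerPotential_nonneg s]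
    exact ENNReal.ofReal_le_ofReal (H.le_realMean_lowerPotential hl.center
      (inv_run hl.nodup hl.sorted hl.lower ω m))

lemma lintegral_squarePotential_le (H : IsHitting G o K d γ h) (hl : IsSweepable G o l)
    (lam : ℝ≥0) (μ : unitInterval) (m : ℕ) :
    ∫⁻ ω, ENNReal.ofReal (squarePotential γ (yield G o K d lam γ) (run G o K l ω m))
      ∂(law G lam μ) ≤
    ENNReal.ofReal ((l.map (yield G o K d lam γ)).sum ^ 2 + (l.map (yield G o K d lam γ)).sum) := by
  induction m with
  | zero =>
    refine (lintegral_mono fun ω => le_of_eq (congrArg ENNReal.ofReal ?_)).trans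
      (le_of_eq ((lintegral_const _).trans (by rw [measure_univ, mul_one])))
    simp [squarePotential, run, begin, walkerValue, pending]
  | succ m ih =>
    refine le_trans ?_ ih
    rw [lintegral_run_succ (F := fun s =>
      ENNReal.ofReal (squarePotential γ (yield G o K d lam γ) s))]
    refine lintegral_mono fun ω => ?_
    rw [mean_ofReal H.degree_ne_zero H.degree_eq fun s => H.squarePotential_nonneg s]
    exact ENNReal.ofReal_le_ofReal (H.realMean_squarePotential_le
      (inv_run hl.nodup hl.sorted hl.lower ω m))

lemma lintegral_budget_add_le (H : IsHitting G o K d γ h) (lam : ℝ≥0) (μ : unitInterval) (m : ℕ) :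
    ∫⁻ ω, ENNReal.ofReal (budget K (run G o K l ω m)) ∂(law G lam μ) +
      ∑ j ∈ Finset.range m, ENNReal.ofReal (1 + (lam : ℝ))⁻¹ *
        law G lam μ {ω | (run G o K l ω j).Unfinished} ≤
    ENNReal.ofReal ((K + 2) * l.length) := by
  classical
  induction m with
  | zero =>
    simp only [Finset.range_zero, Finset.sum_empty, add_zero]
    refine (lintegral_mono fun ω => le_of_eq (congrArg ENNReal.ofReal ?_)).trans
      (le_of_eq ((lintegral_const _).trans (by rw [measure_univ, mul_one])))
    simp [budget, run, begin, walkerBudget]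
  | succ m ih =>
    refine le_trans ?_ ih
    rw [Finset.sum_range_succ, add_comm (∑ j ∈ _, _), ← add_assoc]
    refine add_le_add_left ?_ _
    have hm : MeasurableSet {ω | (run G o K l ω m).Unfinished} :=
      measurable_run l m (t := {s | s.Unfinished}) trivial
    rw [lintegral_run_succ (F := fun s => ENNReal.ofReal (budget K s)),
      ← lintegral_indicator_const hm, ← lintegral_add_right _ (measurable_const.indicator hm)]
    refine lintegral_mono fun ω => ?_
    rw [mean_ofReal H.degree_ne_zero H.degree_eq fun s => budget_nonneg s]
    have hb := H.realMean_budget_add_le (lam := lam) (run G o K l ω m)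
    have hnn : 0 ≤ realMean G o K d lam (budget K) (run G o K l ω m) :=
      realMean_nonneg (fun s => budget_nonneg s) _
    by_cases hu : (run G o K l ω m).Unfinished
    · rw [Set.indicator_of_mem (s := {ω | (run G o K l ω m).Unfinished}) hu,
        ← ENNReal.ofReal_add hnn (by positivity)]
      rw [if_neg hu] at hb
      exact ENNReal.ofReal_le_ofReal hb
    · rw [Set.indicator_of_notMem (s := {ω | (run G o K l ω m).Unfinished}) hu, add_zero]
      rw [if_pos (not_not.1 hu), add_zero] at hb
      exact ENNReal.ofReal_le_ofReal hb

/-- Each unfinished step consumes at least `1 / (1 + λ)` of a finite budget on average, so the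
probabilities of being unfinished cannot all stay above `ε`. -/
lemma exists_unfinished_le (H : IsHitting G o K d γ h) (lam : ℝ≥0) (μ : unitInterval) (l : List V)
    {ε : ℝ} (hε : 0 < ε) :
    ∃ m, law G lam μ {ω | (run G o K l ω m).Unfinished} ≤ ENNReal.ofReal ε := by
  by_contra hcon
  push Not at hcon
  have hp : 0 < (1 + (lam : ℝ))⁻¹ := by positivity
  obtain ⟨m, hm⟩ := exists_nat_gt (((K + 2) * l.length : ℝ) / ((1 + (lam : ℝ))⁻¹ * ε))
  rw [div_lt_iff₀ (by positivity)] at hm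
  have h1 := le_trans le_add_self (H.lintegral_budget_add_le (l := l) lam μ m)
  have h2 : ENNReal.ofReal (m * ((1 + (lam : ℝ))⁻¹ * ε)) ≤ ENNReal.ofReal ((K + 2) * l.length) := by
    refine le_trans (le_of_eq ?_) (le_trans (Finset.sum_le_sum fun j (_ : j ∈ Finset.range m) =>
      mul_le_mul_right (hcon j).le _) h1)
    rw [Finset.sum_const, Finset.card_range, nsmul_eq_mul, ENNReal.ofReal_mul (by positivity),
      ENNReal.ofReal_mul hp.le, ENNReal.ofReal_natCast]
  rw [ENNReal.ofReal_le_ofReal_iff (by positivity)] at h2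
  linarith

/-- If few particles arrive at `o` outside of an event `S`, then the expected number of
arrivals is small. -/
lemma sum_yield_le (H : IsHitting G o K d γ h) (hl : IsSweepable G o l) (lam : ℝ≥0)
    (μ : unitInterval) {S : Set (Sample V)} (hS : MeasurableSet S) {n : ℕ}
    (hn : ∀ m ω, n < (run G o K l ω m).arrived → ω ∈ S) {t : ℝ} (ht : 0 < t) :
    (l.map (yield G o K d lam γ)).sum ≤ n + 1 +
      t * ((l.map (yield G o K d lam γ)).sum ^ 2 + (l.map (yield G o K d lam γ)).sum) +
      (4 * t)⁻¹ * (law G lam μ).real S + (1 - μ) * (l.map h).sum := by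
  classical
  set R := (l.map (yield G o K d lam γ)).sum with hRdef
  set W := (l.map h).sum with hWdef
  have hR : 0 ≤ R := H.pending_nonneg ⟨∅, 0, l, none, []⟩
  have hW : 0 ≤ W := List.sum_nonneg fun x hx => by
    obtain ⟨z, -, rfl⟩ := List.mem_map.1 hx
    exact H.dom_nonneg z
  have hμ : (0 : ℝ) ≤ μ := μ.2.1
  -- On the unfinished event the excess of the potential is at most `R + W`; with this `ε` its
  -- expectation is at most one, which is the `+ 1` of the statement.
  obtain ⟨m, hm⟩ := H.exists_unfinished_le lam μ l (ε := (R + W + 1)⁻¹) (by positivity)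
  have hU : MeasurableSet {ω | (run G o K l ω m).Unfinished} :=
    measurable_run l m (t := {s | s.Unfinished}) trivial
  have hpt : ∀ ω : Sample V,
      ENNReal.ofReal (lowerPotential γ h (yield G o K d lam γ) (run G o K l ω m)) ≤
        ENNReal.ofReal (n + W) + ENNReal.ofReal t *
          ENNReal.ofReal (squarePotential γ (yield G o K d lam γ) (run G o K l ω m)) +
        S.indicator (fun _ => ENNReal.ofReal (4 * t)⁻¹) ω +
        {ω | (run G o K l ω m).Unfinished}.indicator (fun _ => ENNReal.ofReal (R + W)) ω := by
    intro ω
    have h1 := H.lowerPotential_le (lam := lam) hl (inv_run (K := K) hl.nodup hl.sorted hl.lower ω m)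
    have h2 := H.sq_arrived_le (lam := lam) (run G o K l ω m)
    have h3 : ((run G o K l ω m).arrived : ℝ) ≤
        n + t * squarePotential γ (yield G o K d lam γ) (run G o K l ω m) +
          S.indicator (fun _ => (4 * t)⁻¹) ω := by
      set A : ℝ := ((run G o K l ω m).arrived : ℝ) with hA
      by_cases hlt : n < (run G o K l ω m).arrived
      · rw [Set.indicator_of_mem (hn m ω hlt)]
        -- On `S` arrivals are traded for a small multiple of their square plus a constant that is
        -- paid with the probability of `S`; off `S` they are at most `n`.
        have hsq : A ≤ t * A ^ 2 + (4 * t)⁻¹ := by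
          have h4 : t * A ^ 2 + (4 * t)⁻¹ - A = t * (A - (2 * t)⁻¹) ^ 2 := by
            field_simp
            ring
          have h5 : 0 ≤ t * (A - (2 * t)⁻¹) ^ 2 := by positivity
          linarith
        have := mul_le_mul_of_nonneg_left h2 ht.le
        have hn0 : (0 : ℝ) ≤ n := Nat.cast_nonneg n
        linarith
      · have hAn : A ≤ n := by
          rw [hA]
          exact_mod_cast not_lt.1 hlt
        have h4 : 0 ≤ t * squarePotential γ (yield G o K d lam γ) (run G o K l ω m) :=
          mul_nonneg ht.le (H.squarePotential_nonneg _)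
        have h5 : 0 ≤ S.indicator (fun _ => (4 * t)⁻¹) ω :=
          Set.indicator_nonneg (fun _ _ => by positivity) ω
        linarith
    have h4 : lowerPotential γ h (yield G o K d lam γ) (run G o K l ω m) ≤
        (n + W) + t * squarePotential γ (yield G o K d lam γ) (run G o K l ω m) +
          S.indicator (fun _ => (4 * t)⁻¹) ω +
          {ω | (run G o K l ω m).Unfinished}.indicator (fun _ => R + W) ω := by
      have : {ω | (run G o K l ω m).Unfinished}.indicator (fun _ => R + W) ω =
          if (run G o K l ω m).Unfinished then R + W else 0 := rfl
      rw [this]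
      linarith
    refine (ENNReal.ofReal_le_ofReal h4).trans (ENNReal.ofReal_add_le.trans
      (add_le_add (ENNReal.ofReal_add_le.trans (add_le_add (ENNReal.ofReal_add_le.trans
        (add_le_add le_rfl (ENNReal.ofReal_mul ht.le).le)) ?_)) ?_))
    · by_cases hω : ω ∈ S
      · simp [hω]
      · simp [hω]
    · by_cases hω : ω ∈ {ω | (run G o K l ω m).Unfinished}
      · rw [Set.indicator_of_mem hω, Set.indicator_of_mem hω]
      · rw [Set.indicator_of_notMem hω, Set.indicator_of_notMem hω, ENNReal.ofReal_zero]
  have hintegral := (H.lintegral_lowerPotential_mono hl lam μ m).trans (lintegral_mono hpt)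
  rw [H.lintegral_lowerPotential_zero hl.nodup,
    lintegral_add_right _ (measurable_const.indicator hU),
    lintegral_add_right _ (measurable_const.indicator hS),
    lintegral_add_left measurable_const, lintegral_const, measure_univ, mul_one,
    lintegral_const_mul _ (measurable_apply_run l m fun s =>
      ENNReal.ofReal (squarePotential γ (yield G o K d lam γ) s)),
    lintegral_indicator_const hU, lintegral_indicator_const hS] at hintegral
  have hSq := H.lintegral_squarePotential_le hl lam μ m
  have hfin : ENNReal.ofReal (R + μ * W) ≤ ENNReal.ofReal ((n + W) + t * (R ^ 2 + R) +
      (4 * t)⁻¹ * (law G lam μ).real S + (R + W) * (R + W + 1)⁻¹) := by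
    rw [ENNReal.ofReal_add (p := n + W + t * (R ^ 2 + R) + (4 * t)⁻¹ * (law G lam μ).real S)
        (by positivity) (by positivity),
      ENNReal.ofReal_add (p := n + W + t * (R ^ 2 + R)) (by positivity) (by positivity),
      ENNReal.ofReal_add (p := n + W) (by positivity) (by positivity), ENNReal.ofReal_mul ht.le,
      ENNReal.ofReal_mul (p := (4 * t)⁻¹) (by positivity), ENNReal.ofReal_mul (p := R + W)
      (by positivity), ofReal_measureReal]
    refine hintegral.trans ?_
    gcongr
  rw [ENNReal.ofReal_le_ofReal_iff (by positivity)] at hfin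
  have hlast : (R + W) * (R + W + 1)⁻¹ ≤ 1 := by
    rw [← div_eq_mul_inv]
    exact div_le_one_of_le₀ (by linarith) (by positivity)
  linarith

end IsHitting

end Sweep

end ARW

/-! ### The density of the sweeping procedure -/

namespace IsSimpleRandomWalk

variable {V : Type*} {G : SimpleGraph V} [G.LocallyFinite] {o : V} {Ω : Type*} [MeasurableSpace Ω]
  {P : Measure Ω} [IsProbabilityMeasure P] {X : ℕ → Ω → V} {d : ℕ}

/-- The dominating function drops the constraint on the distance and allows one more step, `K + 1`,
because a released particle makes a first jump and then up to `K` others. -/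
lemma isHitting_green [Countable V] (hX : IsSimpleRandomWalk G o P X) (hd : d ≠ 0)
    (hdeg : ∀ x, G.degree x = d) (K : ℕ) :
    ARW.Sweep.IsHitting G o K d (fun k n y => green P X {y | y ≠ o ∧ G.dist o y < k} n y)
      (green P X {y | y ≠ o} (K + 1)) where
  degree_ne_zero := hd
  degree_eq := hdeg
  nonneg _ _ _ := green_nonneg _ _ _
  center k n := hX.green_self (fun h => h.1 rfl) n
  far k n y hy hk := hX.green_of_notMem (fun h => absurd h.2 (not_lt.2 hk)) hy n
  zero k y hy := hX.green_zero _ hy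
  succ k n y hy hk := hX.green_succ hd hdeg (show _ ∧ _ from ⟨hy, hk⟩) hy n
  dom_nonneg _ := green_nonneg _ _ _
  le_dom k n y _ hn := green_mono (fun _ h => h.1) (by omega) y
  mean_le_dom k y hy := by
    rw [hX.green_succ hd hdeg (show y ∈ {y | y ≠ o} from hy) hy]
    exact mul_le_mul_of_nonneg_left
      (Finset.sum_le_sum fun x _ => green_mono (fun _ h => h.1) le_rfl x) (by positivity)

lemma exists_sweepable (hG : G.Connected) (o : V) (L : ℕ) :
    ∃ l : List V, ARW.Sweep.IsSweepable G o l ∧ ∀ z, z ∈ l ↔ z ≠ o ∧ G.dist o z ≤ L := by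
  classical
  let S : Finset V := (G.ballFinset o L).filter fun z => z ≠ o ∧ G.dist o z ≤ L
  let r : V → V → Prop := fun a b => G.dist o b ≤ G.dist o a
  have : Std.Total r := ⟨fun a b => le_total _ _⟩
  have : IsTrans V r := ⟨fun a b c h h' => le_trans h' h⟩
  have hperm : (S.toList.insertionSort r).Perm S.toList := List.perm_insertionSort r _
  have hmem : ∀ z, z ∈ S.toList.insertionSort r ↔ z ≠ o ∧ G.dist o z ≤ L := by
    intro z
    rw [hperm.mem_iff, Finset.mem_toList, Finset.mem_filter]
    exact ⟨fun h => h.2, fun h => ⟨hG.mem_ballFinset h.2, h⟩⟩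
  refine ⟨S.toList.insertionSort r, ⟨fun h => ((hmem o).1 h).1 rfl,
    hperm.nodup_iff.2 S.nodup_toList, List.pairwise_insertionSort r _, fun z hz x hx hlt => ?_⟩, hmem⟩
  exact (hmem x).2 ⟨hx, hlt.le.trans ((hmem z).1 hz).2⟩

/-- By `le_sum_sphere`, each sphere of radius `1 ≤ k ≤ L` contributes `(1 + λ)⁻¹` times at least the
probability of escaping from `o` and being at distance at least `k` at time `K + 1`, hence at least
`δ - b` inside the product. -/
lemma le_sum_yield [Countable V] (hX : IsSimpleRandomWalk G o P X) (hG : G.Connected) (hd : d ≠ 0)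
    (hdeg : ∀ x, G.degree x = d) (K L : ℕ) (lam : ℝ≥0) {l : List V} (hnd : l.Nodup)
    (hl : ∀ z, z ∈ l ↔ z ≠ o ∧ G.dist o z ≤ L) {b : ℝ}
    (hb : P.real {ω | G.dist o (X (K + 1) ω) < L} ≤ b) :
    (1 + (lam : ℝ))⁻¹ * (L * (P.real {ω | ∀ t ≥ 1, X t ω ≠ o} - b)) ≤
      (l.map (ARW.Sweep.yield G o K d lam
        fun k n y => green P X {y | y ≠ o ∧ G.dist o y < k} n y)).sum := by
  classical
  rw [← List.sum_toFinset _ hnd, ← Finset.sum_fiberwise_of_maps_to (s := l.toFinset)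
    (t := Finset.Icc 1 L) (g := fun z => G.dist o z)]
  · have hcard : (L : ℝ) * (P.real {ω | ∀ t ≥ 1, X t ω ≠ o} - b) =
        ∑ k ∈ Finset.Icc 1 L, (P.real {ω | ∀ t ≥ 1, X t ω ≠ o} - b) := by
      rw [Finset.sum_const, Nat.card_Icc, Nat.add_sub_cancel, nsmul_eq_mul]
    rw [hcard, Finset.mul_sum]
    refine Finset.sum_le_sum fun k hk => ?_
    obtain ⟨hk1, hkL⟩ := Finset.mem_Icc.1 hk
    have h1 := hX.le_sum_sphere hG hd hdeg hk1 K (l.toFinset.filter fun z => G.dist o z = k)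
      fun z hz => Finset.mem_filter.2 ⟨List.mem_toFinset.2 ((hl z).2 ⟨?_, hz.le.trans hkL⟩), hz⟩
    · have h2 : P.real {ω | ∀ t ≥ 1, X t ω ≠ o} ≤
          P.real {ω | (∀ t ≥ 1, X t ω ≠ o) ∧ k ≤ G.dist o (X (K + 1) ω)} +
            P.real {ω | G.dist o (X (K + 1) ω) < L} := by
        refine (measureReal_mono fun ω hω => ?_).trans (measureReal_union_le _ _)
        rcases le_or_gt k (G.dist o (X (K + 1) ω)) with h | h
        · exact Or.inl ⟨hω, h⟩
        · exact Or.inr (show _ < _ from h.trans_le hkL)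
      have h3 : ∑ z ∈ l.toFinset with G.dist o z = k, ARW.Sweep.yield G o K d lam
          (fun k n y => green P X {y | y ≠ o ∧ G.dist o y < k} n y) z =
          (1 + (lam : ℝ))⁻¹ * ∑ z ∈ l.toFinset with G.dist o z = k, (d : ℝ)⁻¹ *
            ∑ y ∈ G.neighborFinset z, green P X {y | y ≠ o ∧ G.dist o y < k} K y := by
        rw [Finset.mul_sum]
        refine Finset.sum_congr rfl fun z hz => ?_
        rw [ARW.Sweep.yield, (Finset.mem_filter.1 hz).2]
      rw [h3]
      exact mul_le_mul_of_nonneg_left (by linarith) (by positivity)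
    · rintro rfl
      simp at hz
      omega
  · intro z hz
    obtain ⟨hzo, hzL⟩ := (hl z).1 (List.mem_toFinset.1 hz)
    exact Finset.mem_Icc.2 ⟨(hG.pos_dist_of_ne hzo.symm), hzL⟩

lemma sum_dom_le [Countable V] (hX : IsSimpleRandomWalk G o P X) (K : ℕ) {l : List V}
    (hnd : l.Nodup) (ho : o ∉ l) :
    (l.map (green P X {y | y ≠ o} (K + 1))).sum ≤
      ∑ j ∈ Finset.range (K + 1), noReturn P X o (j + 1) := by
  classical
  rw [← List.sum_toFinset _ hnd]
  exact hX.sum_green_le _ _ (by simpa using ho) _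

/-- The probabilities of no return converge to the escape probability, hence so do their Cesàro
means. -/
lemma eventually_sum_noReturn_le [Countable V] (hX : IsSimpleRandomWalk G o P X) {ε : ℝ}
    (hε : 0 < ε) : ∀ᶠ N : ℕ in atTop, ∑ j ∈ Finset.range N, noReturn P X o (j + 1) ≤
      N * (P.real {ω | ∀ t ≥ 1, X t ω ≠ o} + ε) := by
  have h := (hX.tendsto_noReturn.comp (tendsto_add_atTop_nat 1)).cesaro
  filter_upwards [h.eventually_lt_const (lt_add_of_pos_right _ hε), eventually_gt_atTop 0]
    with N hN hpos
  have hN0 : (0 : ℝ) < N := by exact_mod_cast hpos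
  rw [inv_mul_lt_iff₀ hN0] at hN
  exact hN.le

end IsSimpleRandomWalk

/-! ### Comparing linear growth with tightness -/

namespace ARW

variable {V : Type*} {G : SimpleGraph V} [G.LocallyFinite] {o : V}

/-- If the process is almost surely not active, then the numbers of particles which the sweeping
procedures bring to `o` are tight. -/
lemma exists_arrived_le [Countable V] {lam : ℝ≥0} {μ : unitInterval} {d : ℕ}
    (hG : ∀ x, (G.neighborFinset x).Nonempty) (hdeg : ∀ x, G.degree x = d)
    (hna : law G lam μ {ω | IsActive ω} = 0) (K : ℕ → ℕ) {l : ℕ → List V}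
    (hl : ∀ L, Sweep.IsSweepable G o (l L)) {ε : ℝ} (hε : 0 < ε) :
    ∃ n : ℕ, ∃ S : Set (Sample V), MeasurableSet S ∧ (law G lam μ).real S ≤ ε ∧
      ∀ L m ω, n < (Sweep.run G o (K L) (l L) ω m).arrived → ω ∈ S := by
  let S : ℕ → Set (Sample V) := fun n =>
    ⋃ L, ⋃ m, {ω | n < (Sweep.run G o (K L) (l L) ω m).arrived}
  have hS : ∀ n, MeasurableSet (S n) := fun n => MeasurableSet.iUnion fun L =>
    MeasurableSet.iUnion fun m => Sweep.measurable_run (l L) m (t := {s | n < s.arrived}) trivial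
  have hanti : Antitone S := fun n n' hn => Set.iUnion_mono fun L => Set.iUnion_mono fun m ω hω =>
    show _ < _ from lt_of_le_of_lt hn hω
  have hnull : law G lam μ (⋂ n, S n) = 0 := by
    have hae : ∀ᵐ ω ∂(law G lam μ), ω ∉ ⋂ n, S n := by
      have hna' : ∀ᵐ ω ∂(law G lam μ), ¬ IsActive ω := by
        rw [ae_iff]
        simpa using hna
      filter_upwards [ae_regular G lam μ hG, ae_clocks G lam μ,
        ae_nonExplosive G lam μ hG fun x => (hdeg x).le, hna'] with ω hreg hcl hne hna hω
      obtain ⟨U, hU⟩ := exists_odometer_bound hreg hcl hne hna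
      -- The bound `U` depends on `ω` but neither on the radius nor on the stage, so a single `n`
      -- works for all sweeps of this sample.
      have h := Set.mem_iInter.1 hω (1 + ∑ y ∈ G.neighborFinset o, U y)
      simp only [S, Set.mem_iUnion] at h
      obtain ⟨L, m, h⟩ := h
      exact absurd (Sweep.arrived_run_le (hl L).center (hl L).nodup (hl L).sorted (hl L).lower
        hreg hU m) (not_le.2 h)
    rw [ae_iff] at hae
    simp only [not_not] at hae
    exact hae
  have ht := tendsto_measure_iInter_atTop (μ := law G lam μ)
    (fun n => (hS n).nullMeasurableSet) hanti ⟨0, measure_ne_top _ _⟩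
  have ht' := (ENNReal.tendsto_toReal (measure_ne_top _ _)).comp ht
  rw [hnull, ENNReal.toReal_zero] at ht'
  obtain ⟨n, hn⟩ := (ht'.eventually_lt_const hε).exists
  exact ⟨n, S n, hS n, hn.le, fun L m ω hω => Set.mem_iUnion₂.2 ⟨L, m, hω⟩⟩

lemma exists_forall_affine_lt {A a κ : ℝ} (h : a < κ) : ∃ L₀ : ℝ, ∀ L ≥ L₀, A + a * L < κ * L := by
  refine ⟨(A + 1) / (κ - a), fun L hL => ?_⟩
  rw [ge_iff_le, div_le_iff₀ (by linarith)] at hL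
  linarith

/-- With `t = ε / L` and an exceptional probability `p ≤ ε ^ 2`, both the second-moment term and the
term paid for `p` are of order `ε L`, so only the vacancy term remains at order `L`. -/
lemma le_affine_of_le {c ε δ q L R W p n : ℝ} (hc : 0 < c) (hε : 0 < ε) (hδ0 : 0 ≤ δ)
    (hδ1 : δ ≤ 1) (hq0 : 0 ≤ q) (hq1 : q ≤ 1) (hL : 1 ≤ L) (hR0 : 0 ≤ R) (hRN : R ≤ c * L + 2)
    (hW : W ≤ (c * L + 2) * (δ + ε)) (hp : p ≤ ε ^ 2)
    (h : R ≤ n + 1 + ε / L * (R ^ 2 + R) + (4 * (ε / L))⁻¹ * p + q * W) :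
    R ≤ n + 1 + 2 * (1 + ε) + (q * (δ * c) + ε * (2 * (c + 2) ^ 2 + 1 / 4 + c)) * L := by
  have hLpos : 0 < L := by linarith
  have hRN' : R ≤ (c + 2) * L := by linarith
  have hsq : R ^ 2 + R ≤ 2 * (c + 2) ^ 2 * L ^ 2 := by
    have h1 : R ^ 2 ≤ ((c + 2) * L) ^ 2 := by gcongr
    have h2 : (c + 2) * L ≤ ((c + 2) * L) ^ 2 := by
      have : 0 ≤ c * L := by positivity
      exact le_self_pow₀ (by linarith) two_ne_zero
    have h3 : ((c + 2) * L) ^ 2 = (c + 2) ^ 2 * L ^ 2 := by ring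
    linarith
  have hterm1 : ε / L * (R ^ 2 + R) ≤ ε * (2 * (c + 2) ^ 2) * L := by
    calc ε / L * (R ^ 2 + R) ≤ ε / L * (2 * (c + 2) ^ 2 * L ^ 2) := by gcongr
      _ = ε * (2 * (c + 2) ^ 2) * L := by field_simp
  have hterm2 : (4 * (ε / L))⁻¹ * p ≤ ε * (1 / 4) * L := by
    calc (4 * (ε / L))⁻¹ * p ≤ (4 * (ε / L))⁻¹ * ε ^ 2 := by gcongr
      _ = ε * (1 / 4) * L := by field_simp
  have hterm3 : q * W ≤ q * (δ * c) * L + ε * c * L + 2 * (1 + ε) := by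
    have h2 : q * W ≤ q * ((c * L + 2) * (δ + ε)) := mul_le_mul_of_nonneg_left hW hq0
    have h3 : q * (c * L * ε) ≤ c * L * ε := mul_le_of_le_one_left (by positivity) hq1
    have h4 : q * (2 * (δ + ε)) ≤ 2 * (δ + ε) := mul_le_of_le_one_left (by positivity) hq1
    linarith
  linarith

lemma criticalDensity_le {lam : ℝ≥0} {μ : unitInterval} (h : 0 < law G lam μ {ω | IsActive ω}) :
    criticalDensity G lam ≤ ((μ : ℝ) : EReal) :=
  sInf_le ⟨μ, h, rfl⟩

variable [Infinite V] {Ω : Type*} [MeasurableSpace Ω] {P : Measure Ω} [IsProbabilityMeasure P]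
  {X : ℕ → Ω → V}

theorem law_isActive_pos (hconn : G.Connected) (htrans : IsVertexTransitive G)
    (hX : IsSimpleRandomWalk G o P X) {lam : ℝ≥0} {μ : unitInterval} {c b : ℝ} (hc : 0 < c)
    (hb : P.real {ω | lowerSpeed G o (fun t => X t ω) ≤ c⁻¹} < b)
    (hgap : (1 - μ) * (P.real {ω | ∀ t ≥ 1, X t ω ≠ o} * c) <
      (1 + (lam : ℝ))⁻¹ * (P.real {ω | ∀ t ≥ 1, X t ω ≠ o} - b)) :
    0 < law G lam μ {ω | IsActive ω} := by
  have hcount : Countable V := hconn.countable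
  have hne := fun x => hconn.neighborFinset_nonempty x
  set d := G.degree o with hddef
  have hdeg : ∀ x, G.degree x = d := fun x => htrans.degree_eq x o
  have hd : d ≠ 0 := by
    rw [hddef, ← SimpleGraph.card_neighborFinset_eq_degree]
    exact (Finset.card_pos.2 (hne o)).ne'
  set δ := P.real {ω | ∀ t ≥ 1, X t ω ≠ o} with hδ
  have hδ0 : 0 ≤ δ := measureReal_nonneg
  have hδ1 : δ ≤ 1 := measureReal_le_one
  have hμ0 : (0 : ℝ) ≤ μ := μ.2.1
  have hμ1 : (μ : ℝ) ≤ 1 := μ.2.2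
  rw [pos_iff_ne_zero]
  intro hna
  set κ := (1 + (lam : ℝ))⁻¹ * (δ - b) with hκ
  set B := 2 * (c + 2) ^ 2 + 1 / 4 + c with hBdef
  have hB : 0 < B := by positivity
  -- `B` collects the errors of order `ε L` in `le_affine_of_le`; half of the available gap is given
  -- to them.
  obtain ⟨ε, hε, hεB⟩ : ∃ ε > 0, (1 - μ) * (δ * c) + ε * B < κ := by
    refine ⟨(κ - (1 - μ) * (δ * c)) / (2 * B), div_pos (by linarith) (by positivity), ?_⟩
    have : (κ - (1 - μ) * (δ * c)) / (2 * B) * B = (κ - (1 - μ) * (δ * c)) / 2 := by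
      field_simp
    rw [this]
    linarith
  let K : ℕ → ℕ := fun L => ⌈c * L⌉₊
  have hKlow : ∀ L : ℕ, c * L ≤ (K L + 1 : ℕ) := fun L => by
    push_cast
    linarith [Nat.le_ceil (c * L)]
  have hKup : ∀ L : ℕ, ((K L + 1 : ℕ) : ℝ) ≤ c * L + 2 := fun L => by
    push_cast
    linarith [Nat.ceil_lt_add_one (show 0 ≤ c * L by positivity)]
  choose l hl hmem using fun L => IsSimpleRandomWalk.exists_sweepable hconn o L
  -- `n` and `S` are fixed before `L`, uniformly over all radii, so `n` is negligible once `L` is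
  -- large.
  obtain ⟨n, S, hSm, hSε, hS⟩ := exists_arrived_le (o := o) hne hdeg hna K hl
    (ε := ε ^ 2) (by positivity)
  have hKtop : Tendsto (fun L => K L + 1) atTop atTop := by
    refine tendsto_atTop_mono (fun L => Nat.le_succ _) ?_
    exact tendsto_nat_ceil_atTop.comp
      (Tendsto.const_mul_atTop hc tendsto_natCast_atTop_atTop)
  obtain ⟨L₀, hL₀⟩ := exists_forall_affine_lt (A := n + 1 + 2 * (1 + ε)) hεB
  obtain ⟨L₁, hL₁⟩ := exists_nat_ge L₀
  obtain ⟨L, hspeed, hces, hLL₁, hL1⟩ :=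
    ((hX.eventually_dist_lt_le hc hb (K := fun L => K L + 1) hKlow).and
      ((hKtop.eventually (hX.eventually_sum_noReturn_le hε)).and
        ((eventually_ge_atTop L₁).and (eventually_ge_atTop 1)))).exists
  have hLL₀ : L₀ ≤ L := hL₁.trans (by exact_mod_cast hLL₁)
  have hL : (1 : ℝ) ≤ L := by exact_mod_cast hL1
  have hLpos : (0 : ℝ) < L := by linarith
  have hH := hX.isHitting_green hd hdeg (K L)
  have hlow := hX.le_sum_yield hconn hd hdeg (K L) L lam (hl L).nodup (hmem L) hspeed.le
  have hmain := hH.sum_yield_le (hl L) lam μ hSm (hS L) (t := ε / L) (by positivity)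
  have hW := hX.sum_dom_le (K L) (hl L).nodup (hl L).center
  have hRW : ((l L).map (Sweep.yield G o (K L) d lam
      fun k n y => IsSimpleRandomWalk.green P X {y | y ≠ o ∧ G.dist o y < k} n y)).sum ≤
      ((l L).map (IsSimpleRandomWalk.green P X {y | y ≠ o} (K L + 1))).sum :=
    List.sum_le_sum fun z hz => hH.yield_le fun h => (hl L).center (h ▸ hz)
  have hR0 : 0 ≤ ((l L).map (Sweep.yield G o (K L) d lam
      fun k n y => IsSimpleRandomWalk.green P X {y | y ≠ o ∧ G.dist o y < k} n y)).sum :=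
    hH.pending_nonneg ⟨∅, 0, l L, none, []⟩
  -- A crude linear bound on the total yield, sufficient for the quadratic term; the sharp bound by
  -- the escape probability is used only for `W`.
  have hWK : ∑ j ∈ Finset.range (K L + 1), IsSimpleRandomWalk.noReturn P X o (j + 1) ≤
      (K L + 1 : ℕ) := by
    refine (Finset.sum_le_sum (g := fun _ => (1 : ℝ)) fun j _ => measureReal_le_one).trans ?_
    simp
  have hN := hKup L
  have hle := le_affine_of_le hc hε hδ0 hδ1 (sub_nonneg.2 hμ1) (by linarith) hL hR0
    (hRW.trans (hW.trans (hWK.trans hN)))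
    ((hW.trans hces).trans (mul_le_mul_of_nonneg_right hN (by positivity))) hSε hmain
  have hfinal := hL₀ L hLL₀
  have hlow' : κ * L = (1 + (lam : ℝ))⁻¹ * (L * (δ - b)) := by
    rw [hκ]
    ring
  exact absurd (hfinal.trans_le (hlow'.le.trans (hlow.trans hle))) (lt_irrefl _)

end ARW

theorem theorem2 {V : Type*} [Infinite V] (G : SimpleGraph V) [G.LocallyFinite]
    (hconn : G.Connected) (htrans : IsVertexTransitive G) (o : V)
    {Ω : Type*} [MeasurableSpace Ω] (P : Measure Ω) [IsProbabilityMeasure P]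
    (X : ℕ → Ω → V) (hX : IsSimpleRandomWalk G o P X)
    (hspeed : ∀ᵐ ω ∂P, 0 < lowerSpeed G o (fun t => X t ω)) :
    (∀ lam : ℝ≥0, 0 < lam → ARW.criticalDensity G lam < 1) ∧
    (∀ α : ℝ, (∀ᵐ ω ∂P, lowerSpeed G o (fun t => X t ω) = α) →
      ∀ lam : ℝ≥0, 0 < lam →
        ARW.criticalDensity G lam <
          ((1 - α * P.real {ω | ∀ t ≥ 1, X t ω ≠ o} / (1 + (lam : ℝ)) : ℝ) : EReal)) := by
  have hcount : Countable V := hconn.countable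
  have hdeg : ∀ x, G.degree x = G.degree o := fun x => htrans.degree_eq x o
  have hd : G.degree o ≠ 0 := by
    rw [← SimpleGraph.card_neighborFinset_eq_degree]
    exact (Finset.card_pos.2 (hconn.neighborFinset_nonempty o)).ne'
  have hδ0 := hX.noReturn_pos hd hdeg hspeed
  have hδ1 := hX.noReturn_lt_one hconn
  set δ := P.real {ω | ∀ t ≥ 1, X t ω ≠ o} with hδ
  refine ⟨fun lam _ => ?_, fun α hα lam _ => ?_⟩
  · obtain ⟨c, hc, hb⟩ := hX.exists_lowerSpeed_le_lt hspeed (half_pos hδ0)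
    have hlam : (0 : ℝ) < 1 + lam := by positivity
    -- With `b = δ / 2`, the density `1 - x` must satisfy `x * δ * c < (δ / 2) / (1 + lam)`; the
    -- choice gives half of that, and the minimum keeps the density nonnegative.
    set x : ℝ := min 1 (1 / (4 * (1 + lam) * c)) with hx
    have hx0 : 0 < x := lt_min one_pos (by positivity)
    have hx1 : x ≤ 1 := min_le_left _ _
    have hxc : x ≤ 1 / (4 * (1 + lam) * c) := min_le_right _ _
    let μ : unitInterval := ⟨1 - x, by linarith, by linarith⟩
    have hμ : (μ : ℝ) = 1 - x := rfl
    have hpos : 0 < ARW.law G lam μ {ω | ARW.IsActive ω} := by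
      refine ARW.law_isActive_pos hconn htrans hX hc hb ?_
      rw [hμ, ← hδ]
      calc (1 - (1 - x)) * (δ * c) = x * (δ * c) := by ring
        _ ≤ 1 / (4 * (1 + lam) * c) * (δ * c) := by gcongr
        _ = (1 + (lam : ℝ))⁻¹ * (δ / 4) := by field_simp
        _ < (1 + (lam : ℝ))⁻¹ * (δ - δ / 2) := by
          refine mul_lt_mul_of_pos_left (by linarith) (by positivity)
    refine (ARW.criticalDensity_le hpos).trans_lt ?_
    rw [hμ, ← EReal.coe_one, EReal.coe_lt_coe_iff]
    linarith
  · obtain ⟨ω, hω0, hωα, hω1⟩ :=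
      (hspeed.and (hα.and (hX.lowerSpeed_le_one hconn hd hdeg))).exists
    rw [hωα] at hω0 hω1
    have hlam : (1 : ℝ) ≤ 1 + lam := by simp
    have hlam0 : (0 : ℝ) < 1 + lam := by linarith
    -- The vacancy `x` lies strictly between the claimed `α δ / (1 + λ)` and the threshold `α / (1 +
    -- λ)` of the argument, as `δ < 1`.
    set x : ℝ := α * (1 + δ) / 2 / (1 + lam) with hx
    have hx0 : 0 < x := by positivity
    have hx1 : x ≤ 1 := by
      rw [hx, div_le_one hlam0]
      nlinarith
    let μ : unitInterval := ⟨1 - x, by linarith, by linarith⟩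
    have hμ : (μ : ℝ) = 1 - x := rfl
    -- `c⁻¹ = α (3 + δ) / 4` lies strictly between `α (1 + δ) / 2` and `α`: the walk is faster than
    -- `c⁻¹`, and `x * c` remains below `1 / (1 + λ)`.
    set c : ℝ := 4 / (α * (3 + δ)) with hc
    have hc0 : 0 < c := by positivity
    have hxc : x * c = (1 + (lam : ℝ))⁻¹ * (2 * (1 + δ) / (3 + δ)) := by
      rw [hx, hc]
      field_simp
      ring
    have hq : 2 * (1 + δ) / (3 + δ) < 1 := by
      rw [div_lt_one (by linarith)]
      linarith
    have hcα : c⁻¹ < α := by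
      rw [hc, inv_div, div_lt_iff₀ (by norm_num)]
      nlinarith
    have hzero : P.real {ω | lowerSpeed G o (fun t => X t ω) ≤ c⁻¹} = 0 := by
      rw [measureReal_eq_zero_iff]
      refine measure_mono_null (fun ω hω => ?_) hα
      intro h
      have h1 : lowerSpeed G o (fun t => X t ω) = α := h
      have h2 : lowerSpeed G o (fun t => X t ω) ≤ c⁻¹ := hω
      linarith
    have hpos : 0 < ARW.law G lam μ {ω | ARW.IsActive ω} := by
      refine ARW.law_isActive_pos hconn htrans hX hc0
        -- Half of the gap between `δ` and `δ * (x * c * (1 + λ))`; any smaller positive value would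
        -- do, because the probability of a speed at most `c⁻¹` is zero.
        (b := δ * (1 - 2 * (1 + δ) / (3 + δ)) / 2) ?_ ?_
      · rw [hzero]
        have := sub_pos.2 hq
        positivity
      · rw [hμ, ← hδ]
        calc (1 - (1 - x)) * (δ * c) = δ * (x * c) := by ring
          _ = (1 + (lam : ℝ))⁻¹ * (δ * (2 * (1 + δ) / (3 + δ))) := by rw [hxc]; ring
          _ < _ := by
            refine mul_lt_mul_of_pos_left ?_ (by positivity)
            have := mul_pos hδ0 (sub_pos.2 hq)
            linarith
    refine (ARW.criticalDensity_le hpos).trans_lt ?_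
    rw [hμ, EReal.coe_lt_coe_iff]
    have : α * δ / (1 + (lam : ℝ)) < x := by
      rw [hx]
      refine div_lt_div_of_pos_right ?_ hlam0
      nlinarith
    linarith
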